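/- Let $K$ be an infinite field, $X$ a projective $K$-variety (an integral closed $K$-subscheme of some projective space), $L$ a line bundle on $X$, and $V=H^0(X,L)$. An embedding $X\to\mathbb P^r$ means a closed immersion of $K$-schemes. An algebraic isotopy between embeddings $\psi_0,\psi_1\colon X\to\mathbb P^r$ is a $K$-morphism $I\colon\mathbb A^1\times X\to\mathbb P^r$ such that for every scheme-theoretic point $t\in\mathbb A^1$ the induced morphism $I_t\colon X_{\kappa(t)}\to\mathbb P^r_{\kappa(t)}$ is a closed immersion and such that $I_0=\psi_0$, $I_1=\psi_1$. Two embeddings are algebraically isotopic if they are connected by a chain of algebraic isotopies. Let $\mathrm{Emb}_L(X,\mathbb P^r)(K)$ be the set of embeddings $\psi\colon X\to\mathbb P^r$ with $\psi^*\mathcal O_{\mathbb P^r}(1)\cong L$, and let $[X,\mathbb P^r]^{\mathrm I}_L$ be its set of classes under algebraic isotopy. Let $\Sigma=\Sigma(X,L)\subseteq\mathbb P(V^\vee)$ be the secant variety, i.e. the closed subvariety whose points over an algebraic closure $\overline K$ are the points of $X$ and of the lines spanned by the subschemes of length two of $X_{\overline K}$ (the secant lines through two distinct points and the tangent lines; for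 $X$ smooth over $K$ this is the closure of the union of $X$ and the secant lines). Here a point of $\mathbb P(V^\vee)$ over $\overline K$ is a functional $V\to\overline K$ up to scalars, and the span of a morphism $z\colon\operatorname{Spec}A\to X$ with $\dim_{\overline K}A=2$ consists of the functionals $s\mapsto\lambda(z^*s)$, where $\lambda$ is a $\overline K$-linear functional on $H^0(\operatorname{Spec}A,z^*L)$. Let $b=\dim\Sigma$. (If $L$ is not very ample, then $\mathrm{Emb}_L(X,\mathbb P^r)(K)$ is empty and the statements below are void.) Let $r\ge 0$ be an integer. 1. If $r>b$, then any two embeddings $\psi,\psi'\in\mathrm{Emb}_L(X,\mathbb P^r)(K)$ are algebraically isotopic. 2. If $r\neq b$, then $[X,\mathbb P^r]^{\mathrm I}_L$ has at most one element. 3. If $X$ is a curve (a projective $K$-variety that is smooth of dimension $1$ over $K$) and $r\geq 4$, then $[X,\mathbb P^r]^{\mathrm I}_L$ has at most one element. -/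

import Mathlib

open AlgebraicGeometry CategoryTheory TopologicalSpace Opposite

universe u

namespace TwistingSheaf

noncomputable section

variable {A σ : Type u} [CommRing A] [SetLike σ A] [AddSubgroupClass σ A]
variable (𝒜 : ℕ → σ) [GradedRing 𝒜] (d : ℕ)

/-! ### Serre's twisting sheaf `𝒪(d)` on `Proj A` -/

/-- The complement in `A` of the homogeneous prime `x ∈ Proj A`. -/
abbrev compl (x : ProjectiveSpectrum 𝒜) : Submonoid A :=
  x.asHomogeneousIdeal.toIdeal.primeCompl

/-- The localization `A_x` of the graded ring `A` at the homogeneous prime `x ∈ Proj A`. -/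
abbrev Loc (x : ProjectiveSpectrum 𝒜) : Type u :=
  Localization (compl 𝒜 x)

/-- `f` is given on all of `U` by a single fraction `a / b` with `a`, `b` homogeneous and
`deg a = deg b + d`. -/
def IsFraction {U : Opens (ProjectiveSpectrum.top 𝒜)} (f : ∀ x : U, Loc 𝒜 x.1) : Prop :=
  ∃ (i : ℕ) (a b : A) (_ : a ∈ 𝒜 (i + d)) (_ : b ∈ 𝒜 i)
    (hb : ∀ x : U, b ∈ compl 𝒜 x.1),
    ∀ x : U, f x = Localization.mk a ⟨b, hb x⟩

/-- Being given by a single fraction is stable under restriction. -/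
def isFractionPrelocal : TopCat.PrelocalPredicate fun x : ProjectiveSpectrum.top 𝒜 => Loc 𝒜 x where
  pred f := IsFraction 𝒜 d f
  res := by
    rintro V U i f ⟨j, a, b, ha, hb, hn, h⟩
    exact ⟨j, a, b, ha, hb, fun x => hn (i x), fun x => h (i x)⟩

/-- `f` is locally given by fractions `a / b` with `deg a = deg b + d`. -/
def isLocallyFraction : TopCat.LocalPredicate fun x : ProjectiveSpectrum.top 𝒜 => Loc 𝒜 x :=
  (isFractionPrelocal 𝒜 d).sheafify

/-- The sections of `𝒪(d)` over `U`. -/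
def sections (U : (Opens (ProjectiveSpectrum.top 𝒜))ᵒᵖ) : AddSubgroup (∀ x : U.unop, Loc 𝒜 x.1) where
  carrier := {f | (isLocallyFraction 𝒜 d).pred f}
  zero_mem' x := ⟨unop U, x.2, 𝟙 _, 0, 0, 1, zero_mem _, SetLike.GradedOne.one_mem,
    fun y => one_mem _, fun y => (Localization.mk_zero _).symm⟩
  add_mem' {f g} hf hg x := by
    obtain ⟨V, hV, iV, j, a, b, ha, hb, hn, h⟩ := hf x
    obtain ⟨W, hW, iW, k, a', b', ha', hb', hn', h'⟩ := hg x
    refine ⟨V ⊓ W, ⟨hV, hW⟩, Opens.infLELeft _ _ ≫ iV, j + k, b' * a + b * a', b * b', ?_,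
      SetLike.mul_mem_graded hb hb', fun y => mul_mem (hn ⟨y.1, y.2.1⟩) (hn' ⟨y.1, y.2.2⟩), ?_⟩
    · refine add_mem ?_ ?_
      · rw [show j + k + d = k + (j + d) by omega]
        exact SetLike.mul_mem_graded hb' ha
      · rw [add_assoc]
        exact SetLike.mul_mem_graded hb ha'
    · intro y
      have e1 := h ⟨y.1, y.2.1⟩
      have e2 := h' ⟨y.1, y.2.2⟩
      change f _ + g _ = _
      refine (congrArg₂ (· + ·) e1 e2).trans ?_
      simp only [Localization.add_mk]
      rw [add_comm]
      rfl
  neg_mem' {f} hf x := by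
    obtain ⟨V, hV, iV, j, a, b, ha, hb, hn, h⟩ := hf x
    refine ⟨V, hV, iV, j, -a, b, neg_mem ha, hb, hn, fun y => ?_⟩
    have := h y
    change - f _ = _
    refine (congrArg Neg.neg this).trans ?_
    rw [Localization.neg_mk]

/-- The sheaf of sets underlying `𝒪(d)`. -/
def sheafInType : TopCat.Sheaf (Type u) (ProjectiveSpectrum.top 𝒜) :=
  TopCat.subsheafToTypes (isLocallyFraction 𝒜 d)

/-- The presheaf of abelian groups underlying `𝒪(d)`. -/
def presheafInAb : (Opens (ProjectiveSpectrum.top 𝒜))ᵒᵖ ⥤ Ab.{u} where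
  obj U := AddCommGrpCat.of (sections 𝒜 d U)
  map {U V} i := AddCommGrpCat.ofHom
    { toFun := fun s => ⟨fun x => s.1 (i.unop x), ((sheafInType 𝒜 d).1.map i s).2⟩
      map_zero' := rfl
      map_add' := fun _ _ => rfl }

theorem mul_mem_sections (U : (Opens (ProjectiveSpectrum.top 𝒜))ᵒᵖ)
    (r : (ProjectiveSpectrum.Proj.structureSheaf 𝒜).1.obj U) (s : sections 𝒜 d U) :
    (fun x : U.unop => ((r.1 x).val : Loc 𝒜 x.1) * s.1 x) ∈ sections 𝒜 d U := fun x => by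
  obtain ⟨V, hV, iV, j, ⟨a, ha⟩, ⟨b, hb⟩, hn, h⟩ := r.2 x
  obtain ⟨W, hW, iW, k, a', b', ha', hb', hn', h'⟩ := s.2 x
  refine ⟨V ⊓ W, ⟨hV, hW⟩, Opens.infLELeft _ _ ≫ iV, j + k, a * a', b * b', ?_,
    SetLike.mul_mem_graded hb hb', fun y => mul_mem (hn ⟨y.1, y.2.1⟩) (hn' ⟨y.1, y.2.2⟩), ?_⟩
  · rw [add_assoc]
    exact SetLike.mul_mem_graded ha ha'
  · intro y
    have e1 := (congrArg HomogeneousLocalization.val (h ⟨y.1, y.2.1⟩)).trans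
      (HomogeneousLocalization.val_mk _)
    have e2 := h' ⟨y.1, y.2.2⟩
    exact (congrArg₂ (· * ·) e1 e2).trans (Localization.mk_mul _ _ _ _)

/-- A regular function acts on a section of `𝒪(d)` by pointwise multiplication in `A_x`. -/
instance sectionsModule (U : (Opens (Proj 𝒜))ᵒᵖ) :
    Module ((Proj 𝒜).ringCatSheaf.obj.obj U) ((presheafInAb 𝒜 d).obj U) where
  smul r s := ⟨_, mul_mem_sections 𝒜 d U r s⟩
  one_smul s := Subtype.ext <| funext fun x => by
    refine (congrArg (· * s.1 x) HomogeneousLocalization.val_one).trans (one_mul _)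
  mul_smul r r' s := Subtype.ext <| funext fun x =>
    (congrArg (· * s.1 x) (HomogeneousLocalization.val_mul _ _)).trans (mul_assoc _ _ _)
  smul_zero r := Subtype.ext <| funext fun x => mul_zero _
  smul_add r s s' := Subtype.ext <| funext fun x => mul_add _ _ _
  add_smul r r' s := Subtype.ext <| funext fun x =>
    (congrArg (· * s.1 x) (HomogeneousLocalization.val_add _ _)).trans (add_mul _ _ _)
  zero_smul s := Subtype.ext <| funext fun x =>
    (congrArg (· * s.1 x) HomogeneousLocalization.val_zero).trans (zero_mul _)

/-- `𝒪(d)` as a presheaf of modules on `Proj A`. -/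
def presheafOfModules : (Proj 𝒜).PresheafOfModules :=
  letI (U : (Opens (Proj 𝒜))ᵒᵖ) := sectionsModule 𝒜 d U
  .ofPresheaf (C := Opens (Proj 𝒜)) (presheafInAb 𝒜 d) fun _ _ _ _ _ => rfl

/-- Serre's twisting sheaf `𝒪(d)` on `Proj A`: its sections over `U` are the functions
`x ↦ s(x) ∈ A_x` that are locally of the form `a / b` with `a`, `b` homogeneous and
`deg a = deg b + d`. -/
def _root_.AlgebraicGeometry.Proj.twist : (Proj 𝒜).Modules where
  val := presheafOfModules 𝒜 d
  isSheaf := (TopCat.Presheaf.isSheaf_iff_isSheaf_comp (forget AddCommGrpCat) _).2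
    (sheafInType 𝒜 d).2

end

end TwistingSheaf

namespace ProjectiveEmbedding

noncomputable section

open Limits

variable (K : Type u) [Field K]

/-- The base scheme `Spec K`. -/
abbrev Base : Scheme.{u} := Spec (CommRingCat.of K)

/-! ### Projective space and `𝒪(1)` -/

/-- The standard grading on `K[x₀, …, x_r]`. -/
abbrev grading (r : ℕ) : ℕ → Submodule K (MvPolynomial (Fin (r + 1)) K) :=
  MvPolynomial.homogeneousSubmodule (Fin (r + 1)) K

instance gradedAlgebraGrading (r : ℕ) : GradedAlgebra (grading K r) := MvPolynomial.gradedAlgebra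

/-- Projective space `ℙ^r = Proj K[x₀, …, x_r]` over `K`. -/
def ProjSpace (r : ℕ) : Scheme.{u} := Proj (grading K r)

/-- The structure morphism `ℙ^r → Spec K`. -/
instance projSpaceOver (r : ℕ) : (ProjSpace K r).Over (Base K) where
  hom := Proj.toSpecZero (grading K r) ≫
    Spec.map (CommRingCat.ofHom (algebraMap K (grading K r 0)))

/-- The line bundle `𝒪(1)` on `ℙ^r`. -/
def twistOne (r : ℕ) : (ProjSpace K r).Modules := Proj.twist (grading K r) 1

variable (X : Scheme.{u}) [X.Over (Base K)]

/-! ### Projective varieties, curves and line bundles -/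

/-- A projective `K`-variety: an integral closed `K`-subscheme of some projective space. -/
class IsProjectiveVariety : Prop where
  isIntegral : IsIntegral X
  exists_closedImmersion : ∃ (n : ℕ) (i : X ⟶ ProjSpace K n),
    IsClosedImmersion i ∧ i ≫ (ProjSpace K n ↘ Base K) = X ↘ Base K

/-- A curve over `K`: a projective `K`-variety that is smooth of dimension `1` over `K`. -/
class IsCurve : Prop extends IsProjectiveVariety K X where
  smooth : SmoothOfRelativeDimension 1 (X ↘ Base K)

/-- A sheaf of modules is a line bundle if it is locally isomorphic to the structure sheaf. -/
def IsLineBundle {X : Scheme.{u}} (L : X.Modules) : Prop :=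
  ∀ x : X, ∃ U : X.Opens, x ∈ U ∧
    Nonempty (L.restrict U.ι ≅ (SheafOfModules.unit U.toScheme.ringCatSheaf : U.toScheme.Modules))

/-! ### Embeddings and algebraic isotopies -/

/-- Embeddings `X → ℙ^r` over `K`, i.e. closed immersions of `K`-schemes. -/
structure Embedding (r : ℕ) where
  /-- the underlying morphism -/
  hom : X ⟶ ProjSpace K r
  isClosedImmersion : IsClosedImmersion hom
  isOver : hom ≫ (ProjSpace K r ↘ Base K) = X ↘ Base K

/-- The affine line over `K`. -/
abbrev A1 : Scheme.{u} := 𝔸(PUnit.{u + 1}; Base K)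

/-- The `K`-rational point of the affine line with coordinate `a`. -/
def A1.point (a : K) : Base K ⟶ A1 K :=
  AffineSpace.homOfVector (𝟙 (Base K)) fun _ => (Scheme.ΓSpecIso (CommRingCat.of K)).inv a

/-- The product `𝔸¹ × X` over `K`. -/
abbrev A1Prod : Scheme.{u} := pullback (A1 K ↘ Base K) (X ↘ Base K)

/-- The inclusion `X → 𝔸¹ × X`, `x ↦ (a, x)`, of the fibre over the rational point `a`. -/
def slice (a : K) : X ⟶ A1Prod K X :=
  pullback.lift ((X ↘ Base K) ≫ A1.point K a) (𝟙 X) (by simp [A1.point])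

/-- The structure morphism `Spec κ(t) → Spec K` of the residue field of a point `t ∈ 𝔸¹`. -/
def residueBase (t : A1 K) : Spec ((A1 K).residueField t) ⟶ Base K :=
  (A1 K).fromSpecResidueField t ≫ (A1 K ↘ Base K)

/-- The base change `Y_{κ(t)}` of a `K`-scheme `Y`. -/
abbrev baseChange (Y : Scheme.{u}) [Y.Over (Base K)] (t : A1 K) : Scheme.{u} :=
  pullback (Y ↘ Base K) (residueBase K t)

variable {K X} in
/-- The morphism `I_t : X_{κ(t)} → ℙ^r_{κ(t)}`, `x ↦ I(t, x)`, induced by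
`I : 𝔸¹ × X → ℙ^r` at a point `t ∈ 𝔸¹`. -/
def atPoint {r : ℕ} (I : A1Prod K X ⟶ ProjSpace K r)
    (hI : I ≫ (ProjSpace K r ↘ Base K) = pullback.snd _ _ ≫ (X ↘ Base K)) (t : A1 K) :
    baseChange K X t ⟶ baseChange K (ProjSpace K r) t :=
  pullback.lift
    (pullback.lift (pullback.snd _ _ ≫ (A1 K).fromSpecResidueField t) (pullback.fst _ _)
      (by rw [Category.assoc]; exact pullback.condition.symm) ≫ I)
    (pullback.snd _ _)
    (by rw [Category.assoc, hI, pullback.lift_snd_assoc, pullback.condition])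

variable {K X} in
/-- There is an algebraic isotopy from `ψ₀` to `ψ₁`: a `K`-morphism `I : 𝔸¹ × X → ℙ^r` such that
`I_t` is a closed embedding for every (scheme-theoretic) point `t ∈ 𝔸¹`, with `I_0 = ψ₀` and
`I_1 = ψ₁`. -/
def IsElementaryIsotopic {r : ℕ} (ψ₀ ψ₁ : Embedding K X r) : Prop :=
  ∃ (I : A1Prod K X ⟶ ProjSpace K r)
    (hI : I ≫ (ProjSpace K r ↘ Base K) = pullback.snd _ _ ≫ (X ↘ Base K)),
    (∀ t : A1 K, IsClosedImmersion (atPoint I hI t)) ∧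
    slice K X 0 ≫ I = ψ₀.hom ∧ slice K X 1 ≫ I = ψ₁.hom

/-- Algebraic isotopy of embeddings: the equivalence relation generated by the existence of an
algebraic isotopy, i.e. connectedness by a chain of algebraic isotopies. -/
def isotopySetoid (r : ℕ) : Setoid (Embedding K X r) := Relation.EqvGen.setoid IsElementaryIsotopic

variable {K X} in
/-- The embeddings `ψ` and `ψ'` are algebraically isotopic. -/
def AlgebraicallyIsotopic {r : ℕ} (ψ ψ' : Embedding K X r) : Prop := isotopySetoid K X r ψ ψ'

variable {X} in
/-- `Emb_L(X, ℙ^r)(K)`: the embeddings `ψ : X → ℙ^r` with `ψ^* 𝒪(1) ≅ L`. -/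
def EmbL (L : X.Modules) (r : ℕ) : Type u :=
  {ψ : Embedding K X r // Nonempty ((Scheme.Modules.pullback ψ.hom).obj (twistOne K r) ≅ L)}

variable {X} in
/-- The set `[X, ℙ^r]^I_L` of isotopy classes of embeddings with line bundle `L`. -/
def IsotopyClasses (L : X.Modules) (r : ℕ) : Type u :=
  Quotient ((isotopySetoid K X r).comap (Subtype.val : EmbL K L r → Embedding K X r))

/-! ### The secant variety -/

variable {X} (L : X.Modules)

/-- The space `V = H⁰(X, L)` of global sections. -/
def GlobalSections : Type u := Γ(L, (⊤ : X.Opens))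

instance globalSectionsAddCommGroup : AddCommGroup (GlobalSections L) := inferInstanceAs (AddCommGroup Γ(L, (⊤ : X.Opens)))

/-- The `K`-vector space structure on `H⁰(X, L)`, via `K → Γ(X, 𝒪_X)`. -/
instance globalSectionsModule : Module K (GlobalSections L) :=
  Module.compHom Γ(L, (⊤ : X.Opens))
    ((Scheme.ΓSpecIso (CommRingCat.of K)).inv ≫ (X ↘ Base K).appTop).hom

/-- The pullback `z^* s` of a global section `s` of `L` along `z : Z → X`. -/
def pullbackSection {Z : Scheme.{u}} (z : Z ⟶ X) (s : GlobalSections L) :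
    Γ((Scheme.Modules.pullback z).obj L, (⊤ : Z.Opens)) :=
  ((Scheme.Modules.pullbackPushforwardAdjunction z).unit.app L).app ⊤ s

/-- The set of `K̄`-points of the affine cone in `V^∨` over the secant variety `Σ(X, L) ⊆ ℙ(V^∨)`.

The secant variety is the union of the lines in `ℙ(V^∨)` spanned by the subschemes of length two
of `X` over `K̄`, i.e. of the secant lines through two points and of the tangent lines (and of
`X` itself). For a two-dimensional `K̄`-algebra `A` and `z : Spec A → X`, the linear span of the
image of `z` consists of the functionals `s ↦ lam (z^* s)` on `V`, where `lam` runs through the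
`K̄`-linear functionals on the space of global sections of `z^* L`. -/
def secantCone : Set (GlobalSections L →ₗ[K] AlgebraicClosure K) :=
  {ℓ | ∃ (A : CommRingCat.{u}) (_ : Algebra (AlgebraicClosure K) A) (z : Spec A ⟶ X)
      (lam : Γ((Scheme.Modules.pullback z).obj L, (⊤ : (Spec A).Opens)) →+ AlgebraicClosure K),
    Module.finrank (AlgebraicClosure K) A = 2 ∧
    z ≫ (X ↘ Base K) = Spec.map (CommRingCat.ofHom
      ((algebraMap (AlgebraicClosure K) A).comp (algebraMap K (AlgebraicClosure K)))) ∧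
    (∀ c m, lam (algebraMap (AlgebraicClosure K) A c • m) = c * lam m) ∧
    ∀ s, ℓ s = lam (pullbackSection L z s)}

/-- The homogeneous ideal of the secant variety in the coordinate ring `Sym V` of `ℙ(V^∨)`. -/
def secantIdeal : Ideal (SymmetricAlgebra K (GlobalSections L)) :=
  ⨅ ℓ ∈ secantCone K L, RingHom.ker (SymmetricAlgebra.lift ℓ)

/-- The homogeneous coordinate ring of the secant variety. -/
abbrev SecantCoordinateRing : Type u :=
  SymmetricAlgebra K (GlobalSections L) ⧸ secantIdeal K L

/-- The dimension `b` of the secant variety `Σ(X, L)`: one less than the Krull dimension of its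
homogeneous coordinate ring, i.e. than the dimension of the affine cone over it. (The truncation
of the subtraction could only matter if `Σ` were empty, which is impossible for very ample `L`.) -/
def secantDim : WithBot ℕ∞ := (ringKrullDim (SecantCoordinateRing K L)).map (· - 1)

end

end ProjectiveEmbedding

open ProjectiveEmbedding

/-!
Fix embeddings `ψ : X → ℙ^r` with `ψ^* 𝒪(1) ≅ L`. Such an embedding is given by a tuple
`x₀, …, x_r` of sections of `L` without common zeros (`Frame`, `exists_frame`), that is, by the
linear projection `ℓ ↦ (ℓ(x₀), …, ℓ(x_r))` of `ℙ(V^∨)`. The proof moves one tuple into another along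
straight lines and studies the projection of the cone over the secant variety `Σ`.

*Straight lines.* The family `[p₀ + t q₀ : … : p_r + t q_r]` is an algebraic isotopy as soon as no
nonzero functional in the cone over `Σ` is killed by all `pᵢ + t qᵢ`, for any `t` in the algebraic
closure `K̄` (`AvoidsSecants`, `exists_isotopy`). Points of `X` lie on `Σ`, so the family is
defined everywhere. If it were constant on a subscheme `Spec A` of length two, the values of the
`pᵢ + t qᵢ` on it would be multiples of one element of `A`, hence be killed by a functional on
`A`; this functional is an element of the cone, hence zero there, which forces the subscheme to be
a point (`separatesLengthTwo`). So the morphism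
`𝔸¹ × X → 𝔸¹ × ℙ^r` separates subschemes of length two. This makes it unramified and injective on points
over `K̄`, i.e. a monomorphism (`SeparatesLengthTwo.mono`); the fibres of the family are proper
monomorphisms, which are closed immersions.

*Coordinates of an embedding are a finite projection of `Σ`.* The coordinate ring of `Σ` is
integral over the polynomials in the `xᵢ` (`Frame.isIntegralElem_onCone`). By a valuative
criterion (`isIntegralElem_of_forall_hom`), it is enough that a functional on a quadratic algebra
over a valued field which is integral on all `xᵢ` is integral on every section of `L`. Sections
satisfy relations `s xₖ ^ N = Gₖ(x)` with `Gₖ` homogeneous, as `ψ` is a closed immersion; after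
division by a combination of the `xᵢ` that has maximal valuation at both points of the quadratic
algebra, they lie in a subring on which the functional is integral
(`functional_mem_of_relations`). Consequently the `xᵢ` kill no nonzero element of the cone
(`Frame.eq_zero_of_coord`), and the cone has dimension at most `r + 1`, that is `b ≤ r`
(`Frame.secantDim_le`). Therefore `r ≠ b` is the same as `r > b` as soon as there is an embedding.

*Large dimension.* Let `x` and `x'` be the tuples of two embeddings, and suppose that the image
under `(x, x')` of the cone has dimension at most `r`. For `r + 1` general linear combinations `g`
of `x` and `x'`, each equation `gᵢ = c xᵢ` cuts down the dimension of the product of this image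
with the line of all `c`, so these equations have only the trivial solution, and likewise for `x'`
(`exists_generic_linearForms`). With the previous paragraph, the straight lines from `x` to `g`
and from `x'` to `g` are both isotopies (`algebraicallyIsotopic_of_ringKrullDim_le`). The
hypothesis holds if `r > b`.

*Curves.* For a smooth curve the image of the cone has dimension at most four
(`Frame.ringKrullDim_quotient_coneIdeal_le_four`): a functional is a combination of two points, or
of a point and a derivative there, and each point depends algebraically on one parameter
(`IsParameter.isAlgebraic`). The case `r ≥ 4` follows without comparing `r` and `b`.
-/

/-! ### Free generators of sheaves of modules -/

namespace AlgebraicGeometry.Scheme.Modules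

variable {X Y Z : Scheme.{u}}

/-- The restriction to the open set `U` of a global section of a sheaf of modules. -/
noncomputable def resTop {M : X.Modules} (h : Γ(M, ⊤)) (U : X.Opens) : Γ(M, U) :=
  M.presheaf.map (homOfLE (le_top : U ≤ ⊤)).op h

/-- The global section `h` of `M` is a free generator of `M` over the open set `U`. -/
def IsGenerator (M : X.Modules) (h : Γ(M, ⊤)) (U : X.Opens) : Prop :=
  ∀ W : X.Opens, W ≤ U → Function.Bijective fun a : Γ(X, W) => (a • resTop h W : Γ(M, W))

theorem res_resTop {M : X.Modules} (h : Γ(M, ⊤)) {U V : X.Opens} (i : U ⟶ V) :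
    M.presheaf.map i.op (resTop h V) = resTop h U := by
  unfold resTop
  rw [← ConcreteCategory.comp_apply, ← Functor.map_comp]
  rfl

theorem app_res {M N : X.Modules} (φ : M ⟶ N) {U V : X.Opens} (i : U ⟶ V) (s : Γ(M, V)) :
    φ.app U (M.presheaf.map i.op s) = N.presheaf.map i.op (φ.app V s) :=
  ConcreteCategory.congr_hom (φ.mapPresheaf.naturality i.op) s

theorem app_resTop {M N : X.Modules} (φ : M ⟶ N) (h : Γ(M, ⊤)) (U : X.Opens) :
    φ.app U (resTop h U) = resTop (φ.app ⊤ h) U :=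
  app_res φ _ h

theorem IsGenerator.of_iso {M N : X.Modules} (e : M ≅ N) {h : Γ(M, ⊤)} {U : X.Opens}
    (H : IsGenerator M h U) : IsGenerator N (e.hom.app ⊤ h) U := by
  intro W hW
  have hb : Function.Bijective (e.hom.app W) := by
    have : IsIso (e.hom.app W) := inferInstance
    exact ConcreteCategory.bijective_of_isIso _
  have := hb.comp (H W hW)
  convert this using 1
  ext a
  simp [app_resTop]

/-- The image of a section under the unit of the pullback-pushforward adjunction. -/
noncomputable def pullTop (f : Y ⟶ X) {M : X.Modules} (h : Γ(M, ⊤)) :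
    Γ((pullback f).obj M, ⊤) :=
  ((pullbackPushforwardAdjunction f).unit.app M).app ⊤ h

theorem pullTop_naturality (f : Y ⟶ X) {M N : X.Modules} (φ : M ⟶ N) (h : Γ(M, ⊤)) :
    ((pullback f).map φ).app ⊤ (pullTop f h) = pullTop f (φ.app ⊤ h) := by
  have := (pullbackPushforwardAdjunction f).unit.naturality φ
  exact (ConcreteCategory.congr_hom (congrArg (fun ψ => Hom.app ψ ⊤) this) h).symm

variable (X) in
/-- The structure sheaf as a module over itself. -/
noncomputable abbrev structureModule : X.Modules := SheafOfModules.unit X.ringCatSheaf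

variable (X) in
/-- The global section `1` of the structure sheaf. -/
noncomputable def oneSection : Γ(structureModule X, ⊤) := (1 : Γ(X, ⊤))

theorem isGenerator_one : IsGenerator (structureModule X) (oneSection X) ⊤ := by
  intro W _
  have h1 : resTop (oneSection X) W = (1 : Γ(X, W)) := map_one (X.presheaf.map _).hom
  have : (fun a : Γ(X, W) => (a • resTop (oneSection X) W : Γ(structureModule X, W))) =
      fun a : Γ(X, W) => a := by
    funext a
    rw [h1]
    exact mul_one a
  rw [this]
  exact Function.bijective_id

theorem exists_hom_structureModule {M : X.Modules} (h : Γ(M, ⊤)) :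
    ∃ φ : structureModule X ⟶ M, φ.app ⊤ (oneSection X) = h := by
  let s : SheafOfModules.sections M := PresheafOfModules.sectionsMk
    (fun U => resTop h U.unop) (fun U V i => res_resTop h i.unop)
  refine ⟨(SheafOfModules.unitHomEquiv M).symm s, ?_⟩
  have h1 := congrArg (fun t => t.val (op ⊤)) ((SheafOfModules.unitHomEquiv M).apply_symm_apply s)
  refine h1.trans ?_
  change M.presheaf.map _ h = h
  have : (homOfLE (le_top : (⊤ : X.Opens) ≤ ⊤)).op = 𝟙 _ := rfl
  rw [this, M.presheaf.map_id]
  rfl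

theorem isIso_of_isGenerator {M : X.Modules} (φ : structureModule X ⟶ M)
    (H : IsGenerator M (φ.app ⊤ (oneSection X)) ⊤) : IsIso φ := by
  rw [Hom.isIso_iff_isIso_app]
  intro U
  rw [ConcreteCategory.isIso_iff_bijective]
  have h1 : resTop (oneSection X) U = (1 : Γ(X, U)) := map_one (X.presheaf.map _).hom
  have : (fun a : Γ(X, U) => (a • resTop (φ.app ⊤ (oneSection X)) U : Γ(M, U))) =
      fun a : Γ(X, U) => φ.app U a := by
    funext a
    rw [← app_resTop, ← Hom.app_smul, h1]
    exact congrArg (φ.app U) (mul_one a)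
  have h2 := H U le_top
  rw [this] at h2
  exact h2

theorem exists_iso_of_isGenerator {M : X.Modules} {h : Γ(M, ⊤)} (H : IsGenerator M h ⊤) :
    ∃ e : structureModule X ≅ M, e.hom.app ⊤ (oneSection X) = h := by
  obtain ⟨φ, rfl⟩ := exists_hom_structureModule h
  have := isIso_of_isGenerator φ H
  exact ⟨asIso φ, rfl⟩

/-- The inverse image functor on open sets is final because it preserves the terminal object; this
is what Mathlib needs to identify the pullback of the structure sheaf. -/
theorem final_opensMap (f : Y ⟶ X) : (Opens.map f.base).Final where
  out U := by
    let T : StructuredArrow U (Opens.map f.base) :=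
      StructuredArrow.mk (Y := (⊤ : X.Opens)) (homOfLE le_top)
    refine isConnected_of_isTerminal _ (x := T) (Limits.IsTerminal.ofUniqueHom
      (fun A => StructuredArrow.homMk (homOfLE le_top) (Subsingleton.elim _ _)) ?_)
    intro A m
    exact StructuredArrow.hom_ext _ _ (Subsingleton.elim _ _)

/-- The pullback of the structure sheaf is the structure sheaf, and `1` pulls back to `1`. -/
theorem exists_pullback_unit_iso (f : Y ⟶ X) :
    ∃ e : (pullback f).obj (structureModule X) ≅ structureModule Y,
      e.hom.app ⊤ (pullTop f (oneSection X)) = oneSection Y := by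
  have := final_opensMap f
  have : (SheafOfModules.pushforward.{u} f.toRingCatSheafHom).IsRightAdjoint :=
    (pullbackPushforwardAdjunction f).isRightAdjoint
  let F := SheafOfModules.pullbackObjUnitToUnit f.toRingCatSheafHom
  have : IsIso F := SheafOfModules.instIsIsoPullbackObjUnitToUnitOfFinal (F := Opens.map f.base)
    f.toRingCatSheafHom
  refine ⟨@asIso Y.Modules _ _ _ F this, ?_⟩
  have h := SheafOfModules.pullbackPushforwardAdjunction_homEquiv_pullbackObjUnitToUnit
    f.toRingCatSheafHom
  rw [Adjunction.homEquiv_unit] at h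
  have h2 := congrArg (fun t => t.val.app (op ⊤) (1 : Γ(X, ⊤))) h
  refine h2.trans ?_
  exact map_one (f.app ⊤).hom

theorem IsGenerator.pullback_top (f : Y ⟶ X) {M : X.Modules} {h : Γ(M, ⊤)}
    (H : IsGenerator M h ⊤) : IsGenerator ((pullback f).obj M) (pullTop f h) ⊤ := by
  obtain ⟨e, rfl⟩ := exists_iso_of_isGenerator H
  obtain ⟨e', he'⟩ := exists_pullback_unit_iso f
  have h1 := (isGenerator_one (X := Y)).of_iso e'.symm
  have h2 : e'.symm.hom.app ⊤ (oneSection Y) = pullTop f (oneSection X) := by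
    rw [← he', ← ConcreteCategory.comp_apply]
    change (e'.hom ≫ e'.inv).app ⊤ _ = _
    rw [e'.hom_inv_id]
    rfl
  rw [h2] at h1
  have h3 := h1.of_iso ((pullback f).mapIso e)
  rw [← pullTop_naturality]
  exact h3

theorem resTop_app_top {M : X.Modules} (h : Γ(M, ⊤)) : resTop h ⊤ = h := by
  change M.presheaf.map (𝟙 (op ⊤)) h = h
  rw [M.presheaf.map_id]
  rfl

/-- The restriction of a global section along an open immersion. -/
noncomputable def restrictTop (f : Y ⟶ X) [IsOpenImmersion f] {M : X.Modules} (h : Γ(M, ⊤)) :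
    Γ(M.restrict f, ⊤) :=
  resTop h (f ''ᵁ ⊤)

theorem smul_restrictTop (U : X.Opens) {M : X.Modules} (h : Γ(M, ⊤)) (W : U.toScheme.Opens) :
    (fun a : Γ(U.toScheme, W) => (a • resTop (restrictTop U.ι h) W : Γ(M.restrict U.ι, W))) =
      fun a : Γ(X, U.ι ''ᵁ W) => (a • resTop h (U.ι ''ᵁ W) : Γ(M, U.ι ''ᵁ W)) := by
  have h1 : (resTop (restrictTop U.ι h) W : Γ(M.restrict U.ι, W)) = resTop h (U.ι ''ᵁ W) :=
    res_resTop h (U.ι.opensFunctor.map (homOfLE (le_top : W ≤ ⊤)))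
  funext a
  rw [h1]
  change ((U.ι.appIso W).inv a • resTop h (U.ι ''ᵁ W) : Γ(M, U.ι ''ᵁ W)) = _
  rw [Scheme.Opens.ι_appIso]
  rfl

theorem isGenerator_restrict_iff (U : X.Opens) {M : X.Modules} (h : Γ(M, ⊤)) :
    IsGenerator (M.restrict U.ι) (restrictTop U.ι h) ⊤ ↔ IsGenerator M h U := by
  constructor
  · intro H W hW
    have hW' : U.ι ''ᵁ (U.ι ⁻¹ᵁ W) = W := by
      rw [Scheme.Hom.image_preimage_eq_opensRange_inf]; simpa using hW
    have h1 := H (U.ι ⁻¹ᵁ W) le_top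
    rw [smul_restrictTop] at h1
    have h2 : Function.Bijective fun a : Γ(X, U.ι ''ᵁ (U.ι ⁻¹ᵁ W)) =>
        (a • resTop h (U.ι ''ᵁ (U.ι ⁻¹ᵁ W)) : Γ(M, U.ι ''ᵁ (U.ι ⁻¹ᵁ W))) := h1
    rw [hW'] at h2
    exact h2
  · intro H W _
    rw [smul_restrictTop]
    exact H (U.ι ''ᵁ W) (by simpa using U.ι.image_le_opensRange W)

theorem exists_pullback_comp_iso (f : Y ⟶ X) (g : Z ⟶ Y) (M : X.Modules) :
    ∃ e : (pullback g).obj ((pullback f).obj M) ≅ (pullback (g ≫ f)).obj M,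
      ∀ h : Γ(M, ⊤), e.hom.app ⊤ (pullTop g (pullTop f h)) = pullTop (g ≫ f) h := by
  refine ⟨(pullbackComp g f).app M, fun h => ?_⟩
  have h1 := unit_conjugateEquiv
    ((pullbackPushforwardAdjunction f).comp (pullbackPushforwardAdjunction g))
      (pullbackPushforwardAdjunction (g ≫ f)) (pullbackComp g f).inv M
  rw [conjugateEquiv_pullbackComp_inv] at h1
  have h2 := congrArg (fun t => Hom.app t ⊤ h) h1
  have h3 : ((pullbackComp g f).inv.app M).app ⊤ (pullTop (g ≫ f) h) = pullTop g (pullTop f h) :=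
    h2.symm
  rw [← h3, ← ConcreteCategory.comp_apply, ← Hom.comp_app]
  simp

theorem exists_restrict_iso (f : Y ⟶ X) [IsOpenImmersion f] (M : X.Modules) :
    ∃ e : M.restrict f ≅ (pullback f).obj M,
      ∀ h : Γ(M, ⊤), e.hom.app ⊤ (restrictTop f h) = pullTop f h := by
  refine ⟨(restrictFunctorIsoPullback f).app M, fun h => ?_⟩
  have h1 := Adjunction.unit_leftAdjointUniq_hom_app (restrictAdjunction f)
    (pullbackPushforwardAdjunction f) M
  exact congrArg (fun t => Hom.app t ⊤ h) h1

/-- A free generator pulls back to a free generator: the problem is local on the target, and there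
it says that the pullback of the structure sheaf is the structure sheaf, with the section `1`
pulling back to `1`. -/
theorem IsGenerator.pullback (f : Y ⟶ X) {M : X.Modules} {h : Γ(M, ⊤)} {U : X.Opens}
    (H : IsGenerator M h U) :
    IsGenerator ((Scheme.Modules.pullback f).obj M) (pullTop f h) (f ⁻¹ᵁ U) := by
  rw [← isGenerator_restrict_iff] at H ⊢
  have H1 := H.pullback_top (f ∣_ U)
  obtain ⟨e1, he1⟩ := exists_restrict_iso U.ι M
  have H2 := H1.of_iso ((Scheme.Modules.pullback (f ∣_ U)).mapIso e1)
  rw [Functor.mapIso_hom, pullTop_naturality, he1] at H2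
  obtain ⟨e2, he2⟩ := exists_pullback_comp_iso U.ι (f ∣_ U) M
  have H3 := H2.of_iso e2
  rw [he2] at H3
  have hc : (f ∣_ U) ≫ U.ι = (f ⁻¹ᵁ U).ι ≫ f := morphismRestrict_ι f U
  rw [hc] at H3
  obtain ⟨e3, he3⟩ := exists_pullback_comp_iso f (f ⁻¹ᵁ U).ι M
  have H4 := H3.of_iso e3.symm
  obtain ⟨e4, he4⟩ := exists_restrict_iso (f ⁻¹ᵁ U).ι ((Scheme.Modules.pullback f).obj M)
  have H5 := H4.of_iso e4.symm
  convert H5 using 1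
  have inj : ∀ {A B : (f ⁻¹ᵁ U).toScheme.Modules} (e : A ≅ B) (a : Γ(A, ⊤)),
      e.inv.app ⊤ (e.hom.app ⊤ a) = a := by
    intro A B e a
    rw [← ConcreteCategory.comp_apply, ← Hom.comp_app]
    simp
  rw [← he3, Iso.symm_hom, Iso.symm_hom, inj, ← he4, inj]

end AlgebraicGeometry.Scheme.Modules

/-! ### Sections of the twisting sheaf `𝒪(1)` -/

namespace TwistingSheaf

open AlgebraicGeometry.Scheme.Modules

variable {A σ : Type u} [CommRing A] [SetLike σ A] [AddSubgroupClass σ A]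
variable (𝒜 : ℕ → σ) [GradedRing 𝒜]

/-- The global section of `𝒪(d)` given by an element of degree `d`. -/
noncomputable def ofDegree (d : ℕ) (a : A) (ha : a ∈ 𝒜 d) : Γ(Proj.twist 𝒜 d, ⊤) :=
  show sections 𝒜 d (op ⊤) from ⟨fun _ => Localization.mk a 1, fun x => ⟨⊤, x.2, 𝟙 _, 0, a, 1, by
    rwa [zero_add], SetLike.GradedOne.one_mem, fun y => one_mem _, fun y => rfl⟩⟩

/-- The regular function `a / b` on `D₊(b)`, for `a` and `b` of degree one. -/
noncomputable def ratio {a b : A} (ha : a ∈ 𝒜 1) (hb : b ∈ 𝒜 1) :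
    Γ(Proj 𝒜, Proj.basicOpen 𝒜 b) :=
  Proj.awayToSection 𝒜 b (HomogeneousLocalization.Away.mk 𝒜 hb 1 a (by simpa using ha))

/-- A linear form `b` freely generates `𝒪(1)` on `D₊(b)`: a section `s` is the multiple `(s / b) b`.
-/
theorem isGenerator_ofDegree {b : A} (hb : b ∈ 𝒜 1) :
    IsGenerator (Proj.twist 𝒜 1) (ofDegree 𝒜 1 b hb) (Proj.basicOpen 𝒜 b) := by
  intro W hW
  have key : ∀ x : W, b ∈ compl 𝒜 x.1 := fun x => hW x.2
  have inv : ∀ x : W, Localization.mk b (1 : compl 𝒜 x.1) * Localization.mk 1 ⟨b, key x⟩ = 1 := by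
    intro x
    rw [Localization.mk_mul, one_mul, mul_one]
    exact Localization.mk_self (⟨b, key x⟩ : compl 𝒜 x.1)
  constructor
  · intro f g h
    apply Subtype.ext
    funext x
    have hx : (f.1 x).val * Localization.mk b (1 : compl 𝒜 x.1) =
      (g.1 x).val * Localization.mk b (1 : compl 𝒜 x.1) :=
      congrArg (fun t : sections 𝒜 1 (op W) => t.1 x) h
    apply HomogeneousLocalization.val_injective
    have := congrArg (· * Localization.mk 1 ⟨b, key x⟩) hx
    simpa only [mul_assoc, inv x, mul_one] using this
  · intro s
    let s' : sections 𝒜 1 (op W) := s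
    have loc : ∀ x : W, ∃ (V : Opens (ProjectiveSpectrum.top 𝒜)) (_ : x.1 ∈ V) (i : V ≤ W) (n : ℕ)
        (r t : 𝒜 n) (ht : ∀ y : V, t.1 ∉ y.1.asHomogeneousIdeal), ∀ y : V,
        (HomogeneousLocalization.mk ⟨n, r, t, ht y⟩ :
            HomogeneousLocalization 𝒜 (compl 𝒜 y.1)).val *
          Localization.mk b (1 : compl 𝒜 y.1) = s'.1 ⟨y.1, i y.2⟩ := by
      intro x
      obtain ⟨V, hV, i, n, a, c, ha, hc, hn, h⟩ := s'.2 x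
      refine ⟨V, hV, leOfHom i, n + 1, ⟨a, ha⟩, ⟨c * b, SetLike.mul_mem_graded hc hb⟩,
        fun y => mul_mem (hn y) (key (i y)), fun y => ?_⟩
      refine Eq.trans ?_ (h y).symm
      rw [HomogeneousLocalization.val_mk, Localization.mk_mul, Localization.mk_eq_mk_iff,
        Localization.r_iff_exists]
      refine ⟨1, ?_⟩
      simp only [Submonoid.coe_one, one_mul, mul_one]
      ring
    choose V hV i n r t ht h using loc
    let g : ∀ x : W, HomogeneousLocalization 𝒜 (compl 𝒜 x.1) := fun x =>
      HomogeneousLocalization.mk ⟨n x, r x, t x, ht x ⟨x.1, hV x⟩⟩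
    have hg : ∀ x : W, (g x).val * Localization.mk b (1 : compl 𝒜 x.1) = s'.1 x := fun x =>
      h x ⟨x.1, hV x⟩
    have hg' : ∀ (x : W) (y : V x), g ⟨y.1, i x y.2⟩ =
        (HomogeneousLocalization.mk ⟨n x, r x, t x, ht x y⟩ :
            HomogeneousLocalization 𝒜 (compl 𝒜 y.1)) := by
      intro x y
      apply HomogeneousLocalization.val_injective
      have h1 := congrArg (· * Localization.mk 1 ⟨b, key ⟨y.1, i x y.2⟩⟩)
        ((hg ⟨y.1, i x y.2⟩).trans (h x y).symm)
      simpa only [mul_assoc, inv ⟨y.1, i x y.2⟩, mul_one] using h1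
    refine ⟨⟨g, fun x => ⟨V x, hV x, homOfLE (i x), n x, r x, t x, ht x, fun y => hg' x y⟩⟩, ?_⟩
    exact Subtype.ext (funext fun x => hg x)

theorem val_ratio {a b : A} (ha : a ∈ 𝒜 1) (hb : b ∈ 𝒜 1) (x : Proj.basicOpen 𝒜 b) :
    ((ratio 𝒜 ha hb).1 x).val = Localization.mk a (⟨b, x.2⟩ : compl 𝒜 x.1) := by
  refine (ProjectiveSpectrum.Proj.awayToSection_apply 𝒜 b _ x).trans ?_
  rw [HomogeneousLocalization.Away.val_mk, Localization.mk_eq_mk', IsLocalization.map_mk',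
    ← Localization.mk_eq_mk', Localization.mk_eq_mk_iff, Localization.r_iff_exists]
  exact ⟨1, by simp⟩

theorem resTop_ofDegree {a b : A} (ha : a ∈ 𝒜 1) (hb : b ∈ 𝒜 1) :
    resTop (ofDegree 𝒜 1 a ha) (Proj.basicOpen 𝒜 b) =
      ratio 𝒜 ha hb • resTop (ofDegree 𝒜 1 b hb) (Proj.basicOpen 𝒜 b) := by
  apply Subtype.ext
  funext x
  refine Eq.symm ((congrArg (· * Localization.mk b (1 : compl 𝒜 x.1))
    (val_ratio 𝒜 ha hb x)).trans ?_)
  change _ = Localization.mk a (1 : compl 𝒜 x.1)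
  dsimp only
  rw [Localization.mk_mul, Localization.mk_eq_mk_iff, Localization.r_iff_exists]
  refine ⟨1, ?_⟩
  simp only [Submonoid.coe_one, one_mul, mul_one]
  ring

theorem ratio_mul_ratio {a b c : A} (ha : a ∈ 𝒜 1) (hb : b ∈ 𝒜 1) (hc : c ∈ 𝒜 1)
    {W : (Proj 𝒜).Opens} (h1 : W ≤ Proj.basicOpen 𝒜 b) (h2 : W ≤ Proj.basicOpen 𝒜 c) :
    (Proj 𝒜).presheaf.map (homOfLE h1).op (ratio 𝒜 ha hb) =
      (Proj 𝒜).presheaf.map (homOfLE h2).op (ratio 𝒜 ha hc) *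
        (Proj 𝒜).presheaf.map (homOfLE h1).op (ratio 𝒜 hc hb) := by
  apply Subtype.ext
  funext x
  apply HomogeneousLocalization.val_injective
  refine (val_ratio 𝒜 ha hb ⟨x.1, h1 x.2⟩).trans (Eq.symm ?_)
  refine (HomogeneousLocalization.val_mul _ _).trans ?_
  refine (congrArg₂ (· * ·) (val_ratio 𝒜 ha hc ⟨x.1, h2 x.2⟩)
    (val_ratio 𝒜 hc hb ⟨x.1, h1 x.2⟩)).trans ?_
  dsimp only
  rw [Localization.mk_mul, Localization.mk_eq_mk_iff, Localization.r_iff_exists]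
  refine ⟨1, ?_⟩
  simp only [Submonoid.coe_one, one_mul, Submonoid.coe_mul]
  ring

theorem ratio_self {b : A} (hb : b ∈ 𝒜 1) : ratio 𝒜 hb hb = 1 := by
  apply Subtype.ext
  funext x
  apply HomogeneousLocalization.val_injective
  refine (val_ratio 𝒜 hb hb x).trans (Eq.trans ?_ HomogeneousLocalization.val_one.symm)
  exact Localization.mk_self (⟨b, x.2⟩ : compl 𝒜 x.1)

/-- The function `a / b` vanishes on `D₊(b)` exactly where `a` does. -/
theorem basicOpen_ratio {a b : A} (ha : a ∈ 𝒜 1) (hb : b ∈ 𝒜 1) :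
    (Proj 𝒜).basicOpen (ratio 𝒜 ha hb) = Proj.basicOpen 𝒜 b ⊓ Proj.basicOpen 𝒜 a := by
  apply le_antisymm
  · refine le_inf ((Proj 𝒜).basicOpen_le _) fun x hx hax => ?_
    let y : ProjectiveSpectrum 𝒜 := x
    have hu := RingedSpace.isUnit_res_basicOpen _ (ratio 𝒜 ha hb)
    have h1 := hu.map (openToLocalization 𝒜 _ x hx).hom
    have h2 := h1.map (algebraMap _ (Loc 𝒜 y))
    have h3 : IsUnit (Localization.mk a (⟨b, (Proj 𝒜).basicOpen_le _ hx⟩ : compl 𝒜 y)) := by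
      rw [← val_ratio 𝒜 ha hb ⟨x, (Proj 𝒜).basicOpen_le _ hx⟩]
      exact h2
    rw [Localization.mk_eq_mk', IsLocalization.AtPrime.isUnit_mk'_iff _
      y.asHomogeneousIdeal.toIdeal] at h3
    exact h3 hax
  · have h1 : (Proj.basicOpen 𝒜 b ⊓ Proj.basicOpen 𝒜 a) ≤ Proj.basicOpen 𝒜 b := inf_le_left
    have h2 : (Proj.basicOpen 𝒜 b ⊓ Proj.basicOpen 𝒜 a) ≤ Proj.basicOpen 𝒜 a := inf_le_right
    have h3 := ratio_mul_ratio 𝒜 hb hb ha h1 h2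
    rw [ratio_self, map_one] at h3
    have hu : IsUnit ((Proj 𝒜).presheaf.map (homOfLE h1).op (ratio 𝒜 ha hb)) :=
      .of_mul_eq_one_right _ h3.symm
    have h4 := (Proj 𝒜).basicOpen_of_isUnit hu
    rw [(Proj 𝒜).basicOpen_res] at h4
    exact h4 ▸ inf_le_right

end TwistingSheaf

/-! ### Regular functions and projective space -/

namespace AlgebraicGeometry.Scheme

variable {X Y Z : Scheme.{u}}

/-- Restriction of regular functions to a smaller open set, as a ring homomorphism. -/
noncomputable def res {U V : X.Opens} (h : U ≤ V) : Γ(X, V) →+* Γ(X, U) :=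
  (X.presheaf.map (homOfLE h).op).hom

@[simp] theorem res_res {U V W : X.Opens} (h : U ≤ V) (h' : V ≤ W) (a : Γ(X, W)) :
    res h (res h' a) = res (h.trans h') a := by
  unfold res
  rw [← CommRingCat.comp_apply, ← Functor.map_comp]
  rfl

@[simp] theorem res_rfl {U : X.Opens} (h : U ≤ U) (a : Γ(X, U)) : res h a = a := by
  change X.presheaf.map (𝟙 (op U)) a = a
  rw [X.presheaf.map_id]
  rfl

theorem preimage_le_preimage (f : Y ⟶ X) {U U' : X.Opens} {V : Y.Opens} (h : V ≤ f ⁻¹ᵁ U)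
    (h' : U ≤ U') : V ≤ f ⁻¹ᵁ U' := fun _ hx => h' (h hx)

theorem le_preimage_comp (f : Y ⟶ X) (g : Z ⟶ Y) {U : X.Opens} {V : Y.Opens} {W : Z.Opens}
    (h : V ≤ f ⁻¹ᵁ U) (h' : W ≤ g ⁻¹ᵁ V) : W ≤ (g ≫ f) ⁻¹ᵁ U := fun _ hx => h (h' hx)

theorem le_preimage_top (f : Y ⟶ X) (V : Y.Opens) : V ≤ f ⁻¹ᵁ ⊤ := fun _ _ => trivial

/-- Pullback of regular functions, as a ring homomorphism `Γ(X, U) → Γ(Y, V)`. -/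
noncomputable def Hom.pull (f : Y ⟶ X) (U : X.Opens) (V : Y.Opens) (h : V ≤ f ⁻¹ᵁ U) :
    Γ(X, U) →+* Γ(Y, V) :=
  (f.appLE U V h).hom

@[simp] theorem res_pull (f : Y ⟶ X) {U : X.Opens} {V W : Y.Opens} (h : V ≤ f ⁻¹ᵁ U) (h' : W ≤ V)
    (a : Γ(X, U)) : res h' (f.pull U V h a) = f.pull U W (h'.trans h) a := by
  unfold res Hom.pull
  rw [← CommRingCat.comp_apply, Hom.appLE_map]

@[simp] theorem pull_res (f : Y ⟶ X) {U U' : X.Opens} {V : Y.Opens} (h : V ≤ f ⁻¹ᵁ U) (h' : U ≤ U')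
    (a : Γ(X, U')) : f.pull U V h (res h' a) = f.pull U' V (preimage_le_preimage f h h') a := by
  unfold res Hom.pull
  rw [← CommRingCat.comp_apply, Hom.map_appLE]

@[simp] theorem pull_pull (f : Y ⟶ X) (g : Z ⟶ Y) {U : X.Opens} {V : Y.Opens} {W : Z.Opens}
    (h : V ≤ f ⁻¹ᵁ U) (h' : W ≤ g ⁻¹ᵁ V) (a : Γ(X, U)) :
    g.pull V W h' (f.pull U V h a) = (g ≫ f).pull U W (le_preimage_comp f g h h') a := by
  unfold Hom.pull
  rw [← CommRingCat.comp_apply, Hom.appLE_comp_appLE]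

theorem basicOpen_pull (f : Y ⟶ X) {U : X.Opens} {V : Y.Opens} (h : V ≤ f ⁻¹ᵁ U) (a : Γ(X, U)) :
    Y.basicOpen (f.pull U V h a) = V ⊓ f ⁻¹ᵁ X.basicOpen a :=
  basicOpen_appLE f V U h a

theorem basicOpen_res' {U V : X.Opens} (h : U ≤ V) (a : Γ(X, V)) :
    X.basicOpen (res h a) = U ⊓ X.basicOpen a :=
  X.basicOpen_res a (homOfLE h).op

/-- Two functions that agree locally are equal. -/
theorem eq_of_locally {U : X.Opens} {a b : Γ(X, U)}
    (H : ∀ x ∈ U, ∃ (W : X.Opens) (h : W ≤ U), x ∈ W ∧ res h a = res h b) : a = b := by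
  choose W h hx he using H
  refine X.sheaf.eq_of_locally_eq' (fun x : U => W x.1 x.2) U (fun x => homOfLE (h x.1 x.2)) ?_ a b
    fun x => he x.1 x.2
  intro x hxU
  exact Opens.mem_iSup.mpr ⟨⟨x, hxU⟩, hx x hxU⟩

theorem isUnit_res_basicOpen {U W : X.Opens} (a : Γ(X, U)) (h : W ≤ X.basicOpen a) :
    IsUnit (res (h.trans (X.basicOpen_le a)) a) := by
  have := (RingedSpace.isUnit_res_basicOpen _ a).map (res h)
  convert this using 1
  exact (res_res _ _ _).symm

theorem isUnit_res_iff {U W : X.Opens} (a : Γ(X, U)) (h : W ≤ U) :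
    IsUnit (res h a) ↔ W ≤ X.basicOpen a := by
  constructor
  · intro hu
    have h1 := X.basicOpen_of_isUnit hu
    rw [basicOpen_res'] at h1
    exact h1 ▸ inf_le_right
  · exact fun h1 => isUnit_res_basicOpen a h1

/-- Morphisms into a scheme that land in the same affine open set are equal as soon as they pull
back functions in the same way. -/
theorem hom_ext_of_pull {f g : Y ⟶ X} {U : X.Opens} (hU : IsAffineOpen U) (hf : ⊤ ≤ f ⁻¹ᵁ U)
    (hg : ⊤ ≤ g ⁻¹ᵁ U) (H : ∀ a, f.pull U ⊤ hf a = g.pull U ⊤ hg a) : f = g := by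
  have h1 : f.appLE U ⊤ hf = g.appLE U ⊤ hg := by ext a; exact H a
  have h2 := (Scheme.Opens.toSpecΓ_SpecMap_appLE (f := f) (U := U) (V := ⊤) hf)
  have h3 := (Scheme.Opens.toSpecΓ_SpecMap_appLE (f := g) (U := U) (V := ⊤) hg)
  rw [h1] at h2
  have h4 := h2.symm.trans h3
  have : IsIso U.toSpecΓ := by rw [← hU.isoSpec_hom]; infer_instance
  rw [cancel_mono] at h4
  have h5 := congrArg (· ≫ U.ι) h4
  simp only [Hom.resLE_comp_ι] at h5
  have : IsIso (⊤ : Y.Opens).ι := by rw [← Scheme.topIso_hom]; infer_instance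
  rwa [cancel_epi] at h5

end AlgebraicGeometry.Scheme

/-- On the affine chart `D₊(b)`, the structure morphism of `Proj A` is given by the inclusion of
`A₀` into the degree zero part of `A_b`. -/
theorem AlgebraicGeometry.Proj.basicOpenι_toSpecZero {A σ : Type u} [CommRing A] [SetLike σ A]
    [AddSubgroupClass σ A] (𝒜 : ℕ → σ) [GradedRing 𝒜] {b : A} {m : ℕ} (hb : b ∈ 𝒜 m) (hm : 0 < m) :
    (Proj.basicOpen 𝒜 b).ι ≫ Proj.toSpecZero 𝒜 = (Proj.basicOpen 𝒜 b).toSpecΓ ≫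
      Spec.map (CommRingCat.ofHom (HomogeneousLocalization.fromZeroRingHom 𝒜 _) ≫
        Proj.awayToSection 𝒜 b) := by
  have h3 : (Proj.basicOpen 𝒜 b).ι = (Proj.basicOpenIsoSpec 𝒜 b hb hm).hom ≫
      Proj.awayι 𝒜 b hb hm := by
    rw [← Proj.basicOpenIsoSpec_inv_ι, Iso.hom_inv_id_assoc]
  rw [h3, Category.assoc, Proj.awayι_toSpecZero, Proj.basicOpenIsoSpec_hom,
    Proj.basicOpenToSpec, Category.assoc, Spec.map_comp]

namespace ProjectiveEmbedding

open AlgebraicGeometry.Scheme TwistingSheaf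

variable {K : Type u} [Field K] {X Y Z : Scheme.{u}}

/-- A homogeneous polynomial of degree `n` scales by the `n`-th power. -/
theorem eval₂_mul_of_isHomogeneous {k A ι : Type*} [CommRing k] [CommRing A] {n : ℕ}
    {G : MvPolynomial ι k} (hG : G.IsHomogeneous n) (f : k →+* A) (g : A) (x : ι → A) :
    G.eval₂ f (fun j => g * x j) = g ^ n * G.eval₂ f x := by
  rw [MvPolynomial.eval₂_eq, MvPolynomial.eval₂_eq, Finset.mul_sum]
  refine Finset.sum_congr rfl fun d hd => ?_
  have : ∑ j ∈ d.support, d j = n := by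
    have := hG (MvPolynomial.mem_support_iff.mp hd)
    rwa [show (1 : ι → ℕ) = fun _ => 1 from rfl, ← Finsupp.degree_eq_weight_one] at this
  rw [← this]
  simp only [mul_pow, Finset.prod_mul_distrib, Finset.prod_pow_eq_pow_sum]
  ring

/-- The constant functions on an open subset of a scheme over `K`. -/
noncomputable def consts (σ : Y ⟶ Base K) (U : Y.Opens) : K →+* Γ(Y, U) :=
  (σ.pull ⊤ U (le_preimage_top σ U)).comp (Scheme.ΓSpecIso (CommRingCat.of K)).inv.hom

theorem consts_apply (σ : Y ⟶ Base K) (U : Y.Opens) (a : K) : consts σ U a =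
    σ.pull ⊤ U (le_preimage_top σ U) ((Scheme.ΓSpecIso (CommRingCat.of K)).inv.hom a) := rfl

@[simp] theorem res_consts (σ : Y ⟶ Base K) {U V : Y.Opens} (h : U ≤ V) (a : K) :
    res h (consts σ V a) = consts σ U a := by
  rw [consts_apply, consts_apply, res_pull]

@[simp] theorem pull_consts (σ : X ⟶ Base K) (f : Y ⟶ X) {U : X.Opens} {V : Y.Opens}
    (h : V ≤ f ⁻¹ᵁ U) (a : K) : f.pull U V h (consts σ U a) = consts (f ≫ σ) V a := by
  rw [consts_apply, consts_apply, pull_pull]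

theorem opensι_comp_eq (σ : Y ⟶ Base K) (U : Y.Opens) :
    U.ι ≫ σ = U.toSpecΓ ≫ Spec.map (CommRingCat.ofHom (consts σ U)) := by
  have h1 : CommRingCat.ofHom (consts σ U) = (Scheme.ΓSpecIso (CommRingCat.of K)).inv ≫
      σ.appTop ≫ Y.presheaf.map (homOfLE le_top).op := rfl
  rw [h1, Spec.map_comp, Spec.map_comp, Category.assoc,
    Scheme.Opens.toSpecΓ_SpecMap_presheaf_map_top_assoc,
    ← Scheme.toSpecΓ_naturality_assoc]
  simp

variable (K) in
/-- The homogeneous coordinates on projective space. -/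
noncomputable abbrev coordX {r : ℕ} (i : Fin (r + 1)) : MvPolynomial (Fin (r + 1)) K :=
  MvPolynomial.X i

theorem coordX_mem {r : ℕ} (i : Fin (r + 1)) : coordX K i ∈ grading K r 1 :=
  MvPolynomial.isHomogeneous_X K i

/-- The open subset of projective space on which the linear form `b` does not vanish. -/
noncomputable def dPlus {r : ℕ} (b : MvPolynomial (Fin (r + 1)) K) : (ProjSpace K r).Opens :=
  Proj.basicOpen (grading K r) b

/-- The regular function `a / b` on projective space, for linear forms `a` and `b`. -/
noncomputable def frac {r : ℕ} {a b : MvPolynomial (Fin (r + 1)) K} (ha : a ∈ grading K r 1)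
    (hb : b ∈ grading K r 1) : Γ(ProjSpace K r, dPlus b) :=
  ratio (grading K r) ha hb

theorem isAffineOpen_dPlus {r : ℕ} {b : MvPolynomial (Fin (r + 1)) K} (hb : b ∈ grading K r 1) :
    IsAffineOpen (dPlus b) :=
  Proj.isAffineOpen_basicOpen _ _ hb one_pos

/-- The degree zero part of `K[x₀, …, x_r]_b`, as functions on `D₊(b)`. -/
noncomputable def awayHom {r : ℕ} (b : MvPolynomial (Fin (r + 1)) K) :
    HomogeneousLocalization.Away (grading K r) b →+* Γ(ProjSpace K r, dPlus b) :=
  (Proj.awayToSection (grading K r) b).hom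

/-- The constants in the degree zero part of `K[x₀, …, x_r]_b`. -/
noncomputable def awayConst {r : ℕ} (b : MvPolynomial (Fin (r + 1)) K) :
    K →+* HomogeneousLocalization.Away (grading K r) b :=
  (HomogeneousLocalization.fromZeroRingHom (grading K r) (Submonoid.powers b)).comp
    (algebraMap K (grading K r 0))

/-- The constant functions on the scheme `ℙ^r` are those of the ring of functions on `D₊(b)`. -/
theorem consts_projSpace {r : ℕ} {b : MvPolynomial (Fin (r + 1)) K} (hb : b ∈ grading K r 1) :
    consts (ProjSpace K r ↘ Base K) (dPlus b) = (awayHom b).comp (awayConst b) := by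
  have hU := isAffineOpen_dPlus hb
  have h1 := opensι_comp_eq (ProjSpace K r ↘ Base K) (dPlus b)
  have h2 := Proj.basicOpenι_toSpecZero (grading K r) hb one_pos
  have : IsIso (dPlus b).toSpecΓ := by rw [← hU.isoSpec_hom]; infer_instance
  have h5 := congrArg (· ≫ Spec.map (CommRingCat.ofHom (algebraMap K (grading K r 0)))) h2
  simp only [Category.assoc, ← Spec.map_comp] at h5
  have h4 := (cancel_epi (dPlus b).toSpecΓ).mp (h1.symm.trans h5)
  exact congrArg (fun t => t.hom) (Spec.map_injective h4)

/-- A homogeneous polynomial `p` of degree `n` takes the value `p / bⁿ` at the affine coordinates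
`xⱼ / b`. -/
theorem eval₂Hom_away {r : ℕ} {b : MvPolynomial (Fin (r + 1)) K} (hb : b ∈ grading K r 1) (n : ℕ)
    (p : MvPolynomial (Fin (r + 1)) K) (hp : p ∈ grading K r (n • 1)) :
    MvPolynomial.eval₂Hom (awayConst b) (fun j => HomogeneousLocalization.Away.mk (grading K r) hb 1
      (coordX K j) (by simpa using coordX_mem j)) p =
      HomogeneousLocalization.Away.mk (grading K r) hb n p hp := by
  apply HomogeneousLocalization.val_injective
  let v : HomogeneousLocalization.Away (grading K r) b →+* Localization.Away b := algebraMap _ _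
  suffices h0 : v (MvPolynomial.eval₂Hom (awayConst b) (fun j =>
      HomogeneousLocalization.Away.mk (grading K r) hb 1 (coordX K j)
        (by simpa using coordX_mem j)) p) =
      v (HomogeneousLocalization.Away.mk (grading K r) hb n p hp) from h0
  have h1 : (v.comp (awayConst b)) =
      (algebraMap (MvPolynomial (Fin (r + 1)) K) (Localization.Away b)).comp MvPolynomial.C := by
    ext c
    rfl
  have h2 : (fun j => v (HomogeneousLocalization.Away.mk (grading K r) hb 1
      (coordX K j) (by simpa using coordX_mem j))) = fun j =>
      Localization.mk 1 (⟨b, 1, pow_one b⟩ : Submonoid.powers b) *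
        algebraMap _ (Localization.Away b) (coordX K j) := by
    funext j
    refine (HomogeneousLocalization.Away.val_mk (𝒜 := grading K r) 1 hb (coordX K j)
      (by simpa using coordX_mem j)).trans ?_
    rw [← Localization.mk_one_eq_algebraMap, Localization.mk_mul, Localization.mk_eq_mk_iff,
      Localization.r_iff_exists]
    exact ⟨1, by simp⟩
  have h3 : v (HomogeneousLocalization.Away.mk (grading K r) hb n p hp) =
      Localization.mk p (⟨b ^ n, n, rfl⟩ : Submonoid.powers b) := rfl
  rw [MvPolynomial.coe_eval₂Hom, MvPolynomial.hom_eval₂, h1]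
  erw [h2]
  rw [eval₂_mul_of_isHomogeneous (n := n) (by simpa using hp), h3]
  have h4 : p.eval₂ ((algebraMap (MvPolynomial (Fin (r + 1)) K)
      (Localization.Away b)).comp MvPolynomial.C) (fun i =>
        algebraMap _ (Localization.Away b) (coordX K i)) = algebraMap _ _ p := by
    rw [← MvPolynomial.hom_eval₂, MvPolynomial.eval₂_eta]
  rw [h4, Localization.mk_pow, ← Localization.mk_one_eq_algebraMap, Localization.mk_mul,
    Localization.mk_eq_mk_iff, Localization.r_iff_exists]
  exact ⟨1, by simp⟩

/-- The regular functions on the complement of a hyperplane are polynomials in the affine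
coordinates. -/
theorem surjective_eval₂Hom_frac {r : ℕ} {b : MvPolynomial (Fin (r + 1)) K}
    (hb : b ∈ grading K r 1) :
    Function.Surjective (MvPolynomial.eval₂Hom (consts (ProjSpace K r ↘ Base K) (dPlus b))
      fun j => frac (coordX_mem j) hb) := by
  intro y
  obtain ⟨x, rfl⟩ : ∃ x, awayHom b x = y := by
    refine ⟨(Proj.basicOpenIsoAway (grading K r) b hb one_pos).inv.hom y, ?_⟩
    exact congrArg (fun t => t.hom y) (Proj.basicOpenIsoAway (grading K r) b hb one_pos).inv_hom_id
  obtain ⟨n, p, hp, rfl⟩ := HomogeneousLocalization.Away.mk_surjective (grading K r) hb x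
  refine ⟨p, ?_⟩
  rw [← eval₂Hom_away hb n p hp, MvPolynomial.coe_eval₂Hom, MvPolynomial.coe_eval₂Hom,
    MvPolynomial.hom_eval₂, consts_projSpace hb]
  rfl

theorem exists_mem_dPlus {r : ℕ} (x : ProjSpace K r) : ∃ i, x ∈ dPlus (coordX K i) := by
  have h := Proj.iSup_basicOpen_eq_top' (grading K r) (coordX K) (fun i => ⟨1, coordX_mem i⟩) (by
    rw [eq_top_iff]
    intro p _
    have h1 : p ∈ Algebra.adjoin K (Set.range (MvPolynomial.X (R := K) (σ := Fin (r + 1)))) := by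
      rw [MvPolynomial.adjoin_range_X]; trivial
    induction h1 using Algebra.adjoin_induction with
    | mem x hx => exact Algebra.subset_adjoin hx
    | algebraMap c =>
      exact Subalgebra.algebraMap_mem (Algebra.adjoin (grading K r 0) _)
        (⟨MvPolynomial.C c, MvPolynomial.isHomogeneous_C _ _⟩ : grading K r 0)
    | add x y _ _ hx hy => exact add_mem (hx trivial) (hy trivial)
    | mul x y _ _ hx hy => exact mul_mem (hx trivial) (hy trivial))
  have hx : x ∈ (⊤ : (Proj (grading K r)).Opens) := trivial
  rw [← h] at hx
  exact Opens.mem_iSup.mp hx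

theorem basicOpen_frac {r : ℕ} {a b : MvPolynomial (Fin (r + 1)) K} (ha : a ∈ grading K r 1)
    (hb : b ∈ grading K r 1) : (ProjSpace K r).basicOpen (frac ha hb) = dPlus b ⊓ dPlus a :=
  basicOpen_ratio (grading K r) ha hb

theorem frac_mul_frac {r : ℕ} {a b c : MvPolynomial (Fin (r + 1)) K} (ha : a ∈ grading K r 1)
    (hb : b ∈ grading K r 1) (hc : c ∈ grading K r 1) {W : (ProjSpace K r).Opens}
    (h1 : W ≤ dPlus b) (h2 : W ≤ dPlus c) :
    res h1 (frac ha hb) = res h2 (frac ha hc) * res h1 (frac hc hb) :=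
  ratio_mul_ratio (grading K r) ha hb hc h1 h2

theorem frac_self {r : ℕ} {b : MvPolynomial (Fin (r + 1)) K} (hb : b ∈ grading K r 1) :
    frac hb hb = 1 :=
  ratio_self (grading K r) hb

end ProjectiveEmbedding

/-! ### Morphisms to projective space in coordinates -/

namespace ProjectiveEmbedding

open AlgebraicGeometry.Scheme TwistingSheaf

variable {K : Type u} [Field K] {X Y Z : Scheme.{u}} {r : ℕ}

/-- On the open set `V`, the morphism `φ` to projective space is `[f₀ : … : f_r]`: where `φ` lands
in the `i`-th standard chart, `fᵢ` is invertible and `fⱼ / fᵢ` is the pullback of `xⱼ / xᵢ`. -/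
def Rep (φ : Y ⟶ ProjSpace K r) (V : Y.Opens) (f : Fin (r + 1) → Γ(Y, V)) : Prop :=
  ∀ (i : Fin (r + 1)) (W : Y.Opens) (hW : W ≤ V) (hi : W ≤ φ ⁻¹ᵁ dPlus (coordX K i)),
    IsUnit (res hW (f i)) ∧
    ∀ j, res hW (f j) = φ.pull _ W hi (frac (coordX_mem j) (coordX_mem i)) * res hW (f i)

theorem Rep.res {φ : Y ⟶ ProjSpace K r} {V V' : Y.Opens} {f : Fin (r + 1) → Γ(Y, V)}
    (H : Rep φ V f) (h : V' ≤ V) : Rep φ V' fun i => Scheme.res h (f i) := by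
  intro i W hW hi
  simpa using H i W (hW.trans h) hi

theorem exists_mem_preimage_dPlus (φ : Y ⟶ ProjSpace K r) (y : Y) :
    ∃ i, y ∈ φ ⁻¹ᵁ dPlus (coordX K i) :=
  exists_mem_dPlus (φ y)

theorem pull_frac_mul (φ : Y ⟶ ProjSpace K r) {a b c : MvPolynomial (Fin (r + 1)) K}
    (ha : a ∈ grading K r 1) (hb : b ∈ grading K r 1) (hc : c ∈ grading K r 1) {W : Y.Opens}
    (h1 : W ≤ φ ⁻¹ᵁ dPlus b) (h2 : W ≤ φ ⁻¹ᵁ dPlus c) :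
    φ.pull _ W h1 (frac ha hb) = φ.pull _ W h2 (frac ha hc) * φ.pull _ W h1 (frac hc hb) := by
  have h3 : W ≤ φ ⁻¹ᵁ (dPlus b ⊓ dPlus c) := le_inf h1 h2
  have h := congrArg (φ.pull _ W h3) (frac_mul_frac ha hb hc (W := dPlus b ⊓ dPlus c)
    inf_le_left inf_le_right)
  simpa using h

/-- It is enough to compare with one of the charts if all of `V` maps to it. -/
theorem Rep.of_index {φ : Y ⟶ ProjSpace K r} {V : Y.Opens} {f : Fin (r + 1) → Γ(Y, V)}
    (i : Fin (r + 1)) (hi : V ≤ φ ⁻¹ᵁ dPlus (coordX K i)) (hu : IsUnit (f i))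
    (h : ∀ j, f j = φ.pull _ V hi (frac (coordX_mem j) (coordX_mem i)) * f i) : Rep φ V f := by
  intro k W hW hk
  have hi' := hW.trans hi
  have e : ∀ j, Scheme.res hW (f j) =
      φ.pull _ W hi' (frac (coordX_mem j) (coordX_mem i)) * Scheme.res hW (f i) := by
    intro j
    conv_lhs => rw [h j, map_mul, res_pull]
  have u : IsUnit (φ.pull _ W hi' (frac (coordX_mem (K := K) k) (coordX_mem i))) := by
    have h1 := pull_frac_mul φ (coordX_mem (K := K) i) (coordX_mem i) (coordX_mem k) hi' hk
    rw [frac_self, map_one] at h1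
    exact .of_mul_eq_one_right _ h1.symm
  refine ⟨?_, fun j => ?_⟩
  · rw [e k]
    exact u.mul (hu.map _)
  · rw [e j, e k, pull_frac_mul φ (coordX_mem (K := K) j) (coordX_mem i) (coordX_mem k) hi' hk,
      mul_assoc]

theorem Rep.of_locally {φ : Y ⟶ ProjSpace K r} {V : Y.Opens} {f : Fin (r + 1) → Γ(Y, V)}
    (H : ∀ y ∈ V, ∃ (W : Y.Opens) (h : W ≤ V), y ∈ W ∧ Rep φ W fun i => Scheme.res h (f i)) :
    Rep φ V f := by
  intro i W hW hi
  constructor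
  · rw [isUnit_res_iff]
    intro y hy
    obtain ⟨W', h, hyW, hr⟩ := H y (hW hy)
    have h1 := (hr i (W' ⊓ W) inf_le_left (inf_le_right.trans hi)).1
    rw [res_res, isUnit_res_iff] at h1
    exact h1 ⟨hyW, hy⟩
  · intro j
    apply eq_of_locally
    intro y hy
    obtain ⟨W', h, hyW, hr⟩ := H y (hW hy)
    have h1 := (hr i (W' ⊓ W) inf_le_left (inf_le_right.trans hi)).2 j
    refine ⟨W' ⊓ W, inf_le_right, ⟨hyW, hy⟩, ?_⟩
    simpa using h1

theorem Rep.pullback {φ : Y ⟶ ProjSpace K r} {V : Y.Opens} {f : Fin (r + 1) → Γ(Y, V)}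
    (H : Rep φ V f) (g : Z ⟶ Y) {W : Z.Opens} (hW : W ≤ g ⁻¹ᵁ V) :
    Rep (g ≫ φ) W fun i => g.pull V W hW (f i) := by
  apply Rep.of_locally
  intro z hz
  obtain ⟨i, hi⟩ := exists_mem_preimage_dPlus (K := K) φ (g z)
  have h1 := H i (V ⊓ φ ⁻¹ᵁ dPlus (coordX K i)) inf_le_left inf_le_right
  have h2 : W ⊓ (g ≫ φ) ⁻¹ᵁ dPlus (coordX K i) ≤ g ⁻¹ᵁ (V ⊓ φ ⁻¹ᵁ dPlus (coordX K i)) :=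
    fun x hx => ⟨hW hx.1, hx.2⟩
  refine ⟨W ⊓ (g ≫ φ) ⁻¹ᵁ dPlus (coordX K i), inf_le_left, ⟨hz, hi⟩, ?_⟩
  refine Rep.of_index i inf_le_right ?_ fun j => ?_
  · have := h1.1.map (g.pull _ _ h2)
    rw [pull_res] at this
    rwa [res_pull]
  · have := congrArg (g.pull _ _ h2) (h1.2 j)
    rw [map_mul, pull_res, pull_res, pull_pull] at this
    rw [res_pull, res_pull]
    exact this

theorem Rep.basicOpen {φ : Y ⟶ ProjSpace K r} {V : Y.Opens} {f : Fin (r + 1) → Γ(Y, V)}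
    (H : Rep φ V f) (i : Fin (r + 1)) :
    Y.basicOpen (f i) = V ⊓ φ ⁻¹ᵁ dPlus (coordX K i) := by
  apply le_antisymm
  · refine le_inf (Y.basicOpen_le _) fun y hy => ?_
    have hyV := Y.basicOpen_le _ hy
    obtain ⟨k, hk⟩ := exists_mem_preimage_dPlus (K := K) φ y
    let W := Y.basicOpen (f i) ⊓ φ ⁻¹ᵁ dPlus (coordX K k)
    have h1 := (H k W (inf_le_left.trans (Y.basicOpen_le _)) inf_le_right).2 i
    have h2 : IsUnit (Scheme.res (inf_le_left.trans (Y.basicOpen_le _) : W ≤ V) (f i)) :=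
      (isUnit_res_iff _ _).2 inf_le_left
    rw [h1] at h2
    have h3 := Y.basicOpen_of_isUnit (isUnit_of_mul_isUnit_left h2)
    rw [basicOpen_pull, basicOpen_frac] at h3
    have h4 : y ∈ W := ⟨hy, hk⟩
    rw [← h3] at h4
    exact h4.2.2
  · exact (isUnit_res_iff _ _).1 (H i _ inf_le_left inf_le_right).1

/-- Morphisms to projective space are equal if they have proportional homogeneous coordinates
locally. -/
theorem hom_ext_of_rep {φ φ' : Y ⟶ ProjSpace K r}
    (hφ : φ ≫ (ProjSpace K r ↘ Base K) = φ' ≫ (ProjSpace K r ↘ Base K))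
    (H : ∀ y : Y, ∃ (V : Y.Opens) (f f' : Fin (r + 1) → Γ(Y, V)), y ∈ V ∧ Rep φ V f ∧ Rep φ' V f' ∧
      ∀ i j, f i * f' j = f j * f' i) : φ = φ' := by
  choose V f f' hy h1 h2 h3 using H
  have key : ∀ y : Y, ∃ U : Y.Opens, y ∈ U ∧ U.ι ≫ φ = U.ι ≫ φ' := by
    intro y
    obtain ⟨i, hi⟩ := exists_mem_preimage_dPlus (K := K) φ y
    have hb : Y.basicOpen (f y i) = V y ⊓ φ ⁻¹ᵁ dPlus (coordX K i) := (h1 y).basicOpen i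
    have hb' : Y.basicOpen (f' y i) = V y ⊓ φ' ⁻¹ᵁ dPlus (coordX K i) := (h2 y).basicOpen i
    have hi' : y ∈ φ' ⁻¹ᵁ dPlus (coordX K i) := by
      obtain ⟨k, hk⟩ := exists_mem_preimage_dPlus (K := K) φ' y
      have e1 : y ∈ Y.basicOpen (f y i * f' y k) := by
        rw [Y.basicOpen_mul, hb, (h2 y).basicOpen k]
        exact ⟨⟨hy y, hi⟩, hy y, hk⟩
      rw [h3 y, Y.basicOpen_mul, hb'] at e1
      exact e1.2.2
    let U := V y ⊓ (φ ⁻¹ᵁ dPlus (coordX K i) ⊓ φ' ⁻¹ᵁ dPlus (coordX K i))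
    have hU1 : U ≤ φ ⁻¹ᵁ dPlus (coordX K i) := inf_le_right.trans inf_le_left
    have hU2 : U ≤ φ' ⁻¹ᵁ dPlus (coordX K i) := inf_le_right.trans inf_le_right
    have hUV : U ≤ V y := inf_le_left
    refine ⟨U, ⟨hy y, hi, hi'⟩, ?_⟩
    have hUt : (⊤ : U.toScheme.Opens) ≤ U.ι ⁻¹ᵁ U := U.ι_preimage_self.ge
    refine hom_ext_of_pull (isAffineOpen_dPlus (coordX_mem i)) (le_preimage_comp φ U.ι hU1 hUt)
      (le_preimage_comp φ' U.ι hU2 hUt) fun a => ?_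
    rw [← pull_pull φ U.ι hU1 hUt, ← pull_pull φ' U.ι hU2 hUt]
    congr 1
    obtain ⟨p, rfl⟩ := surjective_eval₂Hom_frac (coordX_mem (K := K) i) a
    rw [MvPolynomial.coe_eval₂Hom, MvPolynomial.hom_eval₂, MvPolynomial.hom_eval₂]
    congr 1
    · ext c
      refine (pull_consts _ φ hU1 c).trans (Eq.trans ?_ (pull_consts _ φ' hU2 c).symm)
      rw [hφ]
    · funext j
      have e1 := h1 y i U hUV hU1
      have e2 := h2 y i U hUV hU2
      have e3 := congrArg (Scheme.res hUV) (h3 y j i)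
      rw [map_mul, map_mul, e1.2 j, e2.2 j] at e3
      have e4 := (e1.1.mul e2.1)
      rw [← e4.mul_left_inj]
      linear_combination e3
  choose U hU e using key
  exact (Scheme.openCoverOfIsOpenCover Y U (by
    rw [TopologicalSpace.IsOpenCover, eq_top_iff]
    exact fun y _ => Opens.mem_iSup.mpr ⟨y, hU y⟩)).hom_ext _ _ fun y => e y

/-- Ring homomorphisms out of the ring of functions on a standard affine chart of projective space,
given by the values of the affine coordinates. -/
theorem exists_hom_dPlus {R : Type u} [CommRing R] (κ : K →+* R) (i : Fin (r + 1))
    (g : Fin (r + 1) → R) (hg : g i = 1) :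
    ∃ θ : Γ(ProjSpace K r, dPlus (coordX K i)) →+* R,
      (∀ c, θ (consts (ProjSpace K r ↘ Base K) _ c) = κ c) ∧
      ∀ j, θ (frac (coordX_mem j) (coordX_mem i)) = g j := by
  let b := coordX K i
  let e : MvPolynomial (Fin (r + 1)) K →+* R := MvPolynomial.eval₂Hom κ g
  have he : IsUnit (e b) := by
    have : e b = 1 := (MvPolynomial.eval₂_X ..).trans hg
    rw [this]; exact isUnit_one
  let e' : Localization.Away b →+* R := IsLocalization.Away.lift b he
  have he' : ∀ p, e' (algebraMap _ _ p) = e p := IsLocalization.Away.lift_eq b he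
  let v : HomogeneousLocalization.Away (grading K r) b →+* Localization.Away b := algebraMap _ _
  let iso := Proj.basicOpenIsoAway (grading K r) b (coordX_mem i) one_pos
  let w : Γ(ProjSpace K r, dPlus b) →+* HomogeneousLocalization.Away (grading K r) b :=
    iso.inv.hom
  have hw : ∀ x, w (awayHom b x) = x := fun x => congrArg (fun t => t.hom x) iso.hom_inv_id
  refine ⟨e'.comp (v.comp w), fun c => ?_, fun j => ?_⟩
  · rw [consts_projSpace (coordX_mem i)]
    simp only [RingHom.comp_apply]
    rw [hw]
    have h1 : v (awayConst b c) = algebraMap (MvPolynomial (Fin (r + 1)) K) (Localization.Away b)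
        (MvPolynomial.C c) := rfl
    rw [h1, he']
    exact MvPolynomial.eval₂_C ..
  · have h0 : frac (coordX_mem (K := K) j) (coordX_mem i) = awayHom b
      (HomogeneousLocalization.Away.mk (grading K r) (coordX_mem i) 1
        (coordX K j) (by simpa using coordX_mem j)) := rfl
    rw [h0]
    simp only [RingHom.comp_apply]
    rw [hw]
    have h1 : v (HomogeneousLocalization.Away.mk (grading K r) (coordX_mem i) 1
        (coordX K j) (by simpa using coordX_mem j)) * algebraMap _ (Localization.Away b) b =
        algebraMap _ (Localization.Away b) (coordX K j) := by
      have h2 : v (HomogeneousLocalization.Away.mk (grading K r) (coordX_mem i) 1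
        (coordX K j) (by simpa using coordX_mem j)) =
          Localization.mk (coordX K j) (⟨b ^ 1, 1, rfl⟩ : Submonoid.powers b) := rfl
      rw [h2, ← Localization.mk_one_eq_algebraMap, ← Localization.mk_one_eq_algebraMap,
        Localization.mk_mul, Localization.mk_eq_mk_iff, Localization.r_iff_exists]
      exact ⟨1, by simp [mul_comm]⟩
    have h2 := congrArg e' h1
    rw [map_mul, he', he'] at h2
    have h3 : e b = 1 := (MvPolynomial.eval₂_X ..).trans hg
    have h4 : e (coordX K j) = g j := MvPolynomial.eval₂_X ..
    rwa [h3, h4, mul_one] at h2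

@[simp] theorem pull_fromSpec {U : Y.Opens} (hU : IsAffineOpen U) (h : ⊤ ≤ hU.fromSpec ⁻¹ᵁ U)
    (a : Γ(Y, U)) : hU.fromSpec.pull U ⊤ h a = (Scheme.ΓSpecIso Γ(Y, U)).inv.hom a := by
  have h1 := hU.fromSpec_app_self
  unfold Hom.pull Hom.appLE
  rw [h1, Category.assoc, ← Functor.map_comp]
  have : ((eqToHom hU.fromSpec_preimage_self).op ≫ (homOfLE h).op) = 𝟙 (op ⊤) := rfl
  erw [this]
  simp

@[simp] theorem pull_specMap {R S : CommRingCat.{u}} (θ : R ⟶ S) (h : ⊤ ≤ Spec.map θ ⁻¹ᵁ ⊤)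
    (a : R) : (Spec.map θ).pull ⊤ ⊤ h ((Scheme.ΓSpecIso R).inv.hom a) =
      (Scheme.ΓSpecIso S).inv.hom (θ.hom a) :=
  congrArg (fun t => t.hom a) (Scheme.ΓSpecIso_inv_naturality θ).symm

@[simp] theorem pull_toSpecΓ {U : Y.Opens} (h : ⊤ ≤ U.toSpecΓ ⁻¹ᵁ ⊤) (a : Γ(Y, U)) :
    U.toSpecΓ.pull ⊤ ⊤ h ((Scheme.ΓSpecIso _).inv.hom a) =
      U.ι.pull U ⊤ U.ι_preimage_self.ge a := by
  have h1 : (Scheme.ΓSpecIso _).inv ≫ U.toSpecΓ.appTop = U.topIso.inv := by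
    rw [Scheme.Opens.toSpecΓ_appTop, Iso.inv_hom_id_assoc]
  have h2 : U.topIso.inv = U.ι.appLE U ⊤ U.ι_preimage_self.ge := by
    rw [Scheme.Opens.ι_appLE]; rfl
  have h3 : U.toSpecΓ.appLE ⊤ ⊤ h = U.toSpecΓ.appTop := Scheme.Hom.appLE_eq_app _
  rw [h2, ← h3] at h1
  exact congrArg (fun t => t.hom a) h1

theorem fromSpec_comp_eq (σ : Y ⟶ Base K) {U : Y.Opens} (hU : IsAffineOpen U) :
    hU.fromSpec ≫ σ = Spec.map (CommRingCat.ofHom (consts σ U)) := by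
  have h := opensι_comp_eq σ U
  rw [← hU.isoSpec_hom] at h
  rw [← hU.isoSpec_inv_ι, Category.assoc, h, Iso.inv_hom_id_assoc]

/-- A tuple with an invertible entry defines a morphism to the corresponding chart. -/
theorem exists_hom_of_isUnit (σ : Y ⟶ Base K) (V : Y.Opens) (f : Fin (r + 1) → Γ(Y, V))
    (i : Fin (r + 1)) (hi : IsUnit (f i)) : ∃ φ : V.toScheme ⟶ ProjSpace K r,
      φ ≫ (ProjSpace K r ↘ Base K) = V.ι ≫ σ ∧
      Rep φ ⊤ fun j => V.ι.pull V ⊤ V.ι_preimage_self.ge (f j) := by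
  obtain ⟨u, hu⟩ := hi
  obtain ⟨θ, h1, h2⟩ := exists_hom_dPlus (consts σ V) i (fun j => f j * ↑u⁻¹) (by simp [← hu])
  have hU := isAffineOpen_dPlus (coordX_mem (K := K) i)
  obtain ⟨θ', rfl⟩ : ∃ θ' : Γ(ProjSpace K r, dPlus (coordX K i)) ⟶ Γ(Y, V), θ'.hom = θ :=
    ⟨ConcreteCategory.ofHom θ, rfl⟩
  let φ : V.toScheme ⟶ ProjSpace K r := V.toSpecΓ ≫ Spec.map θ' ≫ hU.fromSpec
  have hφ : ⊤ ≤ φ ⁻¹ᵁ dPlus (coordX K i) := by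
    intro y _
    have : φ y ∈ Set.range hU.fromSpec :=
      ⟨Spec.map θ' (V.toSpecΓ y), by simp [φ]⟩
    rw [hU.range_fromSpec] at this
    exact this
  have hpull : ∀ a, φ.pull _ ⊤ hφ a = V.ι.pull V ⊤ V.ι_preimage_self.ge (θ'.hom a) := by
    intro a
    have h4 : ⊤ ≤ hU.fromSpec ⁻¹ᵁ dPlus (coordX K i) := hU.fromSpec_preimage_self.ge
    have h3 := pull_pull hU.fromSpec (V.toSpecΓ ≫ Spec.map θ') h4
      (le_preimage_top _ ⊤) a
    rw [pull_fromSpec, ← pull_pull (Spec.map θ') V.toSpecΓ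
      (le_preimage_top _ ⊤) (le_preimage_top _ ⊤), pull_specMap, pull_toSpecΓ] at h3
    exact h3.symm
  refine ⟨φ, ?_, ?_⟩
  · have h3 : CommRingCat.ofHom (consts (ProjSpace K r ↘ Base K) (dPlus (coordX K i))) ≫
        θ' = CommRingCat.ofHom (consts σ V) := by
      ext c
      exact h1 c
    have h4 := fromSpec_comp_eq (ProjSpace K r ↘ Base K) hU
    simp only [φ, Category.assoc]
    rw [h4, ← Spec.map_comp, h3, opensι_comp_eq]
  · refine Rep.of_index i hφ ?_ fun j => ?_
    · exact (hu ▸ u.isUnit).map _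
    · rw [hpull, h2, ← map_mul, mul_assoc, ← hu, Units.inv_mul, mul_one]

/-- Morphisms defined on the members of an open cover glue. -/
theorem exists_glue {α : Type*} (U : α → Y.Opens) (hU : ∀ y, ∃ a, y ∈ U a)
    (φ : ∀ a, (U a).toScheme ⟶ Z)
    (H : ∀ (a b : α) (T : Scheme.{u}) (s : T ⟶ U a) (t : T ⟶ U b),
      s ≫ (U a).ι = t ≫ (U b).ι → s ≫ φ a = t ≫ φ b) :
    ∃ Φ : Y ⟶ Z, ∀ a, (U a).ι ≫ Φ = φ a := by
  let 𝒰 := Scheme.openCoverOfIsOpenCover Y U (by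
    rw [TopologicalSpace.IsOpenCover, eq_top_iff]
    exact fun y _ => Opens.mem_iSup.mpr (hU y))
  exact ⟨𝒰.glueMorphisms φ fun a b => H a b _ _ _ Limits.pullback.condition,
    fun a => 𝒰.ι_glueMorphisms φ _ a⟩

theorem hom_ext_of_opens {α : Type*} (U : α → Y.Opens) (hU : ∀ y, ∃ a, y ∈ U a)
    {f g : Y ⟶ Z} (H : ∀ a, (U a).ι ≫ f = (U a).ι ≫ g) : f = g :=
  (Scheme.openCoverOfIsOpenCover Y U (by
    rw [TopologicalSpace.IsOpenCover, eq_top_iff]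
    exact fun y _ => Opens.mem_iSup.mpr (hU y))).hom_ext _ _ H

theorem pull_congr {f g : Y ⟶ X} (h : f = g) {U : X.Opens} {V : Y.Opens} (hf : V ≤ f ⁻¹ᵁ U)
    (a : Γ(X, U)) : f.pull U V hf a = g.pull U V (h ▸ hf) a := by
  subst h; rfl

theorem bijective_pull_ι {U W : Y.Opens} (h : W ≤ U) :
    Function.Bijective (U.ι.pull W (U.ι ⁻¹ᵁ W) le_rfl) := by
  have : IsIso (U.ι.app W) := Scheme.Hom.isIso_app _ _ (by simpa using h)
  have h2 : U.ι.appLE W (U.ι ⁻¹ᵁ W) le_rfl = U.ι.app W := Scheme.Hom.appLE_eq_app _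
  have h3 : IsIso (U.ι.appLE W (U.ι ⁻¹ᵁ W) le_rfl) := h2 ▸ this
  exact ConcreteCategory.bijective_of_isIso (U.ι.appLE W (U.ι ⁻¹ᵁ W) le_rfl)

theorem Rep.of_ι {φ : Y ⟶ ProjSpace K r} {U : Y.Opens} {f : Fin (r + 1) → Γ(Y, U)}
    (H : Rep (U.ι ≫ φ) ⊤ fun i => U.ι.pull U ⊤ U.ι_preimage_self.ge (f i)) : Rep φ U f := by
  intro i W hW hi
  have hb := bijective_pull_ι hW
  have h1 := H i (U.ι ⁻¹ᵁ W) le_top (le_preimage_comp φ U.ι hi le_rfl)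
  simp only [res_pull] at h1
  have h2 : ∀ j, U.ι.pull U (U.ι ⁻¹ᵁ W) (le_top.trans U.ι_preimage_self.ge) (f j) =
      U.ι.pull W (U.ι ⁻¹ᵁ W) le_rfl (Scheme.res hW (f j)) := fun j => (pull_res ..).symm
  constructor
  · have h3 := h1.1
    rw [h2] at h3
    exact (MulEquiv.isUnit_map (RingEquiv.ofBijective _ hb)).mp h3
  · intro j
    apply hb.1
    have h3 := h1.2 j
    rw [h2, h2, ← pull_pull φ U.ι hi le_rfl] at h3
    rw [h3, map_mul]

/-- Homogeneous coordinates may be replaced by proportional ones without common zeros. -/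
theorem Rep.of_proportional {φ : Y ⟶ ProjSpace K r} {V : Y.Opens} {f f' : Fin (r + 1) → Γ(Y, V)}
    (H : Rep φ V f) (hp : ∀ i j, f i * f' j = f j * f' i)
    (hn : ∀ y ∈ V, ∃ i, y ∈ Y.basicOpen (f' i)) : Rep φ V f' := by
  apply Rep.of_locally
  intro y hy
  obtain ⟨k, hk⟩ := hn y hy
  obtain ⟨l, hl⟩ := exists_mem_preimage_dPlus (K := K) φ y
  have hk' : y ∈ Y.basicOpen (f k) := by
    have h1 : y ∈ Y.basicOpen (f l * f' k) := by
      rw [Y.basicOpen_mul, H.basicOpen]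
      exact ⟨⟨hy, hl⟩, hk⟩
    rw [hp, Y.basicOpen_mul] at h1
    exact h1.1
  let W := Y.basicOpen (f k) ⊓ Y.basicOpen (f' k)
  have hW : W ≤ V := inf_le_left.trans (Y.basicOpen_le _)
  have hW' : W ≤ φ ⁻¹ᵁ dPlus (coordX K k) :=
    inf_le_left.trans ((H.basicOpen k).le.trans inf_le_right)
  refine ⟨W, hW, ⟨hk', hk⟩, Rep.of_index k hW' ((isUnit_res_iff _ _).2 inf_le_right) fun j => ?_⟩
  have h1 := H k W hW hW'
  have h2 := congrArg (Scheme.res hW) (hp k j)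
  rw [map_mul, map_mul, h1.2 j] at h2
  rw [← h1.1.mul_right_inj, h2]
  ring

theorem le_preimage_inf (m : Z ⟶ Y) {V₁ V₂ : Y.Opens} {W : Z.Opens} (h₁ : W ≤ m ⁻¹ᵁ V₁)
    (h₂ : W ≤ m ⁻¹ᵁ V₂) : W ≤ m ⁻¹ᵁ (V₁ ⊓ V₂) := fun _ hx => ⟨h₁ hx, h₂ hx⟩

theorem pull_inf_mul {V₁ V₂ : Y.Opens} (m : Z ⟶ Y) {W : Z.Opens} (h₁ : W ≤ m ⁻¹ᵁ V₁)
    (h₂ : W ≤ m ⁻¹ᵁ V₂) (a : Γ(Y, V₁)) (b : Γ(Y, V₂)) :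
    m.pull (V₁ ⊓ V₂) W (le_preimage_inf m h₁ h₂)
      (Scheme.res inf_le_left a * Scheme.res inf_le_right b) =
      m.pull V₁ W h₁ a * m.pull V₂ W h₂ b := by
  rw [map_mul, pull_res, pull_res]

/-- Locally nonvanishing tuples of functions that are proportional to one another on overlaps
define a morphism to projective space. -/
theorem exists_hom_of_tuples (σ : Y ⟶ Base K) {α : Type*} (V : α → Y.Opens)
    (hV : ∀ y, ∃ a, y ∈ V a) (f : ∀ a, Fin (r + 1) → Γ(Y, V a))
    (hn : ∀ a, ∀ y ∈ V a, ∃ i, y ∈ Y.basicOpen (f a i))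
    (hf : ∀ a b i j, Scheme.res (U := V a ⊓ V b) inf_le_left (f a i) *
        Scheme.res (U := V a ⊓ V b) inf_le_right (f b j) =
      Scheme.res (U := V a ⊓ V b) inf_le_left (f a j) *
        Scheme.res (U := V a ⊓ V b) inf_le_right (f b i)) :
    ∃ φ : Y ⟶ ProjSpace K r, φ ≫ (ProjSpace K r ↘ Base K) = σ ∧ ∀ a, Rep φ (V a) (f a) := by
  choose a ha using hV
  choose i hy using fun y => hn (a y) y (ha y)
  let U : Y → Y.Opens := fun y => Y.basicOpen (f (a y) (i y))
  have hUc : ∀ y, ∃ z, y ∈ U z := fun y => ⟨y, hy y⟩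
  have hU : ∀ y, U y ≤ V (a y) := fun y => Y.basicOpen_le _
  choose φ h1 h2 using fun y => exists_hom_of_isUnit σ (U y)
    (fun j => Scheme.res (hU y) (f (a y) j)) (i y) ((isUnit_res_iff _ _).2 le_rfl)
  obtain ⟨Φ, hΦ⟩ := exists_glue U hUc φ (by
    intro x y T s t hst
    refine hom_ext_of_rep ?_ fun p => ?_
    · rw [Category.assoc, Category.assoc, h1, h1, reassoc_of% hst]
    · refine ⟨⊤, _, _, trivial, (h2 x).pullback _ (le_preimage_top _ ⊤),
        (h2 y).pullback _ (le_preimage_top _ ⊤), fun k l => ?_⟩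
      simp only [pull_pull, pull_res]
      have e1 : (⊤ : T.Opens) ≤ (s ≫ (U x).ι) ⁻¹ᵁ V (a x) := fun q _ => hU x (s q).2
      have e2 : (⊤ : T.Opens) ≤ (s ≫ (U x).ι) ⁻¹ᵁ V (a y) := by
        rw [hst]; exact fun q _ => hU y (t q).2
      rw [pull_congr hst.symm, pull_congr hst.symm, ← pull_inf_mul _ e1 e2, ← pull_inf_mul _ e1 e2,
        hf])
  refine ⟨Φ, ?_, fun b => Rep.of_locally fun y hyb => ?_⟩
  · refine hom_ext_of_opens U hUc fun y => ?_
    rw [reassoc_of% hΦ, h1]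
  · have h3 := h2 y
    rw [← hΦ] at h3
    have h4 := h3.of_ι
    let W := V b ⊓ U y
    refine ⟨W, inf_le_left, ⟨hyb, hy y⟩, (h4.res (V' := W) inf_le_right).of_proportional
      (fun k l => ?_) fun z hz => ?_⟩
    · have h5 : W ≤ V b ⊓ V (a y) := inf_le_inf le_rfl (hU y)
      have h6 := congrArg (Scheme.res h5) (hf b (a y) l k)
      simp only [map_mul, res_res] at h6 ⊢
      linear_combination h6
    · obtain ⟨k, hk⟩ := hn b z hz.1
      exact ⟨k, by rw [basicOpen_res']; exact ⟨hz, hk⟩⟩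

end ProjectiveEmbedding

/-! ### Quotients of sections and the cone over the secant variety -/

namespace AlgebraicGeometry.Scheme.Modules

variable {X Y : Scheme.{u}} {M N : X.Modules} {h h' : Γ(M, ⊤)} {U V : X.Opens}

theorem resTop_add (s t : Γ(M, ⊤)) (U : X.Opens) : resTop (s + t) U = resTop s U + resTop t U :=
  map_add (M.presheaf.map _).hom s t

theorem resTop_smul (a : Γ(X, ⊤)) (s : Γ(M, ⊤)) (U : X.Opens) :
    resTop (a • s) U = Scheme.res (le_top : U ≤ ⊤) a • resTop s U :=
  map_smul _ _ _ _

theorem map_smul_resTop (i : U ≤ V) (a : Γ(X, V)) (s : Γ(M, ⊤)) :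
    M.presheaf.map (homOfLE i).op (a • resTop s V) = Scheme.res i a • resTop s U := by
  rw [map_smul, res_resTop]
  rfl

theorem IsGenerator.mono (H : IsGenerator M h U) (i : V ≤ U) : IsGenerator M h V :=
  fun W hW => H W (hW.trans i)

/-- The regular function `s / h` on `U`, for a free generator `h` of `M` over `U` and a global
section `s`. -/
noncomputable def IsGenerator.coeff (H : IsGenerator M h U) (s : Γ(M, ⊤)) : Γ(X, U) :=
  ((H U le_rfl).2 (resTop s U)).choose

theorem IsGenerator.coeff_smul_resTop (H : IsGenerator M h U) (s : Γ(M, ⊤)) :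
    H.coeff s • resTop h U = resTop s U :=
  ((H U le_rfl).2 (resTop s U)).choose_spec

theorem IsGenerator.eq_coeff (H : IsGenerator M h U) {s : Γ(M, ⊤)} {a : Γ(X, U)}
    (ha : a • resTop h U = resTop s U) : a = H.coeff s :=
  (H U le_rfl).1 (ha.trans (H.coeff_smul_resTop s).symm)

theorem IsGenerator.coeff_self (H : IsGenerator M h U) : H.coeff h = 1 :=
  (H.eq_coeff (one_smul _ _)).symm

theorem IsGenerator.coeff_add (H : IsGenerator M h U) (s t : Γ(M, ⊤)) :
    H.coeff (s + t) = H.coeff s + H.coeff t := by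
  refine (H.eq_coeff ?_).symm
  rw [add_smul, H.coeff_smul_resTop, H.coeff_smul_resTop, resTop_add]

theorem IsGenerator.coeff_smul (H : IsGenerator M h U) (a : Γ(X, ⊤)) (s : Γ(M, ⊤)) :
    H.coeff (a • s) = Scheme.res le_top a * H.coeff s := by
  refine (H.eq_coeff ?_).symm
  rw [mul_smul, H.coeff_smul_resTop, resTop_smul]

theorem IsGenerator.res_coeff (H : IsGenerator M h U) (H' : IsGenerator M h V) (i : V ≤ U)
    (s : Γ(M, ⊤)) : Scheme.res i (H.coeff s) = H'.coeff s := by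
  refine H'.eq_coeff ?_
  rw [← map_smul_resTop, H.coeff_smul_resTop, res_resTop]

theorem IsGenerator.coeff_mul_coeff (H : IsGenerator M h U) (H' : IsGenerator M h' U)
    (s : Γ(M, ⊤)) : H'.coeff s * H.coeff h' = H.coeff s := by
  refine H.eq_coeff ?_
  rw [mul_smul, H.coeff_smul_resTop, H'.coeff_smul_resTop]

theorem IsGenerator.coeff_of_iso (H : IsGenerator M h U) (e : M ≅ N) (s : Γ(M, ⊤)) :
    (H.of_iso e).coeff (e.hom.app ⊤ s) = H.coeff s := by
  refine ((H.of_iso e).eq_coeff ?_).symm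
  rw [← app_resTop, ← Hom.app_smul, H.coeff_smul_resTop, app_resTop]

/-- The unit of the adjunction commutes with restriction to open sets. -/
theorem unit_app_resTop (f : Y ⟶ X) (s : Γ(M, ⊤)) (U : X.Opens) :
    (((pullbackPushforwardAdjunction f).unit.app M).app U (resTop s U) :
      Γ((pushforward f).obj ((Scheme.Modules.pullback f).obj M), U)) =
      (resTop (pullTop f s) (f ⁻¹ᵁ U) : Γ((Scheme.Modules.pullback f).obj M, f ⁻¹ᵁ U)) :=
  app_resTop ((pullbackPushforwardAdjunction f).unit.app M) s U

/-- The quotient `s / h` of sections pulls back to the quotient of the pulled back sections. -/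
theorem IsGenerator.pull_coeff (H : IsGenerator M h U) (f : Y ⟶ X) {W : Y.Opens}
    (hW : W ≤ f ⁻¹ᵁ U) (H' : IsGenerator ((Scheme.Modules.pullback f).obj M) (pullTop f h) W)
    (s : Γ(M, ⊤)) : f.pull U W hW (H.coeff s) = H'.coeff (pullTop f s) := by
  have h1 : f.pull U (f ⁻¹ᵁ U) le_rfl (H.coeff s) = (H.pullback f).coeff (pullTop f s) := by
    refine (H.pullback f).eq_coeff ?_
    have h2 := congrArg (((pullbackPushforwardAdjunction f).unit.app M).app U)
      (H.coeff_smul_resTop s)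
    rw [Hom.app_smul, unit_app_resTop, unit_app_resTop] at h2
    have h3 : f.pull U (f ⁻¹ᵁ U) le_rfl (H.coeff s) = f.app U (H.coeff s) := by
      unfold Hom.pull
      rw [Scheme.Hom.appLE_eq_app]
    rw [h3]
    exact h2
  rw [← (H.pullback f).res_coeff H' hW, ← h1, res_pull]

end AlgebraicGeometry.Scheme.Modules

namespace ProjectiveEmbedding

open AlgebraicGeometry.Scheme AlgebraicGeometry.Scheme.Modules

variable {K : Type u} [Field K] {X Y Z : Scheme.{u}} {r : ℕ}

/-- The ring homomorphism `Γ(X, U) → A` given by a morphism `z : Spec A → X` into `U`. -/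
noncomputable def evalHom {A : CommRingCat.{u}} (z : Spec A ⟶ X) {U : X.Opens} (h : ⊤ ≤ z ⁻¹ᵁ U) :
    Γ(X, U) →+* A :=
  (Scheme.ΓSpecIso A).hom.hom.comp (z.pull U ⊤ h)

theorem pull_eq_of_evalHom {A : CommRingCat.{u}} (z : Spec A ⟶ X) {U : X.Opens} (h : ⊤ ≤ z ⁻¹ᵁ U)
    (a : Γ(X, U)) : z.pull U ⊤ h a = (Scheme.ΓSpecIso A).inv.hom (evalHom z h a) :=
  (congrArg (fun t => t.hom (z.pull U ⊤ h a)) (Scheme.ΓSpecIso A).hom_inv_id).symm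

theorem evalHom_consts {A : CommRingCat.{u}} (σ : X ⟶ Base K) (z : Spec A ⟶ X) {U : X.Opens}
    (h : ⊤ ≤ z ⁻¹ᵁ U) (κ : K →+* A) (hz : z ≫ σ = Spec.map (CommRingCat.ofHom κ)) (c : K) :
    evalHom z h (consts σ U c) = κ c := by
  simp only [evalHom, RingHom.comp_apply, pull_consts, hz]
  rw [consts_apply, pull_specMap]
  exact congrArg (fun t => t.hom (κ c)) (Scheme.ΓSpecIso A).inv_hom_id

section Cone

variable [X.Over (Base K)] {L : X.Modules} {h h' : GlobalSections L} {U V : X.Opens}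

/-- The regular function `s / h` on `U`, for sections `s` and `h` of `L` such that `h` freely
generates `L` over `U`. -/
noncomputable def quo (H : IsGenerator L h U) (s : GlobalSections L) : Γ(X, U) := H.coeff s

theorem quo_self (H : IsGenerator L h U) : quo H h = 1 := H.coeff_self

theorem quo_add (H : IsGenerator L h U) (s t : GlobalSections L) :
    quo H (s + t) = quo H s + quo H t := H.coeff_add s t

theorem res_quo (H : IsGenerator L h U) (H' : IsGenerator L h V) (i : V ≤ U)
    (s : GlobalSections L) : Scheme.res i (quo H s) = quo H' s := H.res_coeff H' i s

theorem quo_mul_quo (H : IsGenerator L h U) (H' : IsGenerator L h' U) (s : GlobalSections L) :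
    quo H' s * quo H h' = quo H s := H.coeff_mul_coeff H' s

theorem quo_smul (H : IsGenerator L h U) (c : K) (s : GlobalSections L) :
    quo H (c • s) = consts (X ↘ Base K) U c * quo H s := by
  refine (H.coeff_smul _ s).trans ?_
  change _ * quo H s = _
  congr 1

/-- The structure map `K → A` of an algebra over the algebraic closure of `K`. -/
noncomputable abbrev baseMap (K : Type u) [Field K] (A : Type u) [CommRing A]
    [Algebra (AlgebraicClosure K) A] : K →+* A :=
  (algebraMap (AlgebraicClosure K) A).comp (algebraMap K (AlgebraicClosure K))

theorem pull_quo (H : IsGenerator L h U) (z : Y ⟶ X) {W : Y.Opens} (hU : W ≤ z ⁻¹ᵁ U)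
    (H' : IsGenerator ((Scheme.Modules.pullback z).obj L) (pullTop z h) W) (s : GlobalSections L) :
    H'.coeff (pullbackSection L z s) = z.pull U W hU (quo H s) :=
  (H.pull_coeff z hU H' s).symm

/-- Once the line bundle is trivialized by `h`, the span of a subscheme `Spec A` of length two
consists of the functionals `s ↦ lam (s / h)` for `K̄`-linear functionals `lam` on `A`. -/
theorem exists_mem_secantCone (H : IsGenerator L h U) (A : CommRingCat.{u})
    [Algebra (AlgebraicClosure K) A] (hA : Module.finrank (AlgebraicClosure K) A = 2)
    (z : Spec A ⟶ X) (hz : z ≫ (X ↘ Base K) = Spec.map (CommRingCat.ofHom (baseMap K A)))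
    (hU : ⊤ ≤ z ⁻¹ᵁ U) (lam : A →ₗ[AlgebraicClosure K] AlgebraicClosure K) :
    ∃ ℓ ∈ secantCone K L, ∀ s, ℓ s = lam (evalHom z hU (quo H s)) := by
  let ℓ : GlobalSections L →ₗ[K] AlgebraicClosure K :=
    { toFun := fun s => lam (evalHom z hU (quo H s))
      map_add' := fun s t => by rw [quo_add, map_add, map_add]
      map_smul' := fun c s => by
        rw [quo_smul, map_mul, evalHom_consts _ z hU _ hz, RingHom.comp_apply,
          ← Algebra.smul_def, LinearMap.map_smul, smul_eq_mul, RingHom.id_apply,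
          Algebra.smul_def] }
  have H' := (H.pullback z).mono hU
  refine ⟨ℓ, ⟨A, inferInstance, z,
    { toFun := fun m => lam ((Scheme.ΓSpecIso A).hom.hom (H'.coeff m))
      map_zero' := ?_
      map_add' := fun m n => ?_ }, hA, hz, fun c m => ?_, fun s => ?_⟩, fun s => rfl⟩
  · have := H'.coeff_add 0 0
    simp only [add_zero, left_eq_add] at this
    rw [this]; simp
  · rw [H'.coeff_add]; simp
  · change lam ((Scheme.ΓSpecIso A).hom.hom _) = c * lam _
    rw [smul_Spec_def]
    have h1 := H'.coeff_smul (Scheme.res (le_top : (⊤ : (Spec A).Opens) ≤ ⊤)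
      ((Scheme.ΓSpecIso A).inv.hom (algebraMap (AlgebraicClosure K) A c))) m
    rw [res_res, res_rfl] at h1
    refine (congrArg (fun t => lam ((Scheme.ΓSpecIso A).hom.hom t)) h1).trans ?_
    rw [map_mul]
    have h2 := congrArg (fun t => t.hom (algebraMap (AlgebraicClosure K) A c))
      (Scheme.ΓSpecIso A).inv_hom_id
    have h3 : (Scheme.ΓSpecIso A).hom.hom ((Scheme.ΓSpecIso A).inv.hom
      (algebraMap (AlgebraicClosure K) A c)) = algebraMap (AlgebraicClosure K) A c := h2
    rw [h3, ← Algebra.smul_def, LinearMap.map_smul, smul_eq_mul]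
  · have := pull_quo H z hU H' s
    exact (congrArg (fun t => lam ((Scheme.ΓSpecIso A).hom.hom t)) this).symm

/-- Every element of the cone is of the form `s ↦ lam (s / h)`, for any trivialization `h` near the
subscheme of length two. -/
theorem exists_of_mem_secantCone {ℓ : GlobalSections L →ₗ[K] AlgebraicClosure K}
    (hℓ : ℓ ∈ secantCone K L) :
    ∃ (A : CommRingCat.{u}) (_ : Algebra (AlgebraicClosure K) A) (z : Spec A ⟶ X),
      Module.finrank (AlgebraicClosure K) A = 2 ∧
      z ≫ (X ↘ Base K) = Spec.map (CommRingCat.ofHom (baseMap K A)) ∧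
      ∀ (U : X.Opens) (h : GlobalSections L) (H : IsGenerator L h U) (hU : ⊤ ≤ z ⁻¹ᵁ U),
        ∃ lam : A →ₗ[AlgebraicClosure K] AlgebraicClosure K,
          ∀ s, ℓ s = lam (evalHom z hU (quo H s)) := by
  obtain ⟨A, iA, z, lam, hA, hz, hl, hs⟩ := hℓ
  refine ⟨A, iA, z, hA, hz, fun U h H hU => ?_⟩
  have H' := (H.pullback z).mono hU
  refine ⟨{ toFun := fun a => lam (a • pullTop z h)
            map_add' := fun a b => ?_
            map_smul' := fun c a => ?_ }, fun s => ?_⟩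
  · rw [add_smul, map_add]
  · rw [RingHom.id_apply, smul_eq_mul, ← hl, smul_smul, Algebra.smul_def]
  · rw [hs]
    change _ = lam (evalHom z hU (quo H s) • pullTop z h)
    congr 1
    have h1 := H'.coeff_smul_resTop (pullbackSection L z s)
    rw [resTop_app_top, resTop_app_top, pull_quo H z hU H', pull_eq_of_evalHom] at h1
    rw [← h1, smul_Spec_def]
    congr 1

end Cone

section Sections

variable {L : X.Modules}

/-- The morphism `φ` to projective space is `[s₀ : … : s_r]`, for global sections `sᵢ` of `L`: its
homogeneous coordinates are the functions `sᵢ / h`, for any local free generator `h` of `L`. -/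
def SecRep (L : X.Modules) (φ : X ⟶ ProjSpace K r) (s : Fin (r + 1) → GlobalSections L) : Prop :=
  ∀ (U : X.Opens) (h : GlobalSections L) (H : IsGenerator L h U), Rep φ U fun i => quo H (s i)

/-- An isomorphism `ψ^* 𝒪(1) ≅ L` turns linear forms on projective space into sections of `L`. -/
theorem exists_sections (ψ : X ⟶ ProjSpace K r)
    (e : (Scheme.Modules.pullback ψ).obj (twistOne K r) ≅ L) :
    ∃ (sec : ∀ b ∈ grading K r 1, GlobalSections L)
      (gen : ∀ b hb, IsGenerator L (sec b hb) (ψ ⁻¹ᵁ dPlus b)),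
      ∀ a ha b hb, quo (gen b hb) (sec a ha) = ψ.pull (dPlus b) _ le_rfl (frac ha hb) := by
  let x : ∀ b ∈ grading K r 1, Γ(twistOne K r, ⊤) := TwistingSheaf.ofDegree (grading K r) 1
  have G : ∀ b hb, IsGenerator (twistOne K r) (x b hb) (dPlus b) :=
    fun b hb => TwistingSheaf.isGenerator_ofDegree (grading K r) hb
  refine ⟨fun b hb => e.hom.app ⊤ (pullTop ψ (x b hb)),
    fun b hb => ((G b hb).pullback ψ).of_iso e, fun a ha b hb => ?_⟩
  refine (((G b hb).pullback ψ).coeff_of_iso e _).trans ?_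
  refine ((G b hb).pull_coeff ψ le_rfl _ (x a ha)).symm.trans (congrArg _ ?_)
  exact ((G b hb).eq_coeff (TwistingSheaf.resTop_ofDegree (grading K r) ha hb).symm).symm

/-- It is enough to consider the trivializations given by the sections `xᵢ` themselves. -/
theorem secRep_of_quo_eq {ψ : X ⟶ ProjSpace K r} {x : Fin (r + 1) → GlobalSections L}
    (gen : ∀ i, IsGenerator L (x i) (ψ ⁻¹ᵁ dPlus (coordX K i)))
    (hq : ∀ i j, quo (gen i) (x j) = ψ.pull _ _ le_rfl (frac (coordX_mem j) (coordX_mem i))) :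
    SecRep L ψ x := by
  intro U h H
  refine Rep.of_locally fun y hy => ?_
  obtain ⟨i, hi⟩ := exists_mem_preimage_dPlus (K := K) ψ y
  let W := U ⊓ ψ ⁻¹ᵁ dPlus (coordX K i)
  have hW : W ≤ ψ ⁻¹ᵁ dPlus (coordX K i) := inf_le_right
  have H₁ : IsGenerator L h W := H.mono inf_le_left
  have H₂ : IsGenerator L (x i) W := (gen i).mono inf_le_right
  refine ⟨W, inf_le_left, ⟨hy, hi⟩, ?_⟩
  simp only [res_quo H H₁]
  refine Rep.of_index i inf_le_right ?_ fun j => ?_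
  · refine .of_mul_eq_one_right (quo H₂ h) ?_
    rw [quo_mul_quo H₁ H₂, quo_self]
  · rw [← quo_mul_quo H₁ H₂, ← res_quo (gen i) H₂ hW, hq, res_pull]

end Sections

end ProjectiveEmbedding

/-! ### Points over the algebraic closure and subschemes of length two -/

namespace ProjectiveEmbedding

open AlgebraicGeometry.Scheme AlgebraicGeometry.Scheme.Modules

variable {K : Type u} [Field K] {X Y Z W : Scheme.{u}} {r : ℕ}

variable (K) in
/-- The scheme `Spec K̄`. -/
noncomputable abbrev GeomPoint : Scheme.{u} := Spec (CommRingCat.of (AlgebraicClosure K))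

variable (K) in
/-- The structure morphism `Spec K̄ → Spec K`. -/
noncomputable abbrev geomPointToBase : GeomPoint K ⟶ Base K :=
  Spec.map (CommRingCat.ofHom (algebraMap K (AlgebraicClosure K)))

variable (K) in
/-- The structure morphism `Spec A → Spec K̄` of a `K̄`-algebra. -/
noncomputable abbrev toGeomPoint (A : CommRingCat.{u}) [Algebra (AlgebraicClosure K) A] :
    Spec A ⟶ GeomPoint K :=
  Spec.map (CommRingCat.ofHom (R := AlgebraicClosure K) (S := A)
    (algebraMap (AlgebraicClosure K) A))

theorem top_le_preimage_fromSpec {V : Y.Opens} (hV : IsAffineOpen V) {S : CommRingCat.{u}}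
    (θ : Γ(Y, V) ⟶ S) : ⊤ ≤ (Spec.map θ ≫ hV.fromSpec) ⁻¹ᵁ V := by
  intro p _
  have : hV.fromSpec (Spec.map θ p) ∈ Set.range hV.fromSpec := ⟨_, rfl⟩
  rw [hV.range_fromSpec] at this
  exact this

theorem evalHom_specMap_fromSpec {V : Y.Opens} (hV : IsAffineOpen V) {S : CommRingCat.{u}}
    (θ : Γ(Y, V) ⟶ S) (a : Γ(Y, V)) :
    evalHom (Spec.map θ ≫ hV.fromSpec) (top_le_preimage_fromSpec hV θ) a = θ.hom a := by
  have h1 := pull_pull hV.fromSpec (Spec.map θ) hV.fromSpec_preimage_self.ge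
    (le_preimage_top (Spec.map θ) ⊤) a
  rw [pull_fromSpec, pull_specMap] at h1
  rw [evalHom, RingHom.comp_apply, ← h1]
  exact congrArg (fun t => t.hom (θ.hom a)) (Scheme.ΓSpecIso S).inv_hom_id

theorem evalHom_specMap_comp {R S : CommRingCat.{u}} (y : Spec R ⟶ Y) (θ : R ⟶ S) {V : Y.Opens}
    (h : ⊤ ≤ y ⁻¹ᵁ V) (h' : ⊤ ≤ (Spec.map θ ≫ y) ⁻¹ᵁ V) (a : Γ(Y, V)) :
    evalHom (Spec.map θ ≫ y) h' a = θ.hom (evalHom y h a) := by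
  have h1 := pull_pull y (Spec.map θ) h (le_preimage_top (Spec.map θ) ⊤) a
  rw [pull_eq_of_evalHom y, pull_specMap] at h1
  rw [evalHom, RingHom.comp_apply, ← h1]
  exact congrArg (fun t => t.hom (θ.hom (evalHom y h a))) (Scheme.ΓSpecIso S).inv_hom_id

theorem evalHom_congr {A : CommRingCat.{u}} {z z' : Spec A ⟶ Y} (hz : z = z') {V : Y.Opens}
    (h : ⊤ ≤ z ⁻¹ᵁ V) (a : Γ(Y, V)) : evalHom z h a = evalHom z' (hz ▸ h) a := by
  subst hz; rfl

/-- A morphism from an affine scheme into an affine open set is determined by its values on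
functions. -/
theorem hom_ext_of_evalHom {A : CommRingCat.{u}} {z z' : Spec A ⟶ Y} {V : Y.Opens}
    (hV : IsAffineOpen V) (h : ⊤ ≤ z ⁻¹ᵁ V) (h' : ⊤ ≤ z' ⁻¹ᵁ V)
    (H : ∀ a, evalHom z h a = evalHom z' h' a) : z = z' :=
  hom_ext_of_pull hV h h' fun a => by
    rw [pull_eq_of_evalHom, pull_eq_of_evalHom, H]

theorem finiteType_consts (σ : Y ⟶ Base K) [LocallyOfFiniteType σ] {V : Y.Opens}
    (hV : IsAffineOpen V) : (consts σ V).FiniteType := by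
  have h1 := Scheme.Hom.finiteType_appLE σ (isAffineOpen_top (Base K)) hV (le_preimage_top σ V)
  have h2 : Function.Surjective (Scheme.ΓSpecIso (CommRingCat.of K)).inv.hom := fun a =>
    ⟨(Scheme.ΓSpecIso (CommRingCat.of K)).hom.hom a,
      congrArg (fun t => t.hom a) (Scheme.ΓSpecIso (CommRingCat.of K)).hom_inv_id⟩
  exact h1.comp (RingHom.FiniteType.of_surjective _ h2)

/-- A residue field of an algebra of finite type over `K` embeds into the algebraic closure. -/
theorem exists_hom_algebraicClosure {B : Type u} [CommRing B] (κ : K →+* B) (hκ : κ.FiniteType)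
    (m : Ideal B) [m.IsMaximal] : ∃ ρ : B ⧸ m →+* AlgebraicClosure K,
      (ρ.comp (Ideal.Quotient.mk m)).comp κ = algebraMap K (AlgebraicClosure K) := by
  algebraize [κ]
  let : Field (B ⧸ m) := Ideal.Quotient.field m
  have : Algebra.FiniteType K (B ⧸ m) := inferInstance
  have : Module.Finite K (B ⧸ m) := finite_of_finite_type_of_isJacobsonRing K (B ⧸ m)
  have : Algebra.IsAlgebraic K (B ⧸ m) := inferInstance
  let f : B ⧸ m →ₐ[K] AlgebraicClosure K := IsAlgClosed.lift
  refine ⟨f.toRingHom, RingHom.ext fun c => ?_⟩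
  exact f.commutes c

/-- A nonempty closed subset of a scheme locally of finite type has a point over the algebraic
closure. -/
theorem exists_geomPoint (σ : Y ⟶ Base K) [LocallyOfFiniteType σ] {C : Set Y} (hC : IsClosed C)
    (hne : C.Nonempty) :
    ∃ y : GeomPoint K ⟶ Y, y ≫ σ = geomPointToBase K ∧ ∀ p, y p ∈ C := by
  obtain ⟨c, hc⟩ := hne
  obtain ⟨V, hV, hcV, -⟩ := exists_isAffineOpen_mem_and_subset (x := c) (U := ⊤) trivial
  let C' : Set (Spec Γ(Y, V)) := hV.fromSpec ⁻¹' C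
  have hC' : IsClosed C' := hC.preimage hV.fromSpec.continuous
  obtain ⟨p, hp⟩ : ∃ p, hV.fromSpec p = c := by
    have : c ∈ Set.range hV.fromSpec := by rw [hV.range_fromSpec]; exact hcV
    exact this
  obtain ⟨I, hI⟩ := (PrimeSpectrum.isClosed_iff_zeroLocus_ideal C').mp hC'
  have hIp : I ≤ (show PrimeSpectrum Γ(Y, V) from p).asIdeal := by
    have : p ∈ C' := by change hV.fromSpec p ∈ C; rwa [hp]
    rw [hI] at this
    exact this
  obtain ⟨m, hm, hIm⟩ := Ideal.exists_le_maximal I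
    (ne_top_of_le_ne_top (show PrimeSpectrum Γ(Y, V) from p).2.ne_top hIp)
  obtain ⟨ρ, hρ⟩ := exists_hom_algebraicClosure _ (finiteType_consts σ hV) m
  obtain ⟨θ, hθ⟩ : ∃ θ : Γ(Y, V) ⟶ CommRingCat.of (AlgebraicClosure K),
    θ.hom = ρ.comp (Ideal.Quotient.mk m) := ⟨CommRingCat.ofHom (R := Γ(Y, V)) _, rfl⟩
  refine ⟨Spec.map θ ≫ hV.fromSpec, ?_, fun q => ?_⟩
  · rw [Category.assoc, fromSpec_comp_eq σ hV, ← Spec.map_comp]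
    congr 1
    refine CommRingCat.hom_ext (RingHom.ext fun c => ?_)
    exact (RingHom.congr_fun hθ _).trans (RingHom.congr_fun hρ c)
  · have : (Spec.map θ q) ∈ C' := by
      rw [hI]
      intro a ha
      have h1 : θ.hom a = 0 := by
        rw [hθ, RingHom.comp_apply, Ideal.Quotient.eq_zero_iff_mem.mpr (hIm ha), map_zero]
      change θ.hom a ∈ (show PrimeSpectrum (AlgebraicClosure K) from q).asIdeal
      rw [h1]
      exact zero_mem _
    exact this

/-- A ring of finite type over `R` and over `K` is unramified over `R` if every first order
deformation over `R` of a point over the algebraic closure is trivial. -/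
theorem formallyUnramified_of_forall_dual {R B : Type u} [CommRing R] [CommRing B] (κ : K →+* R)
    (φ : R →+* B) (hφ : φ.FiniteType) (hκ : (φ.comp κ).FiniteType)
    (H : ∀ θ : B →+* QuadraticAlgebra (AlgebraicClosure K) 0 0,
      (∀ a, θ (φ (κ a)) = algebraMap _ _ (algebraMap K (AlgebraicClosure K) a)) →
      (∀ a, (θ (φ a)).im = 0) → ∀ b, (θ b).im = 0) : φ.FormallyUnramified := by
  algebraize [φ]
  rw [RingHom.FormallyUnramified, Algebra.formallyUnramified_iff]
  by_contra hn
  rw [not_subsingleton_iff_nontrivial] at hn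
  obtain ⟨N, hN, -⟩ := (eq_top_or_exists_le_coatom (⊥ : Submodule B (Ω[B⁄R]))).resolve_left
    bot_ne_top
  have hs : IsSimpleModule B (Ω[B⁄R] ⧸ N) := isSimpleModule_iff_isCoatom.mpr hN
  obtain ⟨m, hm, ⟨e⟩⟩ := isSimpleModule_iff_quot_maximal.mp hs
  obtain ⟨ρ, hρ⟩ := exists_hom_algebraicClosure _ hκ m
  let g : Ω[B⁄R] →ₗ[B] B ⧸ m := e.toLinearMap.comp N.mkQ
  let D : B → B ⧸ m := fun b => g (KaehlerDifferential.D R B b)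
  have hD : ∀ a b, D (a * b) = Ideal.Quotient.mk m a * D b + Ideal.Quotient.mk m b * D a := by
    intro a b
    simp only [D, Derivation.leibniz, map_add, LinearMap.map_smul]
    rfl
  let ρ' := ρ.comp (Ideal.Quotient.mk m)
  let θ : B →+* QuadraticAlgebra (AlgebraicClosure K) 0 0 :=
    { toFun := fun b => ⟨ρ' b, ρ (D b)⟩
      map_one' := by ext <;> simp [D, QuadraticAlgebra.re_one, QuadraticAlgebra.im_one]
      map_zero' := by ext <;> simp [D]
      map_add' := fun a b => by ext <;> simp [D]
      map_mul' := fun a b => by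
        ext
        · simp
        · simp only [hD, map_add, map_mul, QuadraticAlgebra.im_mul, ρ', RingHom.comp_apply]
          ring }
  have hφD : ∀ a, D (φ a) = 0 := by
    intro a
    have : KaehlerDifferential.D R B (algebraMap R B a) = 0 := Derivation.map_algebraMap _ _
    change g (KaehlerDifferential.D R B (algebraMap R B a)) = 0
    rw [this, map_zero]
  have hk : ∀ a, θ (φ (κ a)) = algebraMap _ _ (algebraMap K (AlgebraicClosure K) a) := by
    intro a
    ext
    · exact RingHom.congr_fun hρ a
    · exact (congrArg ρ (hφD (κ a))).trans (map_zero ρ)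
  have h1 := H θ hk fun a => (congrArg ρ (hφD a)).trans (map_zero ρ)
  have h2 : ∀ b, D b = 0 := by
    intro b
    let : Field (B ⧸ m) := Ideal.Quotient.field m
    exact ρ.injective ((h1 b).trans (map_zero ρ).symm)
  have h3 : g = 0 := by
    have : (⊤ : Submodule B (Ω[B⁄R])) ≤ LinearMap.ker g := by
      rw [← KaehlerDifferential.span_range_derivation, Submodule.span_le]
      rintro _ ⟨b, rfl⟩
      exact h2 b
    exact LinearMap.ker_eq_top.mp (top_le_iff.mp this)
  have h4 : N = ⊤ := by
    rw [eq_top_iff]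
    intro v _
    have h5 := LinearMap.congr_fun h3 v
    have h6 : N.mkQ v = 0 := e.injective (h5.trans (map_zero e).symm)
    simpa using h6
  exact hN.1 h4

/-- Two points over the algebraic closure, as a morphism from the spectrum of `K̄ × K̄`. -/
theorem exists_pair (y₁ y₂ : GeomPoint K ⟶ Y) :
    ∃ z : Spec (CommRingCat.of (AlgebraicClosure K × AlgebraicClosure K)) ⟶ Y,
      Spec.map (CommRingCat.ofHom (RingHom.fst _ _)) ≫ z = y₁ ∧
      Spec.map (CommRingCat.ofHom (RingHom.snd _ _)) ≫ z = y₂ := by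
  let k := AlgebraicClosure K
  refine ⟨inv (coprodSpec k k) ≫ Limits.coprod.desc y₁ y₂, ?_, ?_⟩
  · rw [← coprodSpec_inl, Category.assoc, IsIso.hom_inv_id_assoc, Limits.coprod.inl_desc]
  · rw [← coprodSpec_inr, Category.assoc, IsIso.hom_inv_id_assoc, Limits.coprod.inr_desc]

/-- The scheme `Spec (K̄ × K̄)` is the disjoint union of two copies of `Spec K̄`. -/
theorem pair_hom_ext {z z' : Spec (CommRingCat.of (AlgebraicClosure K × AlgebraicClosure K)) ⟶ Y}
    (h₁ : Spec.map (CommRingCat.ofHom (RingHom.fst _ _)) ≫ z =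
      Spec.map (CommRingCat.ofHom (RingHom.fst _ _)) ≫ z')
    (h₂ : Spec.map (CommRingCat.ofHom (RingHom.snd _ _)) ≫ z =
      Spec.map (CommRingCat.ofHom (RingHom.snd _ _)) ≫ z') : z = z' := by
  let k := AlgebraicClosure K
  rw [← cancel_epi (coprodSpec k k)]
  apply Limits.coprod.hom_ext
  · rwa [coprodSpec_inl_assoc, coprodSpec_inl_assoc]
  · rwa [coprodSpec_inr_assoc, coprodSpec_inr_assoc]

/-- The morphism `f` separates subschemes of length two: if `A` is a `K̄`-algebra of dimension two,
every morphism from `Spec A` on which `f` becomes constant, i.e. factors through `Spec K̄`, is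
itself constant. -/
def SeparatesLengthTwo (σ : Y ⟶ Base K) (f : Y ⟶ W) : Prop :=
  ∀ (A : CommRingCat.{u}) [Algebra (AlgebraicClosure K) A],
    Module.finrank (AlgebraicClosure K) A = 2 → ∀ z : Spec A ⟶ Y,
    z ≫ σ = Spec.map (CommRingCat.ofHom (baseMap K A)) →
    (∃ w : GeomPoint K ⟶ W, z ≫ f = toGeomPoint K A ≫ w) →
    ∃ y : GeomPoint K ⟶ Y, z = toGeomPoint K A ≫ y

/-- Morphisms from the spectrum of the dual numbers are tangent vectors, so a morphism that
separates them is unramified. -/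
theorem SeparatesLengthTwo.formallyUnramified {σ : Y ⟶ Base K} {τ : W ⟶ Base K} {f : Y ⟶ W}
    (hf : f ≫ τ = σ) [LocallyOfFiniteType σ] [LocallyOfFiniteType f]
    (H : SeparatesLengthTwo σ f) : FormallyUnramified f := by
  refine ⟨fun {U} hU {V} hV e => ?_⟩
  have hc : (f.appLE U V e).hom.comp (consts τ U) = consts σ V := by
    ext a
    exact (pull_consts τ f e a).trans (by rw [hf])
  refine formallyUnramified_of_forall_dual (consts τ U) _ (f.finiteType_appLE hU hV e)
    (hc ▸ finiteType_consts σ hV) fun θ h1 h2 b => ?_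
  let k := AlgebraicClosure K
  let A := CommRingCat.of (QuadraticAlgebra k 0 0)
  obtain ⟨θ', hθ⟩ : ∃ θ' : Γ(Y, V) ⟶ A, θ'.hom = θ :=
    ⟨CommRingCat.ofHom (R := Γ(Y, V)) (S := QuadraticAlgebra k 0 0) θ, rfl⟩
  obtain ⟨ρ, hρ⟩ : ∃ ρ : Γ(W, U) ⟶ CommRingCat.of k, ∀ a, ρ.hom a = (θ (f.appLE U V e a)).re := by
    let ρ' : Γ(W, U) →+* k :=
      { toFun := fun a => (θ ((f.appLE U V e).hom a)).re
        map_one' := by simp [QuadraticAlgebra.re_one]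
        map_zero' := by simp
        map_add' := fun a b => by simp
        map_mul' := fun a b => by simp }
    exact ⟨CommRingCat.ofHom (R := Γ(W, U)) (S := k) ρ', fun a => rfl⟩
  obtain ⟨y, hy⟩ := H A (QuadraticAlgebra.finrank_eq_two ..) (Spec.map θ' ≫ hV.fromSpec) (by
      rw [Category.assoc, fromSpec_comp_eq, ← Spec.map_comp]
      congr 1
      refine CommRingCat.hom_ext (RingHom.ext fun a => ?_)
      have := h1 a
      rw [← RingHom.comp_apply (f.appLE U V e).hom, hc] at this
      exact (RingHom.congr_fun hθ _).trans this)
    ⟨Spec.map ρ ≫ hU.fromSpec, by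
      rw [Category.assoc, ← IsAffineOpen.SpecMap_appLE_fromSpec f hU hV e, ← Spec.map_comp_assoc,
        ← Spec.map_comp_assoc]
      congr 2
      refine CommRingCat.hom_ext (RingHom.ext fun a => ?_)
      change θ'.hom _ = algebraMap k (QuadraticAlgebra k 0 0) (ρ.hom a)
      rw [hθ, hρ]
      ext
      · rfl
      · exact h2 a⟩
  have hz := top_le_preimage_fromSpec hV θ'
  have hyV : ⊤ ≤ y ⁻¹ᵁ V := by
    intro p _
    let q : Spec A := Classical.arbitrary _
    have e1 : toGeomPoint K A q = p := Subsingleton.elim _ _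
    have e2 := hz (show q ∈ (⊤ : (Spec A).Opens) from trivial)
    rw [hy] at e2
    change y p ∈ V
    rw [← e1]
    exact e2
  have e3 := evalHom_congr hy hz b
  rw [evalHom_specMap_fromSpec, evalHom_specMap_comp y _ hyV, hθ] at e3
  rw [e3]
  rfl

/-- A morphism that is injective on subschemes of length two is a monomorphism: it is unramified,
so its diagonal is an open immersion, and the diagonal contains all closed points. -/
theorem SeparatesLengthTwo.mono {σ : Y ⟶ Base K} {τ : W ⟶ Base K} {f : Y ⟶ W}
    (hf : f ≫ τ = σ) [LocallyOfFiniteType σ] [LocallyOfFiniteType f]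
    (H : SeparatesLengthTwo σ f) : Mono f := by
  have := H.formallyUnramified hf
  rw [← Limits.pullback.isIso_diagonal_iff]
  have hopen : IsOpenImmersion (Limits.pullback.diagonal f) := inferInstance
  let P := Limits.pullback f f
  let σP : P ⟶ Base K := Limits.pullback.fst f f ≫ σ
  have hsurj : Function.Surjective (Limits.pullback.diagonal f) := by
    by_contra hn
    have hC : IsClosed (Set.range (Limits.pullback.diagonal f))ᶜ :=
      (Limits.pullback.diagonal f).isOpenEmbedding.isOpen_range.isClosed_compl
    obtain ⟨y, hy, hyC⟩ := exists_geomPoint σP hC (by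
      rw [Set.nonempty_compl]
      exact fun h => hn (Set.range_eq_univ.mp h))
    obtain ⟨z, hz1, hz2⟩ := exists_pair (y ≫ Limits.pullback.fst f f) (y ≫ Limits.pullback.snd f f)
    let A := CommRingCat.of (AlgebraicClosure K × AlgebraicClosure K)
    have hid1 : Spec.map (CommRingCat.ofHom (RingHom.fst (AlgebraicClosure K) (AlgebraicClosure K)))
        ≫ toGeomPoint K A = 𝟙 _ := by
      rw [← Spec.map_comp, ← Spec.map_id]; rfl
    have hid2 : Spec.map (CommRingCat.ofHom (RingHom.snd (AlgebraicClosure K) (AlgebraicClosure K)))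
        ≫ toGeomPoint K A = 𝟙 _ := by
      rw [← Spec.map_comp, ← Spec.map_id]; rfl
    have hb : Spec.map (CommRingCat.ofHom (baseMap K A)) = toGeomPoint K A ≫ geomPointToBase K := by
      rw [← Spec.map_comp]; rfl
    have hσ2 : Limits.pullback.snd f f ≫ σ = σP := by
      rw [← hf, ← Limits.pullback.condition_assoc, hf]
    obtain ⟨y', hy'⟩ := H A (by simp [A]) z (by
        rw [hb]
        apply pair_hom_ext
        · rw [reassoc_of% hz1, reassoc_of% hid1]; exact hy
        · rw [reassoc_of% hz2, reassoc_of% hid2, hσ2]; exact hy)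
      ⟨y ≫ Limits.pullback.fst f f ≫ f, by
        apply pair_hom_ext
        · rw [reassoc_of% hz1, reassoc_of% hid1]
        · rw [reassoc_of% hz2, reassoc_of% hid2, Limits.pullback.condition]⟩
    rw [hy', reassoc_of% hid1] at hz1
    rw [hy', reassoc_of% hid2] at hz2
    have hyd : y = y' ≫ Limits.pullback.diagonal f := by
      apply Limits.pullback.hom_ext
      · rw [Category.assoc, Limits.pullback.diagonal_fst, Category.comp_id, hz1]
      · rw [Category.assoc, Limits.pullback.diagonal_snd, Category.comp_id, hz2]
    let q : GeomPoint K := Classical.arbitrary _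
    exact hyC q ⟨y' q, by rw [hyd]; simp⟩
  have : Epi (Limits.pullback.diagonal f).base := by
    rw [TopCat.epi_iff_surjective]; exact hsurj
  exact IsOpenImmersion.isIso _

end ProjectiveEmbedding

/-! ### Embeddings and their coordinate sections -/

namespace ProjectiveEmbedding

open AlgebraicGeometry.Scheme AlgebraicGeometry.Scheme.Modules

variable {K : Type u} [Field K] {X Y Z W : Scheme.{u}} {r n : ℕ}

/-- The projective space over `K` is proper: its structure morphism is that of `Proj` over the
degree zero part, which is `K`. -/
instance isProper_projSpace : IsProper (ProjSpace K r ↘ Base K) := by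
  have h1 : Function.Surjective (algebraMap K (grading K r 0)) := by
    rintro ⟨p, hp⟩
    have hp' : p.totalDegree = 0 := by
      have : p.IsHomogeneous 0 := hp
      exact this.totalDegree_le.antisymm (Nat.zero_le _)
    refine ⟨p.coeff 0, Subtype.ext ?_⟩
    exact (MvPolynomial.totalDegree_eq_zero_iff_eq_C.mp hp').symm
  have : IsScalarTower K (grading K r 0) (MvPolynomial (Fin (r + 1)) K) :=
    ⟨fun a b c => smul_mul_assoc a b.1 c⟩
  have : Algebra.FiniteType (grading K r 0) (MvPolynomial (Fin (r + 1)) K) :=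
    .of_restrictScalars_finiteType K _ _
  have h2 : IsClosedImmersion (Spec.map (CommRingCat.ofHom (algebraMap K (grading K r 0)))) :=
    .spec_of_surjective _ h1
  have h3 : IsProper (Proj.toSpecZero (grading K r)) := inferInstance
  exact inferInstanceAs (IsProper (Proj.toSpecZero (grading K r) ≫
    Spec.map (CommRingCat.ofHom (algebraMap K (grading K r 0)))))

theorem IsProjectiveVariety.isProper [X.Over (Base K)] [H : IsProjectiveVariety K X] :
    IsProper (X ↘ Base K) := by
  obtain ⟨n, i, h1, h2⟩ := H.exists_closedImmersion
  rw [← h2]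
  infer_instance

/-- Over an infinite field, finitely many points of projective space lie off a common
hyperplane. -/
theorem exists_linearForm [Infinite K] (S : Set (ProjSpace K r)) (hS : S.Finite) :
    ∃ b ∈ grading K r 1, S ⊆ dPlus b := by
  let E := grading K r 1
  let I : ProjSpace K r → Ideal (MvPolynomial (Fin (r + 1)) K) := fun x =>
    (show ProjectiveSpectrum (grading K r) from x).asHomogeneousIdeal.toIdeal
  let p : ProjSpace K r → Subspace K E := fun x =>
    { carrier := {b | b.1 ∈ I x}
      zero_mem' := zero_mem (I x)
      add_mem' := fun ha hb => (I x).add_mem ha hb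
      smul_mem' := fun c b hb => by
        change c • b.1 ∈ I x
        rw [MvPolynomial.smul_eq_C_mul]
        exact (I x).mul_mem_left _ hb }
  have : Finite S := hS
  by_contra! hn
  obtain ⟨x, hx⟩ := Subspace.exists_eq_top_of_iUnion_eq_univ (p := fun x : S => p x) (by
    rw [Set.eq_univ_iff_forall]
    rintro ⟨b, hb⟩
    obtain ⟨x, hx, hxb⟩ := Set.not_subset.mp (hn b hb)
    refine Set.mem_iUnion.mpr ⟨⟨x, hx⟩, ?_⟩
    by_contra h
    exact hxb h)
  obtain ⟨i, hi⟩ := exists_mem_dPlus (K := K) x.1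
  have : (⟨coordX K i, coordX_mem i⟩ : E) ∈ p x := hx ▸ trivial
  exact hi this

/-- A finite subscheme lies in the complement of a hyperplane section. -/
theorem exists_linearForm_preimage [Infinite K] (ψ : X ⟶ ProjSpace K r) {A : CommRingCat.{u}}
    [Algebra (AlgebraicClosure K) A]
    (hA : Module.finrank (AlgebraicClosure K) A = 2) (z : Spec A ⟶ X) :
    ∃ b ∈ grading K r 1, ⊤ ≤ z ⁻¹ᵁ (ψ ⁻¹ᵁ dPlus b) := by
  have : Module.Finite (AlgebraicClosure K) A :=
    Module.finite_of_finrank_pos (by omega)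
  have : IsArtinianRing A := IsArtinianRing.of_finite (AlgebraicClosure K) A
  have hfin : Finite (Spec A) := inferInstanceAs (Finite (PrimeSpectrum A))
  obtain ⟨b, hb, h⟩ := exists_linearForm (Set.range (z ≫ ψ)) (Set.finite_range _)
  exact ⟨b, hb, fun p _ => h ⟨p, rfl⟩⟩

/-- An embedding of `X` into projective space, together with an identification of the pullback of
`𝒪(1)` with `L`, in the form of the sections of `L` that correspond to linear forms. -/
structure Frame [X.Over (Base K)] (L : X.Modules) (ψ : X ⟶ ProjSpace K r) where
  isOver : ψ ≫ (ProjSpace K r ↘ Base K) = X ↘ Base K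
  isClosedImmersion : IsClosedImmersion ψ
  /-- the section of `L` given by a linear form -/
  sec : ∀ b ∈ grading K r 1, GlobalSections L
  /-- the section given by `b` freely generates `L` where `b` does not vanish -/
  gen : ∀ b hb, IsGenerator L (sec b hb) (ψ ⁻¹ᵁ dPlus b)
  /-- quotients of sections are the quotients of the linear forms -/
  quo_sec : ∀ a ha b hb, quo (gen b hb) (sec a ha) = ψ.pull (dPlus b) _ le_rfl (frac ha hb)

namespace Frame

variable [X.Over (Base K)] {L : X.Modules} {ψ : X ⟶ ProjSpace K r} (F : Frame L ψ)

/-- The section of `L` that corresponds to the `i`-th coordinate. -/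
noncomputable def coord (i : Fin (r + 1)) : GlobalSections L := F.sec (coordX K i) (coordX_mem i)

theorem secRep : SecRep L ψ F.coord :=
  secRep_of_quo_eq (fun i => F.gen _ (coordX_mem i)) fun _ _ => F.quo_sec _ _ _ _

theorem quo_coord {b : MvPolynomial (Fin (r + 1)) K} (hb : b ∈ grading K r 1) (j : Fin (r + 1)) :
    quo (F.gen b hb) (F.coord j) = ψ.pull (dPlus b) _ le_rfl (frac (coordX_mem j) hb) :=
  F.quo_sec _ _ _ _

theorem isAffineOpen (F : Frame L ψ) {b : MvPolynomial (Fin (r + 1)) K} (hb : b ∈ grading K r 1) :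
    IsAffineOpen (ψ ⁻¹ᵁ dPlus b) := by
  have := F.isClosedImmersion
  exact (isAffineOpen_dPlus hb).preimage ψ

theorem eval₂Hom_quo_coord {b : MvPolynomial (Fin (r + 1)) K} (hb : b ∈ grading K r 1)
    (p : MvPolynomial (Fin (r + 1)) K) :
    MvPolynomial.eval₂Hom (consts (X ↘ Base K) (ψ ⁻¹ᵁ dPlus b))
      (fun j => quo (F.gen b hb) (F.coord j)) p = ψ.pull (dPlus b) _ le_rfl
      (MvPolynomial.eval₂Hom (consts (ProjSpace K r ↘ Base K) (dPlus b))
        (fun j => frac (coordX_mem j) hb) p) := by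
  rw [MvPolynomial.coe_eval₂Hom, MvPolynomial.coe_eval₂Hom, MvPolynomial.hom_eval₂]
  congr 1
  · refine RingHom.ext fun c => ?_
    refine Eq.trans ?_ (pull_consts (ProjSpace K r ↘ Base K) ψ le_rfl c).symm
    rw [F.isOver]
  · funext j
    exact F.quo_coord hb j

/-- Functions on the complement of a hyperplane section are polynomials in the coordinates. -/
theorem surjective_eval₂Hom {b : MvPolynomial (Fin (r + 1)) K} (hb : b ∈ grading K r 1) :
    Function.Surjective (MvPolynomial.eval₂Hom (consts (X ↘ Base K) (ψ ⁻¹ᵁ dPlus b))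
      (fun j => quo (F.gen b hb) (F.coord j))) := by
  have := F.isClosedImmersion
  intro a
  obtain ⟨a', ha'⟩ := ψ.app_surjective _ (isAffineOpen_dPlus hb) a
  obtain ⟨p, hp⟩ := surjective_eval₂Hom_frac hb a'
  refine ⟨p, ?_⟩
  rw [eval₂Hom_quo_coord, hp, ← ha']
  unfold Hom.pull
  rw [Scheme.Hom.appLE_eq_app]

/-- The linear form `b`, evaluated at the functions `xⱼ / b`, is `1`. -/
theorem eval₂Hom_self {b : MvPolynomial (Fin (r + 1)) K} (hb : b ∈ grading K r 1) :
    MvPolynomial.eval₂Hom (consts (X ↘ Base K) (ψ ⁻¹ᵁ dPlus b))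
      (fun j => quo (F.gen b hb) (F.coord j)) b = 1 := by
  have h1 : MvPolynomial.eval₂Hom (consts (ProjSpace K r ↘ Base K) (dPlus b))
        (fun j => frac (coordX_mem j) hb) b = 1 := by
    have h2 := congrArg (awayHom b) (eval₂Hom_away hb 1 b (by simpa using hb))
    rw [MvPolynomial.coe_eval₂Hom, MvPolynomial.hom_eval₂, ← consts_projSpace hb] at h2
    exact h2.trans (frac_self hb)
  rw [eval₂Hom_quo_coord, h1, map_one]

end Frame

/-- A tuple of sections determines the morphism to projective space. -/
theorem SecRep.hom_ext [X.Over (Base K)] {L : X.Modules} {ψ : X ⟶ ProjSpace K n} (F : Frame L ψ)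
    {φ φ' : X ⟶ ProjSpace K r} {s : Fin (r + 1) → GlobalSections L}
    (h₁ : φ ≫ (ProjSpace K r ↘ Base K) = X ↘ Base K)
    (h₂ : φ' ≫ (ProjSpace K r ↘ Base K) = X ↘ Base K)
    (H₁ : SecRep L φ s) (H₂ : SecRep L φ' s) : φ = φ' := by
  refine hom_ext_of_rep (h₁.trans h₂.symm) fun y => ?_
  obtain ⟨i, hi⟩ := exists_mem_preimage_dPlus (K := K) ψ y
  exact ⟨_, _, _, hi, H₁ _ _ (F.gen _ (coordX_mem i)), H₂ _ _ (F.gen _ (coordX_mem i)),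
    fun i j => mul_comm _ _⟩

/-- An isomorphism `ψ^* 𝒪(1) ≅ L` makes an embedding `ψ` into a frame. -/
theorem exists_frame [X.Over (Base K)] {L : X.Modules} (ψ : EmbL K L r) :
    Nonempty (Frame L ψ.1.hom) := by
  obtain ⟨e⟩ := ψ.2
  obtain ⟨sec, gen, h⟩ := exists_sections ψ.1.hom e
  exact ⟨⟨ψ.1.isOver, ψ.1.isClosedImmersion, sec, gen, h⟩⟩

end ProjectiveEmbedding

/-! ### Straight-line families of projections -/

namespace ProjectiveEmbedding

open AlgebraicGeometry.Scheme AlgebraicGeometry.Scheme.Modules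

variable {K : Type u} [Field K] {X Y Z W : Scheme.{u}} {r n : ℕ}

theorem evalHom_pull {A : CommRingCat.{u}} (y : Spec A ⟶ Y) (f : Y ⟶ X) {U : X.Opens}
    {V : Y.Opens} (e : V ≤ f ⁻¹ᵁ U) (h : ⊤ ≤ y ⁻¹ᵁ V) (a : Γ(X, U)) :
    evalHom y h (f.pull U V e a) = evalHom (y ≫ f) (le_preimage_comp f y e h) a := by
  simp only [evalHom, RingHom.comp_apply, pull_pull]

theorem notMem_basicOpen_iff_evalHom {y : GeomPoint K ⟶ Y} {V : Y.Opens} (h : ⊤ ≤ y ⁻¹ᵁ V)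
    (a : Γ(Y, V)) (p : GeomPoint K) : y p ∉ Y.basicOpen a ↔ evalHom y h a = 0 := by
  have h1 : (Spec (CommRingCat.of (AlgebraicClosure K))).basicOpen (y.pull V ⊤ h a) =
      ⊤ ⊓ y ⁻¹ᵁ Y.basicOpen a := basicOpen_pull y h a
  constructor
  · intro hp
    by_contra hne
    have hu : IsUnit (y.pull V ⊤ h a) := by
      rw [pull_eq_of_evalHom]
      exact (isUnit_iff_ne_zero.mpr hne).map _
    have h2 := Scheme.basicOpen_of_isUnit _ hu
    rw [h1] at h2
    have h3 : p ∈ (⊤ : (GeomPoint K).Opens) := trivial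
    rw [← h2] at h3
    exact hp h3.2
  · intro h0 hp
    have h2 : y.pull V ⊤ h a = 0 := by rw [pull_eq_of_evalHom, h0, map_zero]
    rw [h2, Scheme.basicOpen_zero] at h1
    have h3 : p ∈ (⊤ ⊓ y ⁻¹ᵁ Y.basicOpen a : (GeomPoint K).Opens) := ⟨trivial, hp⟩
    rw [← h1] at h3
    exact h3

section Cone

variable [X.Over (Base K)] {L : X.Modules} {h h' : GlobalSections L} {U U' : X.Opens}

/-- Two trivializations differ by a factor, which is the same for all sections. -/
theorem pull_quo_eq_mul (H : IsGenerator L h U) (H' : IsGenerator L h' U') (f : Z ⟶ X)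
    {W : Z.Opens} (hW : W ≤ f ⁻¹ᵁ U) (hW' : W ≤ f ⁻¹ᵁ U') (s : GlobalSections L) :
    f.pull U W hW (quo H s) = f.pull (U ⊓ U') W (le_preimage_inf f hW hW')
      (quo (H.mono inf_le_left : IsGenerator L h (U ⊓ U')) h') * f.pull U' W hW' (quo H' s) := by
  have e1 := res_quo H (H.mono inf_le_left : IsGenerator L h (U ⊓ U')) inf_le_left s
  have e2 := res_quo H' (H'.mono inf_le_right : IsGenerator L h' (U ⊓ U')) inf_le_right s
  have e3 := quo_mul_quo (H.mono inf_le_left : IsGenerator L h (U ⊓ U'))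
    (H'.mono inf_le_right : IsGenerator L h' (U ⊓ U')) s
  have e4 := congrArg (f.pull (U ⊓ U') W (le_preimage_inf f hW hW')) e3
  rw [map_mul, ← e1, ← e2, pull_res, pull_res] at e4
  rw [← e4, mul_comm]

/-- A single point of `X` over the algebraic closure gives functionals in the cone. -/
theorem exists_mem_secantCone_point (H : IsGenerator L h U) (z : GeomPoint K ⟶ X)
    (hz : z ≫ (X ↘ Base K) = geomPointToBase K) (hU : ⊤ ≤ z ⁻¹ᵁ U) :
    ∃ ℓ ∈ secantCone K L, ∀ s, ℓ s = evalHom z hU (quo H s) := by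
  -- the zero tangent vector at the point is a morphism from the dual numbers
  let A := CommRingCat.of (QuadraticAlgebra (AlgebraicClosure K) 0 0)
  have hU' : ⊤ ≤ (toGeomPoint K A ≫ z) ⁻¹ᵁ U := fun p _ =>
    hU (show toGeomPoint K A p ∈ ⊤ from trivial)
  obtain ⟨ℓ, h1, h2⟩ := exists_mem_secantCone H A (QuadraticAlgebra.finrank_eq_two ..)
    (toGeomPoint K A ≫ z) (by rw [Category.assoc, hz, ← Spec.map_comp]; rfl) hU'
    (QuadraticAlgebra.reₗ 0 0)
  refine ⟨ℓ, h1, fun s => (h2 s).trans ?_⟩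
  rw [evalHom_specMap_comp z _ hU]
  rfl

end Cone

section Isotopy

variable [X.Over (Base K)] {L : X.Modules} {h h' : GlobalSections L} {U U' : X.Opens}

variable (K X) in
/-- The projection `𝔸¹ × X → X`. -/
noncomputable abbrev projX : A1Prod K X ⟶ X := Limits.pullback.snd _ _

variable (K X) in
/-- The projection `𝔸¹ × X → 𝔸¹`. -/
noncomputable abbrev projA1 : A1Prod K X ⟶ A1 K := Limits.pullback.fst _ _

variable (K X) in
/-- The coordinate of `𝔸¹`, as a function on an open subset of `𝔸¹ × X`. -/
noncomputable def time (V : (A1Prod K X).Opens) : Γ(A1Prod K X, V) :=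
  (projA1 K X).pull ⊤ V (le_preimage_top _ V) (AffineSpace.coord (Base K) PUnit.unit)

@[simp] theorem res_time {V V' : (A1Prod K X).Opens} (i : V ≤ V') :
    Scheme.res i (time K X V') = time K X V := res_pull _ _ _ _

/-- The functions `(pᵢ + t qᵢ) / h` on the part of `𝔸¹ × X` that lies over `U`. -/
noncomputable def lineTuple (H : IsGenerator L h U) (p q : Fin (r + 1) → GlobalSections L)
    (i : Fin (r + 1)) : Γ(A1Prod K X, projX K X ⁻¹ᵁ U) :=
  (projX K X).pull U _ le_rfl (quo H (p i)) +
    time K X _ * (projX K X).pull U _ le_rfl (quo H (q i))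

theorem res_lineTuple (H : IsGenerator L h U) (p q : Fin (r + 1) → GlobalSections L)
    (i : Fin (r + 1)) {V : (A1Prod K X).Opens} (hV : V ≤ projX K X ⁻¹ᵁ U) :
    Scheme.res hV (lineTuple H p q i) = (projX K X).pull U V hV (quo H (p i)) +
      time K X V * (projX K X).pull U V hV (quo H (q i)) := by
  simp only [lineTuple, map_add, map_mul, res_time]
  rw [res_pull, res_pull]

theorem res_lineTuple_eq_mul (H : IsGenerator L h U) (H' : IsGenerator L h' U')
    (p q : Fin (r + 1) → GlobalSections L) (i : Fin (r + 1)) {V : (A1Prod K X).Opens}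
    (hV : V ≤ projX K X ⁻¹ᵁ U) (hV' : V ≤ projX K X ⁻¹ᵁ U') :
    Scheme.res hV (lineTuple H p q i) = (projX K X).pull (U ⊓ U') V (le_preimage_inf _ hV hV')
      (quo (H.mono inf_le_left : IsGenerator L h (U ⊓ U')) h') *
        Scheme.res hV' (lineTuple H' p q i) := by
  rw [res_lineTuple, res_lineTuple, pull_quo_eq_mul H H' _ hV hV', pull_quo_eq_mul H H' _ hV hV']
  ring

/-- The linear projections `p + t q` are defined on the secant variety: no nonzero functional in
the cone over it is killed by all `pᵢ + t qᵢ`. -/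
def AvoidsSecants (L : X.Modules) (p q : Fin (r + 1) → GlobalSections L) : Prop :=
  ∀ ℓ ∈ secantCone K L, ∀ t : AlgebraicClosure K, (∀ i, ℓ (p i) + t * ℓ (q i) = 0) → ℓ = 0

variable {ψ : X ⟶ ProjSpace K n}

theorem locallyOfFiniteType_a1Prod [LocallyOfFiniteType (X ↘ Base K)] :
    LocallyOfFiniteType (projX K X ≫ (X ↘ Base K)) := by
  have : LocallyOfFiniteType (projX K X) := inferInstance
  infer_instance

/-- The sections `pᵢ + t qᵢ` have no common zero on `𝔸¹ × X`: otherwise they would have one over the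
algebraic closure, and the value there would be a functional in the cone that they all kill. -/
theorem exists_mem_basicOpen_lineTuple (F : Frame L ψ) [LocallyOfFiniteType (X ↘ Base K)]
    {p q : Fin (r + 1) → GlobalSections L} (hpq : AvoidsSecants (K := K) L p q)
    (H : IsGenerator L h U) (y : A1Prod K X) (hy : y ∈ projX K X ⁻¹ᵁ U) :
    ∃ i, y ∈ (A1Prod K X).basicOpen (lineTuple H p q i) := by
  have := locallyOfFiniteType_a1Prod (K := K) (X := X)
  have key : ∀ y : A1Prod K X, ∃ k i, y ∈ (A1Prod K X).basicOpen
      (lineTuple (F.gen _ (coordX_mem k)) p q i) := by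
    by_contra! hn
    obtain ⟨y₀, hy₀⟩ := hn
    let O : (A1Prod K X).Opens := ⨆ ki : Fin (n + 1) × Fin (r + 1), (A1Prod K X).basicOpen
      (lineTuple (F.gen _ (coordX_mem ki.1)) p q ki.2)
    have hO : ∀ y, y ∈ O ↔ ∃ k i, y ∈ (A1Prod K X).basicOpen
        (lineTuple (F.gen _ (coordX_mem k)) p q i) := by
      intro y
      simp only [O, Opens.mem_iSup, Prod.exists]
    -- a point over the algebraic closure in the common zero locus
    obtain ⟨w, hw, hwO⟩ := exists_geomPoint (projX K X ≫ (X ↘ Base K))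
      (C := ((O : Set (A1Prod K X)))ᶜ) O.isOpen.isClosed_compl ⟨y₀, fun h0 => by
        obtain ⟨k, i, hki⟩ := (hO _).1 h0
        exact hy₀ k i hki⟩
    let pt : GeomPoint K := Classical.arbitrary _
    obtain ⟨k, hk⟩ := exists_mem_preimage_dPlus (K := K) ψ (projX K X (w pt))
    have hU : ⊤ ≤ (w ≫ projX K X) ⁻¹ᵁ (ψ ⁻¹ᵁ dPlus (coordX K k)) := fun p' _ => by
      obtain rfl : p' = pt := Subsingleton.elim _ _
      exact hk
    have hU' : ⊤ ≤ w ⁻¹ᵁ (projX K X ⁻¹ᵁ (ψ ⁻¹ᵁ dPlus (coordX K k))) := hU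
    obtain ⟨ℓ, hℓ, he⟩ := exists_mem_secantCone_point (F.gen _ (coordX_mem k)) (w ≫ projX K X)
      (by rw [Category.assoc, hw]) hU
    have h0 : ℓ = 0 := hpq ℓ hℓ (evalHom w hU' (time K X _)) fun i => by
      have h1 : w pt ∉ (A1Prod K X).basicOpen (lineTuple (F.gen _ (coordX_mem k)) p q i) :=
        fun h2 => hwO pt ((hO _).2 ⟨k, i, h2⟩)
      rw [notMem_basicOpen_iff_evalHom hU'] at h1
      rw [he, he, ← h1, lineTuple, map_add, map_mul, evalHom_pull, evalHom_pull]
    have h2 := he (F.sec _ (coordX_mem k))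
    rw [quo_self, map_one, h0] at h2
    exact zero_ne_one h2
  -- the trivialization `h` can be compared with those of the embedding
  obtain ⟨k, i, hki⟩ := key y
  refine ⟨i, ?_⟩
  let V := projX K X ⁻¹ᵁ U ⊓ projX K X ⁻¹ᵁ (ψ ⁻¹ᵁ dPlus (coordX K k))
  have hyV : y ∈ V := ⟨hy, (A1Prod K X).basicOpen_le _ hki⟩
  have h1 := res_lineTuple_eq_mul (F.gen _ (coordX_mem k)) H p q i (V := V) inf_le_right inf_le_left
  have h2 : y ∈ (A1Prod K X).basicOpen (Scheme.res (inf_le_right : V ≤ _)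
    (lineTuple (F.gen _ (coordX_mem k)) p q i)) := by
    rw [basicOpen_res']; exact ⟨hyV, hki⟩
  rw [h1, Scheme.basicOpen_mul, basicOpen_res'] at h2
  exact h2.2.2

/-- The family of projections `p + t q`, as a morphism `𝔸¹ × X → ℙ^r`. -/
theorem exists_family (F : Frame L ψ) [LocallyOfFiniteType (X ↘ Base K)]
    {p q : Fin (r + 1) → GlobalSections L} (hpq : AvoidsSecants (K := K) L p q) :
    ∃ I : A1Prod K X ⟶ ProjSpace K r,
      I ≫ (ProjSpace K r ↘ Base K) = projX K X ≫ (X ↘ Base K) ∧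
      ∀ (U : X.Opens) (h : GlobalSections L) (H : IsGenerator L h U),
        Rep I (projX K X ⁻¹ᵁ U) (lineTuple H p q) := by
  let α := Σ' (U : X.Opens) (h : GlobalSections L), IsGenerator L h U
  obtain ⟨I, h1, h2⟩ := exists_hom_of_tuples (projX K X ≫ (X ↘ Base K))
    (fun a : α => projX K X ⁻¹ᵁ a.1) (fun y => by
      obtain ⟨k, hk⟩ := exists_mem_preimage_dPlus (K := K) ψ (projX K X y)
      exact ⟨⟨_, _, F.gen _ (coordX_mem k)⟩, hk⟩)
    (fun a => lineTuple a.2.2 p q) (fun a y hy => exists_mem_basicOpen_lineTuple F hpq a.2.2 y hy)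
    (fun a b i j => by
      rw [res_lineTuple_eq_mul a.2.2 b.2.2 p q i inf_le_left inf_le_right,
        res_lineTuple_eq_mul a.2.2 b.2.2 p q j inf_le_left inf_le_right]
      ring)
  exact ⟨I, h1, fun U h H => h2 ⟨U, h, H⟩⟩

end Isotopy

end ProjectiveEmbedding

/-! ### Isotopies from straight lines -/

namespace ProjectiveEmbedding

open AlgebraicGeometry.Scheme AlgebraicGeometry.Scheme.Modules

variable {K : Type u} [Field K] {X Y Z W : Scheme.{u}} {r n : ℕ}

/-- In dimension two, every vector is killed by a nonzero functional. -/
theorem exists_functional {k A : Type*} [Field k] [CommRing A] [Algebra k A]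
    (hA : Module.finrank k A = 2) (u : A) : ∃ lam : A →ₗ[k] k, lam u = 0 ∧ lam ≠ 0 := by
  have : Module.Finite k A := Module.finite_of_finrank_pos (by omega)
  have h1 : Submodule.span k {u} < ⊤ := by
    rw [lt_top_iff_ne_top]
    intro h
    have h2 := finrank_span_le_card (R := k) ({u} : Set A)
    rw [h, finrank_top, Set.toFinset_singleton, Finset.card_singleton] at h2
    omega
  obtain ⟨lam, hne, hle⟩ := Submodule.exists_le_ker_of_lt_top _ h1
  exact ⟨lam, hle (Submodule.mem_span_singleton_self u), hne⟩

/-- In dimension two, the kernel of a nonzero functional that kills `1` consists of the constants.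
-/
theorem mem_range_algebraMap_of_functional {k A : Type*} [Field k] [CommRing A] [Algebra k A]
    (hA : Module.finrank k A = 2) {lam : A →ₗ[k] k} (h1 : lam 1 = 0) (h0 : lam ≠ 0) {a : A}
    (ha : lam a = 0) : a ∈ (algebraMap k A).range := by
  have : Module.Finite k A := Module.finite_of_finrank_pos (by omega)
  have : Nontrivial A := Module.nontrivial_of_finrank_pos (R := k) (by omega)
  have h2 : Module.finrank k (LinearMap.ker lam) = 1 := by
    have := LinearMap.finrank_range_add_finrank_ker lam
    have h3 : LinearMap.range lam = ⊤ := LinearMap.range_eq_top.mpr (LinearMap.surjective h0)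
    rw [h3, finrank_top, Module.finrank_self] at this
    omega
  obtain ⟨c, hc⟩ := (finrank_eq_one_iff_of_nonzero' (⟨1, h1⟩ : LinearMap.ker lam)
    (fun h => one_ne_zero (congrArg Subtype.val h))).mp h2 ⟨a, ha⟩
  exact ⟨c, by rw [Algebra.algebraMap_eq_smul_one]; exact congrArg Subtype.val hc⟩

/-- Morphisms from `Spec K̄` to an affine scheme are equal if they agree on the spectrum of a
nonzero `K̄`-algebra. -/
theorem eq_of_toGeomPoint_comp_eq {A S : CommRingCat.{u}} [Algebra (AlgebraicClosure K) A]
    [Nontrivial A] {a b : GeomPoint K ⟶ Spec S}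
    (h : toGeomPoint K A ≫ a = toGeomPoint K A ≫ b) : a = b := by
  obtain ⟨a, rfl⟩ := Spec.map_surjective a
  obtain ⟨b, rfl⟩ := Spec.map_surjective b
  rw [← Spec.map_comp, ← Spec.map_comp] at h
  congr 1
  refine CommRingCat.hom_ext (RingHom.ext fun c => ?_)
  apply (algebraMap (AlgebraicClosure K) A).injective
  exact congrArg (fun t => t.hom c) (Spec.map_injective h)

section Isotopy

variable [X.Over (Base K)] {L : X.Modules} {ψ : X ⟶ ProjSpace K n}

/-- The morphism `𝔸¹ × X → 𝔸¹ × ℙ^r` over `𝔸¹` given by `I : 𝔸¹ × X → ℙ^r`. -/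
noncomputable def graphOverA1 (I : A1Prod K X ⟶ ProjSpace K r)
    (hI : I ≫ (ProjSpace K r ↘ Base K) = projX K X ≫ (X ↘ Base K)) :
    A1Prod K X ⟶ Limits.pullback (A1 K ↘ Base K) (ProjSpace K r ↘ Base K) :=
  Limits.pullback.lift (projA1 K X) I (Limits.pullback.condition.trans hI.symm)

theorem graphOverA1_fst (I : A1Prod K X ⟶ ProjSpace K r)
    (hI : I ≫ (ProjSpace K r ↘ Base K) = projX K X ≫ (X ↘ Base K)) :
    graphOverA1 I hI ≫ Limits.pullback.fst _ _ = projA1 K X :=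
  Limits.pullback.lift_fst _ _ _

theorem graphOverA1_snd (I : A1Prod K X ⟶ ProjSpace K r)
    (hI : I ≫ (ProjSpace K r ↘ Base K) = projX K X ≫ (X ↘ Base K)) :
    graphOverA1 I hI ≫ Limits.pullback.snd _ _ = I :=
  Limits.pullback.lift_snd _ _ _

/-- The family `p + t q` separates subschemes of length two: if it is constant on a subscheme of
length two with coordinate ring `A`, then its values there are multiples of a unit `u ∈ A`, and a
functional on `A` that kills `u` gives an element of the cone over the secant variety that is killed
by all `pᵢ + t qᵢ`, hence is zero. The functional then kills `1`, and its kernel contains the values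
of all coordinates of `ψ`; these are therefore constant on the subscheme. -/
theorem separatesLengthTwo [Infinite K] (F : Frame L ψ) {p q : Fin (r + 1) → GlobalSections L}
    (hpq : AvoidsSecants (K := K) L p q) {I : A1Prod K X ⟶ ProjSpace K r}
    (hI : I ≫ (ProjSpace K r ↘ Base K) = projX K X ≫ (X ↘ Base K))
    (hrep : ∀ (U : X.Opens) (h : GlobalSections L) (H : IsGenerator L h U),
        Rep I (projX K X ⁻¹ᵁ U) (lineTuple H p q)) :
    SeparatesLengthTwo (projX K X ≫ (X ↘ Base K)) (graphOverA1 I hI) := by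
  intro A _ hA z hz ⟨w, hw⟩
  have hA1 : Nontrivial A := Module.nontrivial_of_finrank_pos (R := AlgebraicClosure K) (by omega)
  have hw1 : z ≫ projA1 K X = toGeomPoint K A ≫ w ≫ Limits.pullback.fst _ _ := by
    have := congrArg (· ≫ Limits.pullback.fst _ _) hw
    simp only [Category.assoc] at this
    rwa [graphOverA1_fst] at this
  have hw2 : z ≫ I = toGeomPoint K A ≫ w ≫ Limits.pullback.snd _ _ := by
    have := congrArg (· ≫ Limits.pullback.snd _ _) hw
    simp only [Category.assoc] at this
    rwa [graphOverA1_snd] at this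
  set w₁ := w ≫ Limits.pullback.fst (A1 K ↘ Base K) (ProjSpace K r ↘ Base K) with hw₁
  set w₂ := w ≫ Limits.pullback.snd (A1 K ↘ Base K) (ProjSpace K r ↘ Base K) with hw₂
  let z' := z ≫ projX K X
  have hz' : z' ≫ (X ↘ Base K) = Spec.map (CommRingCat.ofHom (baseMap K A)) := by
    rw [Category.assoc, hz]
  obtain ⟨b, hb, hbU⟩ := exists_linearForm_preimage ψ hA z'
  let H := F.gen b hb
  have hbV : ⊤ ≤ z ⁻¹ᵁ (projX K X ⁻¹ᵁ (ψ ⁻¹ᵁ dPlus b)) := hbU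
  -- the parameter `t` takes a constant value `τ` on the subscheme
  obtain ⟨τ, hτ⟩ : ∃ τ : AlgebraicClosure K,
      evalHom z hbV (time K X _) = algebraMap (AlgebraicClosure K) A τ := by
    refine ⟨evalHom w₁ (le_preimage_top w₁ ⊤) (AffineSpace.coord (Base K) PUnit.unit), ?_⟩
    rw [time, evalHom_pull, evalHom_congr hw1, evalHom_specMap_comp w₁ _ (le_preimage_top w₁ ⊤)]
    rfl
  let f : Fin (r + 1) → A := fun i => evalHom z hbV (lineTuple H p q i)
  have hf : ∀ i, f i = evalHom z' hbU (quo H (p i)) +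
      algebraMap (AlgebraicClosure K) A τ * evalHom z' hbU (quo H (q i)) := fun i => by
    simp only [f, lineTuple, map_add, map_mul, hτ]
    rw [evalHom_pull, evalHom_pull]
  let pt : GeomPoint K := Classical.arbitrary _
  obtain ⟨k, hk⟩ := exists_mem_preimage_dPlus (K := K) w₂ pt
  have hk' : ⊤ ≤ w₂ ⁻¹ᵁ dPlus (coordX K k) := fun p' _ => by
    obtain rfl : p' = pt := Subsingleton.elim _ _
    exact hk
  have hzk : ⊤ ≤ (z ≫ I) ⁻¹ᵁ dPlus (coordX K k) := by
    rw [hw2]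
    exact fun p' _ => hk' (show toGeomPoint K A p' ∈ ⊤ from trivial)
  have hR := ((hrep _ _ H).pullback z hbV) k ⊤ le_rfl hzk
  simp only [res_rfl] at hR
  let c : Fin (r + 1) → AlgebraicClosure K := fun j =>
    evalHom w₂ hk' (frac (coordX_mem j) (coordX_mem k))
  have hfc : ∀ j, f j = algebraMap (AlgebraicClosure K) A (c j) * f k := fun j => by
    have h1 := congrArg (Scheme.ΓSpecIso A).hom.hom (hR.2 j)
    rw [map_mul] at h1
    have h2 : (Scheme.ΓSpecIso A).hom.hom ((z ≫ I).pull _ ⊤ hzk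
        (frac (coordX_mem j) (coordX_mem k))) = algebraMap (AlgebraicClosure K) A (c j) := by
      change evalHom (z ≫ I) hzk _ = _
      rw [evalHom_congr hw2, evalHom_specMap_comp w₂ _ hk']
      rfl
    rw [h2] at h1
    exact h1
  -- all values are multiples of `f k`, and a functional that kills `f k` gives zero in the cone
  obtain ⟨lam, hlu, hl0⟩ := exists_functional hA (f k)
  obtain ⟨ℓ, hℓ, hℓs⟩ := exists_mem_secantCone H A hA z' hz' hbU lam
  have hℓ0 : ℓ = 0 := hpq ℓ hℓ τ fun i => by
    rw [hℓs, hℓs, ← smul_eq_mul, ← LinearMap.map_smul, ← map_add, Algebra.smul_def, ← hf, hfc,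
      ← Algebra.smul_def, LinearMap.map_smul, hlu, smul_zero]
  have hl1 : lam 1 = 0 := by
    have := hℓs (F.sec b hb)
    rwa [quo_self, map_one, hℓ0, eq_comm] at this
  have hrange : ∀ a, evalHom z' hbU a ∈ (algebraMap (AlgebraicClosure K) A).range := by
    intro a
    obtain ⟨g, rfl⟩ := F.surjective_eval₂Hom hb a
    rw [MvPolynomial.coe_eval₂Hom, MvPolynomial.hom_eval₂, MvPolynomial.eval₂_eq]
    refine sum_mem fun d _ => mul_mem ?_ (prod_mem fun i _ => pow_mem ?_ _)
    · rw [RingHom.comp_apply, evalHom_consts _ z' hbU _ hz']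
      exact ⟨_, rfl⟩
    · have := hℓs (F.coord i)
      rw [hℓ0, LinearMap.zero_apply, eq_comm] at this
      exact mem_range_algebraMap_of_functional hA hl1 hl0 this
  -- hence `z'` factors through a point over the algebraic closure
  obtain ⟨ρ, hρ⟩ : ∃ ρ : Γ(X, ψ ⁻¹ᵁ dPlus b) ⟶ CommRingCat.of (AlgebraicClosure K),
      ∀ a, algebraMap (AlgebraicClosure K) A (ρ.hom a) = evalHom z' hbU a := by
    let e := RingEquiv.ofBijective (algebraMap (AlgebraicClosure K) A).rangeRestrict
      ⟨fun a b h => (algebraMap (AlgebraicClosure K) A).injective (congrArg Subtype.val h),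
        (algebraMap (AlgebraicClosure K) A).rangeRestrict_surjective⟩
    refine ⟨CommRingCat.ofHom (R := Γ(X, ψ ⁻¹ᵁ dPlus b))
      (e.symm.toRingHom.comp ((evalHom z' hbU).codRestrict _ hrange)), fun a => ?_⟩
    exact congrArg Subtype.val (e.apply_symm_apply ⟨evalHom z' hbU a, hrange a⟩)
  have hU := F.isAffineOpen hb
  let y' : GeomPoint K ⟶ X := Spec.map ρ ≫ hU.fromSpec
  have hy' : z' = toGeomPoint K A ≫ y' := by
    have h1 : ⊤ ≤ y' ⁻¹ᵁ (ψ ⁻¹ᵁ dPlus b) := top_le_preimage_fromSpec hU ρ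
    have h2 : ⊤ ≤ (toGeomPoint K A ≫ y') ⁻¹ᵁ (ψ ⁻¹ᵁ dPlus b) :=
      fun p' _ => h1 (show toGeomPoint K A p' ∈ ⊤ from trivial)
    refine hom_ext_of_evalHom hU hbU h2 fun a => ?_
    rw [evalHom_specMap_comp y' _ h1, evalHom_specMap_fromSpec, ← hρ]
    rfl
  refine ⟨Limits.pullback.lift w₁ y' ?_, ?_⟩
  · apply eq_of_toGeomPoint_comp_eq (A := A)
    rw [← reassoc_of% hy', ← reassoc_of% hw1, Category.assoc]
    exact congrArg (z ≫ ·) Limits.pullback.condition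
  · apply Limits.pullback.hom_ext
    · rw [Category.assoc, Limits.pullback.lift_fst]
      exact hw1
    · rw [Category.assoc, Limits.pullback.lift_snd]
      exact hy'

/-- If `p + t q` never kills a nonzero element of the cone over the secant variety, the family of
projections `p + t q` is an algebraic isotopy of embeddings: the morphism `𝔸¹ × X → 𝔸¹ × ℙ^r` is a
monomorphism, and so are the morphisms `I_t`, which are proper and therefore closed immersions. -/
theorem exists_isotopy [Infinite K] [IsProper (X ↘ Base K)] (F : Frame L ψ)
    {p q : Fin (r + 1) → GlobalSections L} (hpq : AvoidsSecants (K := K) L p q) :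
    ∃ φ₀ φ₁ : Embedding K X r, IsElementaryIsotopic φ₀ φ₁ ∧ SecRep L φ₀.hom p ∧
      SecRep L φ₁.hom (p + q) := by
  obtain ⟨I, hI, hrep⟩ := exists_family F hpq
  have := locallyOfFiniteType_a1Prod (K := K) (X := X)
  have hgraph : graphOverA1 I hI ≫ (Limits.pullback.snd _ _ ≫ (ProjSpace K r ↘ Base K)) =
      projX K X ≫ (X ↘ Base K) := by
    rw [graphOverA1, Limits.pullback.lift_snd_assoc, hI]
  have hft : LocallyOfFiniteType (graphOverA1 I hI) := by
    have : LocallyOfFiniteType (graphOverA1 I hI ≫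
        (Limits.pullback.snd (A1 K ↘ Base K) (ProjSpace K r ↘ Base K) ≫
          (ProjSpace K r ↘ Base K))) := by
      rw [hgraph]; infer_instance
    exact locallyOfFiniteType_of_comp (graphOverA1 I hI)
      (Limits.pullback.snd _ _ ≫ (ProjSpace K r ↘ Base K))
  have hmono : Mono (graphOverA1 I hI) := (separatesLengthTwo F hpq hI hrep).mono hgraph
  have hext : ∀ {T : Scheme.{u}} (a b : T ⟶ A1Prod K X), a ≫ projA1 K X = b ≫ projA1 K X →
      a ≫ I = b ≫ I → a = b := by
    intro T a b h1 h2
    rw [← cancel_mono (graphOverA1 I hI)]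
    apply Limits.pullback.hom_ext
    · rwa [Category.assoc, Category.assoc, graphOverA1_fst]
    · rwa [Category.assoc, Category.assoc, graphOverA1_snd]
  have hslice1 : ∀ a : K, slice K X a ≫ projA1 K X = (X ↘ Base K) ≫ A1.point K a := fun a =>
    Limits.pullback.lift_fst _ _ _
  have hslice2 : ∀ a : K, slice K X a ≫ projX K X = 𝟙 X := fun a =>
    Limits.pullback.lift_snd _ _ _
  have hover : ∀ a : K, (slice K X a ≫ I) ≫ (ProjSpace K r ↘ Base K) = X ↘ Base K := fun a => by
    rw [Category.assoc, hI, reassoc_of% (hslice2 a)]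
  have hclosed : ∀ a : K, IsClosedImmersion (slice K X a ≫ I) := by
    intro a
    rw [IsClosedImmersion.iff_isProper_and_mono]
    constructor
    · have : IsProper ((slice K X a ≫ I) ≫ (ProjSpace K r ↘ Base K)) := by
        rw [hover]; infer_instance
      exact IsProper.of_comp _ (ProjSpace K r ↘ Base K)
    · constructor
      intro T s t hst
      have h1 : s ≫ (X ↘ Base K) = t ≫ (X ↘ Base K) := by
        have h0 := congrArg (· ≫ (ProjSpace K r ↘ Base K)) hst
        simp only [Category.assoc] at h0
        have h00 := hover a
        rw [Category.assoc] at h00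
        rwa [h00] at h0
      have h2 := hext (s ≫ slice K X a) (t ≫ slice K X a)
        (by rw [Category.assoc, Category.assoc, hslice1, reassoc_of% h1])
        (by rw [Category.assoc, Category.assoc, hst])
      have h3 := congrArg (· ≫ projX K X) h2
      simpa [hslice2] using h3
  have hsec : ∀ a : K, SecRep L (slice K X a ≫ I) fun i => p i + a • q i := by
    intro a U h H
    have h1 : U ≤ slice K X a ⁻¹ᵁ (projX K X ⁻¹ᵁ U) := by
      have : slice K X a ⁻¹ᵁ (projX K X ⁻¹ᵁ U) = (slice K X a ≫ projX K X) ⁻¹ᵁ U := rfl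
      rw [this, hslice2]
      exact le_rfl
    have h2 := (hrep U h H).pullback (slice K X a) h1
    convert h2 using 2 with i
    have e1 : ∀ s, (slice K X a).pull (projX K X ⁻¹ᵁ U) U h1
        ((projX K X).pull U _ le_rfl (quo H s)) = quo H s := fun s => by
      rw [pull_pull, pull_congr (hslice2 a)]
      have : (𝟙 X : X ⟶ X).pull U U le_rfl (quo H s) = quo H s := by
        have h3 : (𝟙 X : X ⟶ X).appLE U U le_rfl = 𝟙 _ := by
          simp only [Scheme.Hom.appLE, Scheme.Hom.id_app]
          exact X.presheaf.map_id _
        exact congrArg (fun t => t.hom (quo H s)) h3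
      exact this
    have e2 : (slice K X a).pull (projX K X ⁻¹ᵁ U) U h1 (time K X _) =
        consts (X ↘ Base K) U a := by
      rw [time, pull_pull, pull_congr (hslice1 a)]
      have h3 : (A1.point K a).pull ⊤ ⊤ (le_preimage_top (A1.point K a) ⊤)
          (AffineSpace.coord (Base K) PUnit.unit) =
          (Scheme.ΓSpecIso (CommRingCat.of K)).inv.hom a := by
        have := AffineSpace.homOfVector_appTop_coord (𝟙 (Base K))
          (fun _ : PUnit.{u + 1} => (Scheme.ΓSpecIso (CommRingCat.of K)).inv a) PUnit.unit
        have h4 : (A1.point K a).appLE ⊤ ⊤ (le_preimage_top (A1.point K a) ⊤) =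
            (A1.point K a).appTop := Scheme.Hom.appLE_eq_app _
        exact (congrArg (fun t => t.hom (AffineSpace.coord (Base K) PUnit.unit)) h4).trans this
      rw [← pull_pull (A1.point K a) (X ↘ Base K) (le_preimage_top (A1.point K a) ⊤)
        (le_preimage_top _ U), h3, consts_apply]
    rw [lineTuple, map_add, map_mul, e1, e1, e2, quo_add, quo_smul]
  refine ⟨⟨slice K X 0 ≫ I, hclosed 0, hover 0⟩, ⟨slice K X 1 ≫ I, hclosed 1, hover 1⟩,
    ⟨I, hI, fun t => ?_, rfl, rfl⟩, ?_, ?_⟩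
  · have hsnd : atPoint I hI t ≫ Limits.pullback.snd _ _ = Limits.pullback.snd _ _ :=
      Limits.pullback.lift_snd _ _ _
    let g : baseChange K X t ⟶ A1Prod K X :=
      Limits.pullback.lift (Limits.pullback.snd _ _ ≫ (A1 K).fromSpecResidueField t)
        (Limits.pullback.fst _ _)
        (by rw [Category.assoc]; exact Limits.pullback.condition.symm)
    have hg1 : g ≫ projA1 K X = Limits.pullback.snd _ _ ≫ (A1 K).fromSpecResidueField t :=
      Limits.pullback.lift_fst _ _ _
    have hg2 : g ≫ projX K X = Limits.pullback.fst _ _ := Limits.pullback.lift_snd _ _ _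
    have hfst : atPoint I hI t ≫ Limits.pullback.fst _ _ = g ≫ I := Limits.pullback.lift_fst _ _ _
    rw [IsClosedImmersion.iff_isProper_and_mono]
    constructor
    · have : IsProper (atPoint I hI t ≫ Limits.pullback.snd _ _) := by
        rw [hsnd]; infer_instance
      exact IsProper.of_comp _ (Limits.pullback.snd (ProjSpace K r ↘ Base K) (residueBase K t))
    · constructor
      intro T a b hab
      have h1 : a ≫ Limits.pullback.snd _ _ = b ≫ Limits.pullback.snd _ _ := by
        rw [← hsnd, reassoc_of% hab]
      have h2 := congrArg (· ≫ Limits.pullback.fst _ _) hab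
      simp only [Category.assoc, hfst] at h2
      have h3 := hext (a ≫ g) (b ≫ g)
        (by rw [Category.assoc, Category.assoc, hg1, reassoc_of% h1])
        (by rwa [Category.assoc, Category.assoc])
      have h4 := congrArg (· ≫ projX K X) h3
      simp only [Category.assoc, hg2] at h4
      exact Limits.pullback.hom_ext h4 h1
  · simpa using hsec 0
  · have := hsec 1
    simp only [one_smul] at this
    exact this

end Isotopy

end ProjectiveEmbedding

/-! ### A valuative criterion and quadratic algebras -/

namespace ProjectiveEmbedding

section Valuative

open Polynomial in
/-- An element is integral as soon as it is so modulo every prime ideal: otherwise the values of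
monic polynomials at it form a multiplicative set without zero. -/
theorem isIntegralElem_of_forall_prime {R₀ R : Type*} [CommRing R₀] [CommRing R] (f : R₀ →+* R)
    (y : R)
    (h : ∀ (Q : Ideal R) [Q.IsPrime],
      ((Ideal.Quotient.mk Q).comp f).IsIntegralElem (Ideal.Quotient.mk Q y)) :
    f.IsIntegralElem y := by
  let M : Submonoid R :=
    { carrier := {x | ∃ g : R₀[X], g.Monic ∧ g.eval₂ f y = x}
      one_mem' := ⟨1, monic_one, eval₂_one _ _⟩
      mul_mem' := by
        rintro _ _ ⟨g, hg, rfl⟩ ⟨g', hg', rfl⟩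
        exact ⟨g * g', hg.mul hg', eval₂_mul _ _⟩ }
  by_contra hy
  have h0 : Disjoint ((⊥ : Ideal R) : Set R) M := by
    rw [Set.disjoint_left]
    rintro x hx ⟨g, hg, hgx⟩
    exact hy ⟨g, hg, hgx.trans hx⟩
  obtain ⟨Q, hQ, -, hd⟩ := Ideal.exists_le_prime_disjoint ⊥ M h0
  obtain ⟨g, hg, hgy⟩ := h Q
  rw [← hom_eval₂, Ideal.Quotient.eq_zero_iff_mem] at hgy
  exact Set.disjoint_left.mp hd hgy ⟨g, hg, rfl⟩

/-- An integral closure in a field is the intersection of the valuation rings that contain the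
base ring. -/
theorem isIntegralElem_of_forall_valuationSubring {R₀ F : Type*} [CommRing R₀] [Field F]
    (f : R₀ →+* F) (y : F)
    (h : ∀ O : ValuationSubring F, (∀ a, f a ∈ O) → y ∈ O) : f.IsIntegralElem y := by
  have h1 : y ∈ (integralClosure (Subring.closure (Set.range f)) F).toSubring := by
    rw [← iInf_valuationSubring_superset, Subring.mem_iInf]
    exact fun O => h O.1 fun a => O.2 ⟨a, rfl⟩
  have h2 : IsIntegral (Subring.closure (Set.range f)) y := h1
  obtain ⟨g, hg, hgy⟩ := h2
  have hl : g ∈ Polynomial.lifts (f.codRestrict (Subring.closure (Set.range f))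
      fun a => Subring.subset_closure ⟨a, rfl⟩) := by
    rw [Polynomial.lifts_iff_coeff_lifts]
    intro n
    have h3 : (g.coeff n : F) ∈ f.range := by
      rw [← Subring.closure_eq f.range]
      exact (g.coeff n).2
    obtain ⟨a, ha⟩ := h3
    exact ⟨a, Subtype.ext ha⟩
  obtain ⟨g', hg', -, hm⟩ := Polynomial.lifts_and_natDegree_eq_and_monic hl hg
  refine ⟨g', hm, ?_⟩
  rw [← hg', Polynomial.eval₂_map] at hgy
  exact hgy

/-- The valuative criterion for integrality, over rings that need not be domains. -/
theorem isIntegralElem_of_forall_hom {R₀ R : Type u} [CommRing R₀] [CommRing R] (f : R₀ →+* R)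
    (y : R) (h : ∀ (F : Type u) [Field F] (φ : R →+* F) (O : ValuationSubring F),
      (∀ a, φ (f a) ∈ O) → φ y ∈ O) : f.IsIntegralElem y := by
  refine isIntegralElem_of_forall_prime f y fun Q _ => ?_
  let φ := algebraMap (R ⧸ Q) (FractionRing (R ⧸ Q))
  obtain ⟨g, hg, hgy⟩ := isIntegralElem_of_forall_valuationSubring
    (φ.comp ((Ideal.Quotient.mk Q).comp f)) (φ (Ideal.Quotient.mk Q y)) fun O hO =>
      h _ (φ.comp (Ideal.Quotient.mk Q)) O hO
  refine ⟨g, hg, IsFractionRing.injective (R ⧸ Q) (FractionRing (R ⧸ Q)) ?_⟩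
  rwa [map_zero, Polynomial.hom_eval₂]

/-- Given two nonzero tuples, one combination with integral coefficients has maximal valuation
at both. -/
theorem exists_combination_maximal {F ι : Type*} [Field F] (O : ValuationSubring F) [Fintype ι]
    {a b : ι → F} (ha : a ≠ 0) (hb : b ≠ 0) :
    ∃ c : ι → F, (∀ j, c j ∈ O) ∧ ∑ j, c j * a j ≠ 0 ∧ ∑ j, c j * b j ≠ 0 ∧
      (∀ j, a j / ∑ j, c j * a j ∈ O) ∧ ∀ j, b j / ∑ j, c j * b j ∈ O := by
  classical
  suffices h : ∃ c : ι → F, (∀ j, c j ∈ O) ∧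
      (∀ j, O.valuation (a j) ≤ O.valuation (∑ j, c j * a j)) ∧
      ∀ j, O.valuation (b j) ≤ O.valuation (∑ j, c j * b j) by
    obtain ⟨c, hc, h1, h2⟩ := h
    have key : ∀ {a : ι → F}, a ≠ 0 → (∀ j, O.valuation (a j) ≤ O.valuation (∑ j, c j * a j)) →
        ∑ j, c j * a j ≠ 0 ∧ ∀ j, a j / ∑ j, c j * a j ∈ O := by
      intro a ha h
      have h0 : ∑ j, c j * a j ≠ 0 := by
        intro h0
        refine ha (funext fun j => ?_)
        have := h j
        rwa [h0, map_zero, le_zero_iff, Valuation.zero_iff] at this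
      refine ⟨h0, fun j => ?_⟩
      rw [← O.valuation_le_one_iff, map_div₀]
      exact div_le_one_of_le₀ (h j) zero_le
    exact ⟨c, hc, (key ha h1).1, (key hb h2).1, (key ha h1).2, (key hb h2).2⟩
  have : Nonempty ι := by
    obtain ⟨j, -⟩ := Function.ne_iff.mp ha
    exact ⟨j⟩
  obtain ⟨i, hi⟩ := Finite.exists_max fun j => O.valuation (a j)
  obtain ⟨k, hk⟩ := Finite.exists_max fun j => O.valuation (b j)
  have hmem : ∀ i j : ι, (Pi.single i 1 : ι → F) j ∈ O := by
    intro i j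
    obtain rfl | h := eq_or_ne j i
    · rw [Pi.single_eq_same]; exact one_mem O
    · rw [Pi.single_eq_of_ne h]; exact zero_mem O
  have hsum : ∀ (i : ι) (a : ι → F), ∑ j, (Pi.single i 1 : ι → F) j * a j = a i := by
    intro i a
    simp [Pi.single_apply]
  by_cases h1 : O.valuation (b k) ≤ O.valuation (b i)
  · exact ⟨Pi.single i 1, hmem i, fun j => by rw [hsum]; exact hi j,
      fun j => by rw [hsum]; exact (hk j).trans h1⟩
  by_cases h2 : O.valuation (a i) ≤ O.valuation (a k)
  · exact ⟨Pi.single k 1, hmem k, fun j => by rw [hsum]; exact (hi j).trans h2,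
      fun j => by rw [hsum]; exact hk j⟩
  -- the two maxima are attained at different places, at each of which the other value is smaller
  refine ⟨Pi.single i 1 + Pi.single k 1, fun j => add_mem (hmem i j) (hmem k j), fun j => ?_,
    fun j => ?_⟩
  · simp only [Pi.add_apply, add_mul, Finset.sum_add_distrib, hsum]
    rw [Valuation.map_add_eq_of_lt_left _ (not_le.mp h2)]
    exact hi j
  · simp only [Pi.add_apply, add_mul, Finset.sum_add_distrib, hsum]
    rw [Valuation.map_add_eq_of_lt_right _ (not_le.mp h1)]
    exact hk j

end Valuative

section Quadratic

open QuadraticAlgebra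

variable {R S : Type*} [CommRing R] [CommRing S]

/-- Functoriality of `R[e] / (e² - w e)` in `R`. -/
def quadraticMap (φ : R →+* S) (w : R) :
    QuadraticAlgebra R 0 w →+* QuadraticAlgebra S 0 (φ w) where
  toFun x := ⟨φ x.re, φ x.im⟩
  map_one' := by ext <;> simp
  map_mul' x y := by ext <;> simp
  map_zero' := by ext <;> simp
  map_add' x y := by ext <;> simp

@[simp]
theorem quadraticMap_re (φ : R →+* S) (w : R) (x : QuadraticAlgebra R 0 w) :
    (quadraticMap φ w x).re = φ x.re := rfl

@[simp]
theorem quadraticMap_im (φ : R →+* S) (w : R) (x : QuadraticAlgebra R 0 w) :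
    (quadraticMap φ w x).im = φ x.im := rfl

theorem quadraticMap_algebraMap (φ : R →+* S) (w : R) (c : R) :
    quadraticMap φ w (algebraMap R _ c) = algebraMap S _ (φ c) := by
  ext <;> simp [algebraMap_eq]

/-- The point `e ↦ 0` of `R[e] / (e² - w e)`. -/
def pointZero (w : R) : QuadraticAlgebra R 0 w →+* R where
  toFun x := x.re
  map_one' := by simp
  map_mul' x y := by simp
  map_zero' := by simp
  map_add' x y := by simp

/-- The point `e ↦ w` of `R[e] / (e² - w e)`. -/
def pointOmega (w : R) : QuadraticAlgebra R 0 w →+* R where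
  toFun x := x.re + w * x.im
  map_one' := by simp
  map_mul' x y := by simp; ring
  map_zero' := by simp
  map_add' x y := by simp; ring

theorem pointZero_apply (w : R) (x : QuadraticAlgebra R 0 w) : pointZero w x = x.re := rfl

theorem pointOmega_apply (w : R) (x : QuadraticAlgebra R 0 w) :
    pointOmega w x = x.re + w * x.im := rfl

variable {F : Type*} [Field F]

/-- The elements of `F[e] / (e² - w e)` with integral values at both points, and with coefficient
at `e` in the fractional ideal of all `f` with `μ f` integral. -/
def integralSubring (O : ValuationSubring F) (w μ : F) : Subring (QuadraticAlgebra F 0 w) where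
  carrier := {u | pointZero w u ∈ O ∧ pointOmega w u ∈ O ∧ μ * u.im ∈ O}
  one_mem' := by
    refine ⟨?_, ?_, ?_⟩
    · rw [map_one]; exact one_mem O
    · rw [map_one]; exact one_mem O
    · rw [QuadraticAlgebra.im_one, mul_zero]; exact zero_mem O
  zero_mem' := by
    refine ⟨?_, ?_, ?_⟩
    · rw [map_zero]; exact zero_mem O
    · rw [map_zero]; exact zero_mem O
    · rw [QuadraticAlgebra.im_zero, mul_zero]; exact zero_mem O
  mul_mem' := by
    rintro u v ⟨h1, h2, h3⟩ ⟨h1', h2', h3'⟩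
    refine ⟨?_, ?_, ?_⟩
    · rw [map_mul]; exact mul_mem h1 h1'
    · rw [map_mul]; exact mul_mem h2 h2'
    · have : μ * (u * v).im = pointZero w u * (μ * v.im) + (μ * u.im) * pointOmega w v := by
        rw [QuadraticAlgebra.im_mul, pointZero_apply, pointOmega_apply]
        ring
      rw [this]
      exact add_mem (mul_mem h1 h3') (mul_mem h3 h2')
  add_mem' := by
    rintro u v ⟨h1, h2, h3⟩ ⟨h1', h2', h3'⟩
    refine ⟨?_, ?_, ?_⟩
    · rw [map_add]; exact add_mem h1 h1'
    · rw [map_add]; exact add_mem h2 h2'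
    · rw [QuadraticAlgebra.im_add, mul_add]; exact add_mem h3 h3'
  neg_mem' := by
    rintro u ⟨h1, h2, h3⟩
    refine ⟨?_, ?_, ?_⟩
    · rw [map_neg]; exact neg_mem h1
    · rw [map_neg]; exact neg_mem h2
    · rw [QuadraticAlgebra.im_neg, mul_neg]; exact neg_mem h3

theorem algebraMap_mem_integralSubring {O : ValuationSubring F} {w μ c : F} (hc : c ∈ O) :
    algebraMap F _ c ∈ integralSubring O w μ := by
  refine ⟨?_, ?_, ?_⟩
  · simpa [pointZero_apply, algebraMap_eq] using hc
  · simpa [pointOmega_apply, algebraMap_eq] using hc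
  · simp [algebraMap_eq]

/-- Membership in a subring can be tested after multiplication by powers of elements that
generate the unit ideal. -/
theorem mem_subring_of_mul_pow_mem {A ι : Type*} [CommRing A] [Fintype ι] (N : Subring A)
    {u c : ι → A} (hu : ∀ j, u j ∈ N) (hc : ∀ j, c j ∈ N) (h1 : ∑ j, c j * u j = 1) {s : A}
    (n : ι → ℕ) (hs : ∀ j, s * u j ^ n j ∈ N) : s ∈ N := by
  let J : Ideal N :=
    { carrier := {y | s * y ∈ N}
      zero_mem' := by simp
      add_mem' := by
        intro a b ha hb
        simp only [Set.mem_ofPred_eq, Subring.coe_add, mul_add] at ha hb ⊢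
        exact add_mem ha hb
      smul_mem' := by
        intro a b hb
        simp only [Set.mem_ofPred_eq, smul_eq_mul, Subring.coe_mul] at hb ⊢
        rw [mul_left_comm]
        exact mul_mem a.2 hb }
  let u' : ι → N := fun j => ⟨u j, hu j⟩
  have hspan : Ideal.span (Set.range u') = ⊤ := by
    rw [Ideal.eq_top_iff_one]
    have : (1 : N) = ∑ j, (⟨c j, hc j⟩ : N) * u' j := by
      apply Subtype.ext
      push_cast
      exact h1.symm
    rw [this]
    exact sum_mem fun j _ => Ideal.mul_mem_left _ _ (Ideal.subset_span ⟨j, rfl⟩)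
  have h2 := Ideal.span_pow_eq_top _ hspan (∑ j, n j)
  have h3 : (1 : N) ∈ J := by
    have h4 : (⊤ : Ideal N) ≤ J := by
      rw [← h2, Ideal.span_le]
      rintro _ ⟨_, ⟨j, rfl⟩, rfl⟩
      change s * (u j) ^ (∑ j, n j) ∈ N
      rw [← Nat.sub_add_cancel (Finset.single_le_sum (fun j _ => Nat.zero_le (n j))
        (Finset.mem_univ j)), pow_add, mul_left_comm]
      exact mul_mem (pow_mem (hu j) _) (hs j)
    exact h4 trivial
  simpa [J] using h3

/-- The heart of the integrality of projections of the secant variety.  Let `x₀, …, x_r, s` be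
elements of `A = F[e] / (e² - w e)` with homogeneous relations `s xₖ ^ N = Gₖ(x)`, the `xⱼ`
generating the unit ideal.  If a functional takes integral values at all `xⱼ`, then also at `s`.
The functional may have poles that cancel in its values; division by a combination `h` of the
`xⱼ` of maximal valuation at both points of `A` gives elements of the subring
`integralSubring`, on which the functional `u ↦ lam (h u)` is integral. -/
theorem functional_mem_of_relations (O : ValuationSubring F) {k ι : Type*} [CommRing k]
    (i : k →+* F) (hi : ∀ c, i c ∈ O) [Fintype ι] {w : F} (x : ι → QuadraticAlgebra F 0 w)
    (s : QuadraticAlgebra F 0 w) (b : ι → F) (hb : ∑ j, algebraMap F _ (b j) * x j = 1)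
    (n : ι → ℕ) (G : ι → MvPolynomial ι k) (hG : ∀ j, (G j).IsHomogeneous (n j + 1))
    (hs : ∀ j, s * x j ^ n j = (G j).eval₂ ((algebraMap F _).comp i) x)
    (α β : F) (hx : ∀ j, α * (x j).re + β * (x j).im ∈ O) : α * s.re + β * s.im ∈ O := by
  have hp : (fun j => pointZero w (x j)) ≠ 0 := by
    intro h
    have h1 := congrArg (pointZero w) hb
    rw [map_sum, map_one] at h1
    refine one_ne_zero (h1.symm.trans (Finset.sum_eq_zero fun j _ => ?_))
    rw [map_mul, congrFun h j]
    exact mul_zero _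
  have hq : (fun j => pointOmega w (x j)) ≠ 0 := by
    intro h
    have h1 := congrArg (pointOmega w) hb
    rw [map_sum, map_one] at h1
    refine one_ne_zero (h1.symm.trans (Finset.sum_eq_zero fun j _ => ?_))
    rw [map_mul, congrFun h j]
    exact mul_zero _
  obtain ⟨c, hc, hp0, hq0, hpm, hqm⟩ := exists_combination_maximal O hp hq
  set h := ∑ j, algebraMap F (QuadraticAlgebra F 0 w) (c j) * x j with hh
  have hp' : pointZero w h = ∑ j, c j * pointZero w (x j) := by
    simp [hh, map_sum, pointZero_apply, algebraMap_eq]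
  have hq' : pointOmega w h = ∑ j, c j * pointOmega w (x j) := by
    rw [hh, map_sum]
    refine Finset.sum_congr rfl fun j _ => ?_
    simp [pointOmega_apply, algebraMap_eq]
    ring
  rw [← hp'] at hp0 hpm
  rw [← hq'] at hq0 hqm
  have hunit : IsUnit h := by
    rw [isUnit_iff_norm_isUnit]
    have : norm h = pointZero w h * pointOmega w h := by
      rw [norm_def, pointZero_apply, pointOmega_apply]
      ring
    rw [this]
    exact (mul_ne_zero hp0 hq0).isUnit
  -- from here on, `g` is the inverse of `h`
  obtain ⟨g, hg⟩ := hunit.exists_right_inv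
  -- the functional `u ↦ lam (h u)`, in terms of the point `e ↦ 0` and the coefficient at `e`
  have hlam : ∀ u : QuadraticAlgebra F 0 w, α * (h * u).re + β * (h * u).im =
      (α * h.re + β * h.im) * pointZero w u + (β * pointOmega w h) * u.im := by
    intro u
    rw [QuadraticAlgebra.re_mul, QuadraticAlgebra.im_mul, pointZero_apply, pointOmega_apply]
    ring
  have hlh : α * h.re + β * h.im ∈ O := by
    have : α * h.re + β * h.im = ∑ j, c j * (α * (x j).re + β * (x j).im) := by
      have e1 : h.re = ∑ j, c j * (x j).re := hp'
      have e2 : h.im = ∑ j, c j * (x j).im := by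
        have : h.im = imₗ 0 w h := rfl
        rw [this, hh, map_sum]
        refine Finset.sum_congr rfl fun j _ => ?_
        change (algebraMap F (QuadraticAlgebra F 0 w) (c j) * x j).im = _
        simp [algebraMap_eq]
      rw [e1, e2, Finset.mul_sum, Finset.mul_sum, ← Finset.sum_add_distrib]
      exact Finset.sum_congr rfl fun j _ => by ring
    rw [this]
    exact sum_mem fun j _ => mul_mem (hc j) (hx j)
  let N := integralSubring O w (β * pointOmega w h)
  have hgp : ∀ y, pointZero w (g * y) = pointZero w y / pointZero w h := fun y => by
    have := congrArg (pointZero w) hg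
    rw [map_mul, map_one] at this
    rw [map_mul, eq_div_iff hp0]
    linear_combination pointZero w y * this
  have hgq : ∀ y, pointOmega w (g * y) = pointOmega w y / pointOmega w h := fun y => by
    have := congrArg (pointOmega w) hg
    rw [map_mul, map_one] at this
    rw [map_mul, eq_div_iff hq0]
    linear_combination pointOmega w y * this
  have hu : ∀ j, g * x j ∈ N := by
    intro j
    have h1 : pointZero w (g * x j) ∈ O := by rw [hgp]; exact hpm j
    refine ⟨h1, by rw [hgq]; exact hqm j, ?_⟩
    have h2 := hlam (g * x j)
    rw [← mul_assoc, hg, one_mul] at h2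
    rw [← sub_eq_iff_eq_add'.mpr h2]
    exact sub_mem (hx j) (mul_mem hlh h1)
  -- the relations, divided by powers of `h`, show that `s / h` is in the subring
  have hσ : g * s ∈ N := by
    refine mem_subring_of_mul_pow_mem N (u := fun j => g * x j)
      (c := fun j => algebraMap F _ (c j)) hu (fun j => algebraMap_mem_integralSubring (hc j))
      ?_ n fun j => ?_
    · rw [← hg, hh, Finset.sum_mul]
      exact Finset.sum_congr rfl fun j _ => by ring
    · have h1 : g * s * (g * x j) ^ n j =
          (G j).eval₂ ((algebraMap F _).comp i) (fun j => g * x j) := by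
        rw [eval₂_mul_of_isHomogeneous (hG j), ← hs]
        ring
      rw [h1, MvPolynomial.eval₂_eq]
      exact sum_mem fun d _ => mul_mem (algebraMap_mem_integralSubring (hi _))
        (prod_mem fun j _ => pow_mem (hu j) _)
  have := hlam (g * s)
  rw [← mul_assoc, hg, one_mul] at this
  rw [this]
  exact add_mem (mul_mem hlh hσ.1) hσ.2.2

end Quadratic

end ProjectiveEmbedding

/-! ### The cone over the secant variety in terms of quadratic algebras -/

namespace ProjectiveEmbedding

open AlgebraicGeometry.Scheme AlgebraicGeometry.Scheme.Modules

/-- Over an algebraically closed field, algebras of dimension two are of the form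
`k[e] / (e² - w e)`. -/
theorem exists_quadraticAlgebra_equiv {k A : Type*} [Field k] [IsAlgClosed k] [CommRing A]
    [Algebra k A] (hA : Module.finrank k A = 2) :
    ∃ w : k, Nonempty (QuadraticAlgebra k 0 w ≃ₐ[k] A) := by
  have : Module.Finite k A := Module.finite_of_finrank_pos (by omega)
  have : Nontrivial A := Module.nontrivial_of_finrank_pos (R := k) (by omega)
  obtain ⟨a, -, ha⟩ : ∃ a ∈ (⊤ : Submodule k A), a ∉ Submodule.span k {(1 : A)} := by
    by_contra! h
    have htop : Submodule.span k {(1 : A)} = ⊤ := top_le_iff.mp fun a ha => h a ha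
    have h1 := finrank_span_le_card (R := k) ({1} : Set A)
    rw [htop, finrank_top, Set.toFinset_singleton, Finset.card_singleton] at h1
    omega
  -- multiplication by `a` has an eigenvalue, so that `e₀ = a - ρ` is a zero divisor; its quadratic
  -- equation has no constant term
  obtain ⟨ρ, hρ⟩ := Module.End.exists_eigenvalue (LinearMap.mulLeft k a)
  obtain ⟨e, he⟩ := hρ.exists_hasEigenvector
  have he1 : (a - algebraMap k A ρ) * e = 0 := by
    have := he.apply_eq_smul
    rw [LinearMap.mulLeft_apply, Algebra.smul_def] at this
    rw [sub_mul, this, sub_self]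
  set e₀ := a - algebraMap k A ρ with he₀
  have hli : LinearIndependent k ![1, e₀] := by
    rw [LinearIndependent.pair_iff]
    intro s t hst
    have ht : t = 0 := by
      by_contra ht
      refine ha (Submodule.mem_span_singleton.mpr ⟨ρ - t⁻¹ * s, ?_⟩)
      have h1 : t⁻¹ • (s • (1 : A) + t • e₀) = 0 := by rw [hst, smul_zero]
      rw [smul_add, smul_smul, smul_smul, inv_mul_cancel₀ ht, one_smul, he₀,
        Algebra.algebraMap_eq_smul_one] at h1
      rw [sub_smul]
      linear_combination -h1
    refine ⟨?_, ht⟩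
    rw [ht, zero_smul, add_zero] at hst
    exact (smul_eq_zero.mp hst).resolve_right one_ne_zero
  have hspan := hli.span_eq_top_of_card_eq_finrank' (by simp [hA])
  have hpair : ∀ u : A, ∃ x y : k, x • 1 + y • e₀ = u := fun u => by
    have : u ∈ Submodule.span k (Set.range ![1, e₀]) := hspan ▸ Submodule.mem_top
    rwa [Matrix.range_cons, Matrix.range_cons, Matrix.range_empty, Set.union_empty,
      Set.singleton_union, Submodule.mem_span_pair] at this
  obtain ⟨x, y, hxy⟩ := hpair e
  have hy : y ≠ 0 := by
    intro hy
    rw [hy, zero_smul, add_zero] at hxy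
    rw [← hxy, mul_smul_comm, mul_one] at he1
    have hx : x ≠ 0 := fun hx => he.2 (by rw [← hxy, hx, zero_smul])
    exact hli.ne_zero 1 ((smul_eq_zero.mp he1).resolve_left hx)
  have hsq : e₀ * e₀ = (0 : k) • (1 : A) + (-(y⁻¹ * x)) • e₀ := by
    rw [← hxy, mul_add, mul_smul_comm, mul_smul_comm, mul_one] at he1
    have := congrArg (y⁻¹ • ·) he1
    simp only [smul_add, smul_smul, inv_mul_cancel₀ hy, one_smul, smul_zero] at this
    rw [neg_smul, zero_smul, zero_add]
    exact eq_neg_of_add_eq_zero_right this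
  let f := QuadraticAlgebra.lift ⟨e₀, hsq⟩
  have hf : ∀ u, f u = u.re • (1 : A) + u.im • e₀ := fun u => by
    simp [f, QuadraticAlgebra.lift]
  refine ⟨_, ⟨AlgEquiv.ofBijective f ⟨?_, fun u => ?_⟩⟩⟩
  · rw [injective_iff_map_eq_zero]
    intro u hu
    rw [hf] at hu
    obtain ⟨h1, h2⟩ := LinearIndependent.pair_iff.mp hli _ _ hu
    exact QuadraticAlgebra.ext h1 h2
  · obtain ⟨x, y, h⟩ := hpair u
    exact ⟨⟨x, y⟩, by rw [hf, h]⟩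

/-- Homogenization with respect to the variable `k`, in a degree so large that the result is
divisible by that variable. -/
theorem exists_homogenization {R ι : Type*} [CommRing R] (k : ι) (g : MvPolynomial ι R) :
    ∃ (N : ℕ) (G : MvPolynomial ι R), 0 < N ∧ G.IsHomogeneous (N + 1) ∧ MvPolynomial.X k ∣ G ∧
      ∀ {A : Type u} [CommRing A] (f : R →+* A) (x : ι → A), x k = 1 →
        G.eval₂ f x = g.eval₂ f x := by
  classical
  let G₀ : MvPolynomial ι R := ∑ d ∈ g.support,
    MvPolynomial.monomial (d + Finsupp.single k (g.totalDegree - d.degree)) (g.coeff d)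
  refine ⟨g.totalDegree + 1, MvPolynomial.X k ^ 2 * G₀, by omega, ?_,
    ⟨MvPolynomial.X k * G₀, by ring⟩, ?_⟩
  · have h1 : G₀.IsHomogeneous g.totalDegree := by
      refine MvPolynomial.IsHomogeneous.sum _ _ _ fun d hd => ?_
      apply MvPolynomial.isHomogeneous_monomial
      rw [map_add, Finsupp.degree_single]
      have : d.degree ≤ g.totalDegree := MvPolynomial.le_totalDegree hd
      omega
    have h2 := ((MvPolynomial.isHomogeneous_X R k).pow 2).mul h1
    convert h2 using 1
    omega
  · intro A _ f x hx
    rw [MvPolynomial.eval₂_mul, MvPolynomial.eval₂_pow, MvPolynomial.eval₂_X, hx, one_pow, one_mul,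
      MvPolynomial.eval₂_sum, MvPolynomial.eval₂_eq]
    refine Finset.sum_congr rfl fun d hd => ?_
    rw [MvPolynomial.eval₂_monomial, Finsupp.prod_add_index' (by simp) (by simp [pow_add]),
      Finsupp.prod_single_index (by simp), hx, one_pow, mul_one]
    rfl

variable {K : Type u} [Field K] {X : Scheme.{u}} [X.Over (Base K)] {L : X.Modules} {r : ℕ}
  {ψ : X ⟶ ProjSpace K r}

/-- On each chart, a section `s` of `L` and the coordinates of the embedding satisfy a homogeneous
relation `s xₖ ^ N = G(x)`, because `s / xₖ` is a polynomial in the functions `xⱼ / xₖ`. -/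
theorem Frame.exists_relation [IsIntegral X] (F : Frame L ψ) (s : GlobalSections L)
    (k : Fin (r + 1)) :
    ∃ (N : ℕ) (G : MvPolynomial (Fin (r + 1)) K), G.IsHomogeneous (N + 1) ∧
      ∀ b hb, quo (F.gen b hb) s * quo (F.gen b hb) (F.coord k) ^ N =
        G.eval₂ (consts (X ↘ Base K) _) fun j => quo (F.gen b hb) (F.coord j) := by
  obtain ⟨g, hg⟩ := F.surjective_eval₂Hom (coordX_mem k) (quo (F.gen _ (coordX_mem k)) s)
  obtain ⟨N, G, hN, hG, hdvd, hGg⟩ := exists_homogenization.{u} k g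
  refine ⟨N, G, hG, fun b hb => ?_⟩
  set U := ψ ⁻¹ᵁ dPlus b
  let V := ψ ⁻¹ᵁ dPlus (coordX K k)
  let W := U ⊓ V
  -- as `X` is integral, the relation can be checked on `W`; if `W` is empty, `xₖ` vanishes on `U`,
  -- and both sides are zero because `N > 0` and `G` is divisible by the variable `k`
  by_cases hW : Nonempty W
  · have i : W ≤ U := inf_le_left
    have i' : W ≤ V := inf_le_right
    have hinj : Function.Injective (Scheme.res (X := X) i) :=
      map_injective_of_isIntegral X (homOfLE i)
    apply hinj
    have H₁ : IsGenerator L (F.sec b hb) W := (F.gen b hb).mono i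
    have H₂ : IsGenerator L (F.coord k) W := (F.gen _ (coordX_mem k)).mono i'
    have hq : ∀ t, Scheme.res i (quo (F.gen b hb) t) = quo H₁ (F.coord k) * quo H₂ t := fun t => by
      rw [res_quo _ H₁, mul_comm, quo_mul_quo]
    have hs : quo H₂ s = G.eval₂ (consts (X ↘ Base K) W) fun j => quo H₂ (F.coord j) := by
      have hs' : Scheme.res i' (quo (F.gen _ (coordX_mem k)) s) = quo H₂ s :=
        res_quo (F.gen _ (coordX_mem k)) H₂ i' s
      rw [hGg _ _ (quo_self H₂), ← hs', ← hg, MvPolynomial.coe_eval₂Hom, MvPolynomial.hom_eval₂]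
      congr 1
      · refine RingHom.ext fun c => ?_
        exact res_consts _ i' c
      · funext j
        exact res_quo (F.gen _ (coordX_mem k)) H₂ i' _
    rw [map_mul, map_pow, hq, hq, quo_self, mul_one, MvPolynomial.hom_eval₂]
    have hc : (Scheme.res i).comp (consts (X ↘ Base K) U) = consts (X ↘ Base K) W := by
      refine RingHom.ext fun c => ?_
      simp
    rw [hc]
    have hx : (fun j => Scheme.res i (quo (F.gen b hb) (F.coord j))) =
        fun j => quo H₁ (F.coord k) * quo H₂ (F.coord j) := funext fun j => hq _
    rw [hx, eval₂_mul_of_isHomogeneous hG, ← hs]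
    ring
  · have h0 : quo (F.gen b hb) (F.coord k) = 0 := by
      rw [F.quo_coord, ← basicOpen_eq_bot_iff, basicOpen_pull, basicOpen_frac, eq_bot_iff]
      intro p hp
      exact hW ⟨p, hp.1, hp.2.2⟩
    obtain ⟨G', rfl⟩ := hdvd
    rw [h0, zero_pow hN.ne', mul_zero, MvPolynomial.eval₂_mul, MvPolynomial.eval₂_X, h0, zero_mul]

/-- An element of the cone over the secant variety is a functional on `K̄[e] / (e² - w e)`, applied
to the values of sections on a subscheme of length two with that coordinate ring. -/
theorem Frame.exists_quadratic [Infinite K] (F : Frame L ψ)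
    {ℓ : GlobalSections L →ₗ[K] AlgebraicClosure K} (hℓ : ℓ ∈ secantCone K L) :
    ∃ (w α β : AlgebraicClosure K) (b : MvPolynomial (Fin (r + 1)) K) (hb : b ∈ grading K r 1)
      (φ : Γ(X, ψ ⁻¹ᵁ dPlus b) →+* QuadraticAlgebra (AlgebraicClosure K) 0 w),
      (∀ c, φ (consts (X ↘ Base K) _ c) = algebraMap _ _ (algebraMap K (AlgebraicClosure K) c)) ∧
      ∀ s, ℓ s = α * (φ (quo (F.gen b hb) s)).re + β * (φ (quo (F.gen b hb) s)).im := by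
  obtain ⟨A, _, z, hA, hz, h⟩ := exists_of_mem_secantCone hℓ
  obtain ⟨b, hb, hzb⟩ := exists_linearForm_preimage ψ hA z
  obtain ⟨lam, hlam⟩ := h _ _ (F.gen b hb) hzb
  obtain ⟨w, ⟨e⟩⟩ := exists_quadraticAlgebra_equiv hA
  refine ⟨w, lam (e 1), lam (e QuadraticAlgebra.omega), b, hb,
    (e.symm : A →+* QuadraticAlgebra (AlgebraicClosure K) 0 w).comp (evalHom z hzb),
    fun c => ?_, fun s => ?_⟩
  · rw [RingHom.comp_apply, evalHom_consts _ z hzb _ hz]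
    exact e.symm.commutes _
  · rw [hlam]
    obtain ⟨u, hu⟩ := e.surjective (evalHom z hzb (quo (F.gen b hb) s))
    have hu' : ((e.symm : A →+* QuadraticAlgebra (AlgebraicClosure K) 0 w).comp (evalHom z hzb))
        (quo (F.gen b hb) s) = u := by
      rw [RingHom.comp_apply, ← hu]
      exact e.symm_apply_apply u
    rw [hu', ← hu]
    have h1 : u = u.re • 1 + u.im • QuadraticAlgebra.omega := by
      ext <;> simp [QuadraticAlgebra.re_one, QuadraticAlgebra.im_one]
    conv_lhs => rw [h1]
    rw [map_add, _root_.map_smul, _root_.map_smul, map_add, _root_.map_smul, _root_.map_smul,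
      smul_eq_mul, smul_eq_mul, mul_comm, mul_comm u.im]

theorem smul_mem_secantCone {ℓ : GlobalSections L →ₗ[K] AlgebraicClosure K}
    (hℓ : ℓ ∈ secantCone K L) (c : AlgebraicClosure K) : c • ℓ ∈ secantCone K L := by
  obtain ⟨A, iA, z, lam, hA, hz, hl, hs⟩ := hℓ
  refine ⟨A, iA, z, (AddMonoidHom.mulLeft c).comp lam, hA, hz, fun a m => ?_, fun s => ?_⟩
  · simp only [AddMonoidHom.comp_apply, AddMonoidHom.coe_mulLeft, hl]
    ring
  · simp [hs]

variable (K L) in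
/-- A global section of `L`, as a function on the cone over the secant variety. -/
noncomputable def onCone (s : GlobalSections L) : secantCone K L → AlgebraicClosure K :=
  fun ℓ => ℓ.1 s

end ProjectiveEmbedding

/-! ### Integrality over the coordinates of an embedding -/

namespace ProjectiveEmbedding

open AlgebraicGeometry.Scheme AlgebraicGeometry.Scheme.Modules

variable {K : Type u} [Field K] {X : Scheme.{u}} [X.Over (Base K)] {L : X.Modules} {r : ℕ}
  {ψ : X ⟶ ProjSpace K r}

/-- Sections of `L` are integral over the coordinates of an embedding, as functions on the cone
over the secant variety: the projection of the secant variety that an embedding defines is a finite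
morphism. -/
theorem Frame.isIntegralElem_onCone [Infinite K] [IsIntegral X] (F : Frame L ψ)
    (s : GlobalSections L) :
    (MvPolynomial.aeval (R := K) fun j => onCone K L (F.coord j)).toRingHom.IsIntegralElem
      (onCone K L s) := by
  refine isIntegralElem_of_forall_hom _ _ fun E _ φ O hO => ?_
  choose w α β b hb θ hθ hℓ using fun ℓ : secantCone K L => F.exists_quadratic ℓ.2
  choose N G hG hrel using fun k => F.exists_relation s k
  -- the values of sections on the subschemes of length two, as elements of one quadratic algebra
  -- over the ring of all functions on the cone
  let P : GlobalSections L → QuadraticAlgebra (secantCone K L → AlgebraicClosure K) 0 w :=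
    fun s => ⟨fun ℓ => (θ ℓ (quo (F.gen _ (hb ℓ)) s)).re,
      fun ℓ => (θ ℓ (quo (F.gen _ (hb ℓ)) s)).im⟩
  let ev : ∀ ℓ : secantCone K L, QuadraticAlgebra (secantCone K L → AlgebraicClosure K) 0 w →+*
      QuadraticAlgebra (AlgebraicClosure K) 0 (w ℓ) := fun ℓ => quadraticMap (Pi.evalRingHom _ ℓ) w
  have hev : ∀ u v, (∀ ℓ, ev ℓ u = ev ℓ v) → u = v := fun u v h =>
    QuadraticAlgebra.ext (funext fun ℓ => congrArg QuadraticAlgebra.re (h ℓ))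
      (funext fun ℓ => congrArg QuadraticAlgebra.im (h ℓ))
  have hevP : ∀ ℓ t, ev ℓ (P t) = θ ℓ (quo (F.gen _ (hb ℓ)) t) := fun ℓ t => rfl
  have honCone : ∀ t, onCone K L t = α * (P t).re + β * (P t).im := fun t =>
    funext fun ℓ => hℓ ℓ t
  let Q := quadraticMap φ w
  have hre : ∀ t, φ (onCone K L t) = φ α * (Q (P t)).re + φ β * (Q (P t)).im := fun t => by
    rw [honCone, map_add, map_mul, map_mul]
    rfl
  rw [hre]
  have hc : ∀ ℓ, ∃ c : Fin (r + 1) → K, ∑ j, MvPolynomial.C (c j) * MvPolynomial.X j = b ℓ := by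
    intro ℓ
    have h1 := hb ℓ
    rw [grading, MvPolynomial.homogeneousSubmodule_one_eq_span_X,
      Submodule.mem_span_range_iff_exists_fun] at h1
    obtain ⟨c, hc⟩ := h1
    exact ⟨c, by simpa only [MvPolynomial.smul_eq_C_mul] using hc⟩
  choose c hc using hc
  have hcoef : ∀ ℓ a, (ev ℓ) (algebraMap _ _
      (algebraMap K (secantCone K L → AlgebraicClosure K) a)) =
        θ ℓ (consts (X ↘ Base K) _ a) := fun ℓ a => by
    rw [hθ]
    exact quadraticMap_algebraMap _ _ _
  refine functional_mem_of_relations O (φ.comp (algebraMap K _)) (fun a => ?_)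
    (fun j => Q (P (F.coord j))) (Q (P s))
    (fun j => φ fun ℓ => algebraMap K _ (c ℓ j)) ?_ N G hG (fun k => ?_) (φ α) (φ β) (fun j => ?_)
  · have := hO (MvPolynomial.C a)
    simpa using this
  · have h1 : ∑ j, algebraMap _ (QuadraticAlgebra _ 0 w)
        (fun ℓ => algebraMap K (AlgebraicClosure K) (c ℓ j)) * P (F.coord j) = 1 := by
      refine hev _ _ fun ℓ => ?_
      have h2 := congrArg (fun g => θ ℓ (MvPolynomial.eval₂Hom (consts (X ↘ Base K) _)
        (fun j => quo (F.gen _ (hb ℓ)) (F.coord j)) g)) (hc ℓ)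
      rw [F.eval₂Hom_self (hb ℓ), map_one, map_sum, map_sum] at h2
      rw [map_one, ← h2, map_sum]
      refine Finset.sum_congr rfl fun j _ => ?_
      rw [map_mul, map_mul, map_mul, hevP, MvPolynomial.coe_eval₂Hom, MvPolynomial.eval₂_C,
        MvPolynomial.eval₂_X, hθ]
      congr 1
    have h2 := congrArg Q h1
    rw [map_one, map_sum] at h2
    rw [← h2]
    refine Finset.sum_congr rfl fun j _ => ?_
    rw [map_mul, quadraticMap_algebraMap]
  · have h1 : P s * P (F.coord k) ^ N k = (G k).eval₂
        ((algebraMap (secantCone K L → AlgebraicClosure K) _).comp (algebraMap K _))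
        fun j => P (F.coord j) := by
      refine hev _ _ fun ℓ => ?_
      have h2 := congrArg (θ ℓ) (hrel k _ (hb ℓ))
      rw [map_mul, map_pow, MvPolynomial.hom_eval₂] at h2
      rw [map_mul, map_pow, MvPolynomial.hom_eval₂, hevP, hevP, h2]
      congr 1
      exact RingHom.ext fun a => (hcoef ℓ a).symm
    have h2 := congrArg Q h1
    rw [map_mul, map_pow, MvPolynomial.hom_eval₂] at h2
    rw [h2]
    congr 1
    exact RingHom.ext fun a => quadraticMap_algebraMap _ _ _
  · rw [← hre]
    have := hO (MvPolynomial.X j)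
    simpa using this

/-- The coordinates of an embedding do not vanish simultaneously on the secant variety. -/
theorem Frame.eq_zero_of_coord [Infinite K] [IsIntegral X] (F : Frame L ψ)
    {ℓ : GlobalSections L →ₗ[K] AlgebraicClosure K} (hℓ : ℓ ∈ secantCone K L)
    (h0 : ∀ j, ℓ (F.coord j) = 0) : ℓ = 0 := by
  refine LinearMap.ext fun s => ?_
  by_contra hs
  obtain ⟨g, hg, hgs⟩ := F.isIntegralElem_onCone s
  -- the values at `s` of all multiples of `ℓ` satisfy the same monic equation over `K`
  let g' : Polynomial (AlgebraicClosure K) :=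
    g.map ((algebraMap K (AlgebraicClosure K)).comp MvPolynomial.constantCoeff)
  have hg' : g' ≠ 0 := (hg.map _).ne_zero
  have hroot : ∀ c : AlgebraicClosure K, g'.IsRoot (c * ℓ s) := by
    intro c
    let ℓ' : secantCone K L := ⟨c • ℓ, smul_mem_secantCone hℓ c⟩
    have h1 := congrArg (Pi.evalRingHom _ ℓ') hgs
    rw [Polynomial.hom_eval₂, map_zero] at h1
    rw [Polynomial.IsRoot, Polynomial.eval_map]
    refine Eq.trans ?_ h1
    congr 1
    refine MvPolynomial.ringHom_ext (fun a => ?_) fun j => ?_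
    · simp
    · have : onCone K L (F.coord j) ℓ' = 0 := by
        change c * ℓ (F.coord j) = 0
        rw [h0, mul_zero]
      simp [this]
  have hinj : Function.Injective fun c : AlgebraicClosure K => c * ℓ s :=
    mul_left_injective₀ hs
  have hsub : Set.range (fun c : AlgebraicClosure K => c * ℓ s) ⊆ {a | g'.IsRoot a} := by
    rintro _ ⟨c, rfl⟩
    exact hroot c
  have : Infinite (AlgebraicClosure K) :=
    Infinite.of_injective _ (algebraMap K (AlgebraicClosure K)).injective
  exact Set.infinite_range_of_injective hinj ((Polynomial.finite_setOfPred_isRoot hg').subset hsub)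

end ProjectiveEmbedding

/-! ### Krull dimension and general linear forms -/

namespace ProjectiveEmbedding

section KrullDimension

/-- Primes in a chain stay distinct after contraction along an integral homomorphism. -/
theorem ringKrullDim_le_of_isIntegral {A B : Type*} [CommRing A] [CommRing B] {f : A →+* B}
    (hf : f.IsIntegral) : ringKrullDim B ≤ ringKrullDim A := by
  algebraize [f]
  refine Order.krullDim_le_of_strictMono (PrimeSpectrum.comap f) fun P Q h => ?_
  exact Ideal.IsIntegral.comap_lt_comap (R := A) (A := B) (I := P.asIdeal) (J := Q.asIdeal) h

/-- Chains of primes lift along an injective integral homomorphism, by going up. -/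
theorem ringKrullDim_le_of_isIntegral_of_injective {A B : Type*} [CommRing A] [CommRing B]
    {f : A →+* B} (hf : f.IsIntegral) (hinj : Function.Injective f) :
    ringKrullDim A ≤ ringKrullDim B := by
  algebraize [f]
  refine iSup_le fun l => ?_
  obtain ⟨Q, -, hQ, hQl⟩ := Ideal.exists_ideal_over_prime_of_isIntegral (S := B) l.head.asIdeal
    (⊥ : Ideal B) (by
      intro a ha
      have : f a = 0 := ha
      rw [(map_eq_zero_iff f hinj).mp this]
      exact zero_mem _)
  have : Q.LiesOver l.head.asIdeal := ⟨hQl.symm⟩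
  obtain ⟨l', hl', -⟩ := Ideal.exists_ltSeries_of_hasGoingUp l Q
  rw [← hl']
  exact Order.LTSeries.length_le_krullDim l'

end KrullDimension

section LinearForms

open Polynomial

variable {K : Type*} [Field K] {ι : Type*}

/-- Over an infinite field, a linear form `a` can be chosen so that `a - c y` avoids finitely many
ideals that do not contain all variables. -/
theorem exists_linearForm_notMem [Infinite K] {κ : Type*} [Finite κ]
    (P : κ → Ideal (MvPolynomial ι K)[X]) (y : κ → MvPolynomial ι K)
    (hP : ∀ k, ∃ i, C (MvPolynomial.X i) ∉ P k) :
    ∃ a : MvPolynomial ι K, a.IsHomogeneous 1 ∧ ∀ k, C a - X * C (y k) ∉ P k := by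
  let E := MvPolynomial.homogeneousSubmodule ι K 1
  let f : κ → E × K →ₗ[K] (MvPolynomial ι K)[X] := fun k =>
    { toFun := fun v => C v.1.1 - v.2 • (X * C (y k))
      map_add' := fun v w => by simp [add_smul]; ring
      map_smul' := fun c v => by
        simp [mul_smul, smul_sub, Polynomial.smul_C] }
  -- the pairs `(a, c)` with `a - c X y ∈ P k` and those with `c = 0` are proper subspaces, and
  -- finitely many of these do not cover the space
  let p : Option κ → Subspace K (E × K) := fun o =>
    o.elim (LinearMap.ker (LinearMap.snd K E K))
      fun k => (Submodule.restrictScalars K (P k)).comap (f k)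
  by_contra! hn
  obtain ⟨o, ho⟩ := Subspace.exists_eq_top_of_iUnion_eq_univ (p := p) (by
    rw [Set.eq_univ_iff_forall]
    rintro ⟨⟨a, ha⟩, c⟩
    by_cases hc : c = 0
    · exact Set.mem_iUnion.mpr ⟨none, hc⟩
    · obtain ⟨k, hk⟩ := hn (c⁻¹ • a) (E.smul_mem _ ha)
      refine Set.mem_iUnion.mpr ⟨some k, ?_⟩
      have h1 : c • (C (c⁻¹ • a) - X * C (y k)) ∈ P k :=
        Submodule.smul_of_tower_mem (P k) c hk
      rw [smul_sub, Polynomial.smul_C, smul_smul, mul_inv_cancel₀ hc, one_smul] at h1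
      exact h1)
  cases o with
  | none =>
    have : ((0, 1) : E × K) ∈ p none := ho ▸ trivial
    exact one_ne_zero (α := K) this
  | some k =>
    obtain ⟨i, hi⟩ := hP k
    have : ((⟨MvPolynomial.X i, MvPolynomial.isHomogeneous_X K i⟩, 0) : E × K) ∈ p (some k) :=
      ho ▸ trivial
    refine hi ?_
    have h2 : C (MvPolynomial.X i) - (0 : K) • (X * C (y k)) ∈ P k := this
    rwa [zero_smul, sub_zero] at h2

/-- The ideal of the incidence locus, for `c` in the affine line: `I` together with the first `n`
of the equations `gᵢ = c yᵢ`. -/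
noncomputable def incidenceIdeal (I : Ideal (MvPolynomial ι K)) (g y : ℕ → MvPolynomial ι K)
    (n : ℕ) : Ideal (MvPolynomial ι K)[X] :=
  I.map C ⊔ Ideal.span ((fun i => C (g i) - X * C (y i)) '' Set.Iio n)

theorem incidenceIdeal_congr (I : Ideal (MvPolynomial ι K)) {g g' : ℕ → MvPolynomial ι K}
    (y : ℕ → MvPolynomial ι K) {n : ℕ} (h : ∀ i < n, g i = g' i) :
    incidenceIdeal I g y n = incidenceIdeal I g' y n := by
  rw [incidenceIdeal, incidenceIdeal]
  congr 2
  exact Set.image_congr fun i hi => by rw [h i hi]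

theorem incidenceIdeal_le_iff {I : Ideal (MvPolynomial ι K)} {g y : ℕ → MvPolynomial ι K}
    {n : ℕ} {P : Ideal (MvPolynomial ι K)[X]} :
    incidenceIdeal I g y n ≤ P ↔ I.map C ≤ P ∧ ∀ i < n, C (g i) - X * C (y i) ∈ P := by
  rw [incidenceIdeal, sup_le_iff, Ideal.span_le, Set.image_subset_iff]
  rfl

/-- Linear forms `gᵢ` such that each equation `gᵢ = c yᵢ` cuts down the dimension of the
locus defined by the previous ones, away from the vertex of the cone. -/
theorem exists_generic_sequence [Infinite K] [Finite ι] (I : Ideal (MvPolynomial ι K))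
    {κ : Type*} [Finite κ] (y : κ → ℕ → MvPolynomial ι K) (n : ℕ) :
    ∃ g : ℕ → MvPolynomial ι K, (∀ i, (g i).IsHomogeneous 1) ∧ ∀ i < n, ∀ k,
      ∀ P ∈ (incidenceIdeal I g (y k) i).minimalPrimes, (∃ j, C (MvPolynomial.X j) ∉ P) →
        C (g i) - X * C (y k i) ∉ P := by
  induction n with
  | zero => exact ⟨0, fun i => MvPolynomial.isHomogeneous_zero _ _ _, by simp⟩
  | succ n ih =>
    obtain ⟨g, hg, h⟩ := ih
    let T := Σ k, {P // P ∈ (incidenceIdeal I g (y k) n).minimalPrimes ∧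
      ∃ j, C (MvPolynomial.X j) ∉ P}
    have hfin : ∀ k, Finite {P // P ∈ (incidenceIdeal I g (y k) n).minimalPrimes ∧
        ∃ j, C (MvPolynomial.X j) ∉ P} := fun k =>
      ((Ideal.finite_minimalPrimes_of_isNoetherianRing _ (incidenceIdeal I g (y k) n)).subset
        fun P hP => hP.1).to_subtype
    obtain ⟨a, ha, haP⟩ := exists_linearForm_notMem (κ := T) (fun t => t.2.1)
      (fun t => y t.1 n) fun t => t.2.2.2
    have hne : ∀ i < n, Function.update g n a i = g i := fun i hi =>
      Function.update_of_ne hi.ne _ _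
    refine ⟨Function.update g n a, fun i => ?_, fun i hi k P hP hj => ?_⟩
    · obtain rfl | hi := eq_or_ne i n
      · rwa [Function.update_self]
      · rw [Function.update_of_ne hi]; exact hg i
    · rw [incidenceIdeal_congr I (y k) fun j hj => hne j (by omega)] at hP
      obtain rfl | hi' := eq_or_ne i n
      · rw [Function.update_self]
        exact haP ⟨k, P, hP, hj⟩
      · rw [hne i (by omega)]
        exact h i (by omega) k P hP hj

/-- The substitution `v ↦ τ v` of the variables by their multiples, with a new variable `τ`. -/
noncomputable def scaling (ι : Type*) (K : Type*) [Field K] :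
    (MvPolynomial ι K)[X] →+* (MvPolynomial ι K)[X][X] :=
  let κ : K →+* (MvPolynomial ι K)[X][X] := (C.comp C).comp MvPolynomial.C
  let θ : MvPolynomial ι K →+* (MvPolynomial ι K)[X][X] :=
    MvPolynomial.eval₂Hom κ fun i => X * C (C (MvPolynomial.X i))
  Polynomial.eval₂RingHom (S := (MvPolynomial ι K)[X][X]) θ (C X)

theorem scaling_X : scaling ι K X = C X := by
  simp [scaling]

theorem scaling_C_of_isHomogeneous {f : MvPolynomial ι K} {n : ℕ} (hf : f.IsHomogeneous n) :
    scaling ι K (C f) = X ^ n * C (C f) := by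
  have h1 : scaling ι K (C f) = f.eval₂ ((C.comp C).comp MvPolynomial.C)
      fun i => (X : (MvPolynomial ι K)[X][X]) * C (C (MvPolynomial.X i)) := by
    rw [scaling, Polynomial.coe_eval₂RingHom, Polynomial.eval₂_C, MvPolynomial.coe_eval₂Hom]
  rw [h1, eval₂_mul_of_isHomogeneous (A := (MvPolynomial ι K)[X][X]) hf]
  congr 1
  have h2 := MvPolynomial.hom_eval₂ (S₂ := (MvPolynomial ι K)[X][X]) f MvPolynomial.C (C.comp C)
    MvPolynomial.X
  rw [MvPolynomial.eval₂_eta] at h2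
  exact h2.symm

/-- If the cone defined by `I` has dimension at most `r`, then for general linear forms
`g₀, …, g_r` the equations `gᵢ = c yᵢ` have no solution `(v, c)` with `v` in the cone but the vertex
`v = 0`.  Otherwise, there is a prime ideal of the incidence locus that does not contain all
variables, and it can be made homogeneous.  Each of the `r + 1` equations cuts down the dimension,
and one further step leads to a prime ideal that contains all variables.  This is a chain of primes
longer than allowed by the dimension `r + 1` of the product of the cone with the affine line. -/
theorem exists_generic_linearForms [Infinite K] [Finite ι] (I : Ideal (MvPolynomial ι K))
    (hI : ∀ f ∈ I, ∀ n, MvPolynomial.homogeneousComponent n f ∈ I) {r : ℕ}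
    (hr : ringKrullDim (MvPolynomial ι K ⧸ I) ≤ r)
    {κ : Type*} [Finite κ] (y : κ → ℕ → MvPolynomial ι K) (hy : ∀ k i, (y k i).IsHomogeneous 1) :
    ∃ g : ℕ → MvPolynomial ι K, (∀ i, (g i).IsHomogeneous 1) ∧
      ∀ (k : κ) (P : Ideal (MvPolynomial ι K)[X]) [P.IsPrime], I.map C ≤ P →
        (∀ i < r + 1, C (g i) - X * C (y k i) ∈ P) → ∀ j, C (MvPolynomial.X j) ∈ P := by
  obtain ⟨g, hg, h⟩ := exists_generic_sequence I y (r + 1)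
  refine ⟨g, hg, fun k P hP hIP hgP => ?_⟩
  by_contra! hj
  obtain ⟨j, hj⟩ := hj
  let Z := PrimeSpectrum.zeroLocus (R := (MvPolynomial ι K)[X]) (I.map C)
  -- each equation increases the height by one
  have key : ∀ n ≤ r + 1, ∀ (Q : Ideal (MvPolynomial ι K)[X]) (hQ : Q.IsPrime) (hIQ : I.map C ≤ Q),
      (∀ i < n, C (g i) - X * C (y k i) ∈ Q) → C (MvPolynomial.X j) ∉ Q →
      (n : ℕ∞) ≤ Order.height (⟨⟨Q, hQ⟩, hIQ⟩ : Z) := by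
    intro n
    induction n with
    | zero => intros; simp
    | succ n ih =>
      intro hn Q hQ hIQ hgQ hjQ
      have hle : incidenceIdeal I g (y k) n ≤ Q :=
        incidenceIdeal_le_iff.mpr ⟨hIQ, fun i hi => hgQ i (by omega)⟩
      obtain ⟨Q', hQ', hQ'Q⟩ := Ideal.exists_minimalPrimes_le hle
      have hjQ' : C (MvPolynomial.X j) ∉ Q' := fun h => hjQ (hQ'Q h)
      obtain ⟨h1, h2⟩ := incidenceIdeal_le_iff.mp hQ'.1.2
      have h3 := h n (by omega) k Q' hQ' ⟨j, hjQ'⟩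
      have h4 := ih (by omega) Q' hQ'.1.1 h1 h2 hjQ'
      have h5 : (⟨⟨Q', hQ'.1.1⟩, h1⟩ : Z) < ⟨⟨Q, hQ⟩, hIQ⟩ :=
        lt_of_le_of_ne hQ'Q fun he => h3 (by
          have : Q' = Q := congrArg (fun z : Z => z.1.asIdeal) he
          rw [this]
          exact hgQ n (by omega))
      have h6 := Order.height_add_one_le h5
      push_cast
      exact (add_le_add_left h4 1).trans h6
  -- the largest ideal in `P` that is homogeneous in the variables: `f(τ v) ∈ P[τ]` for all its `f`
  let Q := (P.map (C : _ →+* (MvPolynomial ι K)[X][X])).comap (scaling ι K)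
  have hCP : (P.map (C : _ →+* (MvPolynomial ι K)[X][X])).IsPrime := Ideal.isPrime_map_C_of_isPrime
  have hQ : Q.IsPrime := Ideal.comap_isPrime _ _
  have hIQ : I.map C ≤ Q := by
    rw [Ideal.map_le_iff_le_comap]
    intro f hf
    change scaling ι K (C f) ∈ P.map C
    rw [← MvPolynomial.sum_homogeneousComponent f, map_sum, map_sum]
    refine sum_mem fun n _ => ?_
    rw [scaling_C_of_isHomogeneous (MvPolynomial.homogeneousComponent_isHomogeneous n f)]
    exact Ideal.mul_mem_left _ _ (Ideal.mem_map_of_mem _ (hIP (Ideal.mem_map_of_mem _ (hI f hf n))))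
  have hgQ : ∀ i < r + 1, C (g i) - X * C (y k i) ∈ Q := by
    intro i hi
    change scaling ι K (C (g i) - X * C (y k i)) ∈ P.map C
    have : scaling ι K (C (g i) - X * C (y k i)) = X * C (C (g i) - X * C (y k i)) := by
      rw [map_sub, map_mul, scaling_X, scaling_C_of_isHomogeneous (hg i),
        scaling_C_of_isHomogeneous (hy k i), map_sub, map_mul]
      ring
    rw [this]
    exact Ideal.mul_mem_left _ _ (Ideal.mem_map_of_mem _ (hgP i hi))
  have hsX : scaling ι K (C (MvPolynomial.X j)) = C (C (MvPolynomial.X j)) * X := by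
    rw [scaling_C_of_isHomogeneous (MvPolynomial.isHomogeneous_X K j), pow_one]
    exact mul_comm (X : (MvPolynomial ι K)[X][X]) _
  have hjQ : C (MvPolynomial.X j) ∉ Q := by
    intro hmem
    have h1 : scaling ι K (C (MvPolynomial.X j)) ∈ P.map C := hmem
    rw [hsX, Ideal.mem_map_C_iff] at h1
    have h2 := h1 1
    rw [Polynomial.coeff_C_mul_X, if_pos rfl] at h2
    exact hj h2
  -- the image of `P` in the vertex of the cone, by the substitution `τ = 0`
  let Q' := P.comap ((Polynomial.evalRingHom 0).comp (scaling ι K))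
  have hQ' : Q'.IsPrime := Ideal.comap_isPrime _ _
  have hQQ' : Q ≤ Q' := by
    intro f hf
    have h1 : scaling ι K f ∈ P.map C := hf
    rw [Ideal.mem_map_C_iff] at h1
    have h2 := h1 0
    rw [Polynomial.coeff_zero_eq_eval_zero] at h2
    exact h2
  have hjQ' : C (MvPolynomial.X j) ∈ Q' := by
    change Polynomial.eval 0 (scaling ι K (C (MvPolynomial.X j))) ∈ P
    rw [hsX]
    simp
  have h1 := key (r + 1) le_rfl Q hQ hIQ hgQ hjQ
  have h2 : (⟨⟨Q, hQ⟩, hIQ⟩ : Z) < ⟨⟨Q', hQ'⟩, hIQ.trans hQQ'⟩ :=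
    lt_of_le_of_ne hQQ' fun he => hjQ (by
      have : Q = Q' := congrArg (fun z : Z => z.1.asIdeal) he
      rw [this]
      exact hjQ')
  have h3 := (add_le_add_left h1 1).trans (Order.height_add_one_le h2)
  have h4 : ringKrullDim ((MvPolynomial ι K)[X] ⧸ I.map C) ≤ r + 1 := by
    let e := Ideal.polynomialQuotientEquivQuotientPolynomial I
    let f : (MvPolynomial ι K ⧸ I)[X] →+* (MvPolynomial ι K)[X] ⧸ I.map C := e
    refine (ringKrullDim_le_of_surjective (R := (MvPolynomial ι K ⧸ I)[X])
      (S := (MvPolynomial ι K)[X] ⧸ I.map C) f e.surjective).trans ?_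
    rw [Polynomial.ringKrullDim_of_isNoetherianRing]
    exact add_le_add_left hr 1
  rw [ringKrullDim_quotient] at h4
  have h5 := (Order.height_le_krullDim (⟨⟨Q', hQ'⟩, hIQ.trans hQQ'⟩ : Z)).trans h4
  have h6 : (((r + 1 : ℕ) : ℕ∞) + 1) ≤ ((r + 1 : ℕ) : ℕ∞) := by
    refine h3.trans ?_
    rw [← WithBot.coe_le_coe]
    exact_mod_cast h5
  have h7 : r + 1 + 1 ≤ r + 1 := by exact_mod_cast h6
  omega

end LinearForms

end ProjectiveEmbedding

/-! ### Isotopies in large dimension -/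

namespace ProjectiveEmbedding

open AlgebraicGeometry.Scheme AlgebraicGeometry.Scheme.Modules

variable {K : Type u} [Field K] {X : Scheme.{u}} [X.Over (Base K)] {L : X.Modules} {r : ℕ}
  {ι : Type*}

/-- The ideal of the projection of the cone over the secant variety that is given by a family of
global sections of `L`. -/
noncomputable def coneIdeal (y : ι → GlobalSections L) : Ideal (MvPolynomial ι K) :=
  RingHom.ker (MvPolynomial.aeval (R := K) fun j => onCone K L (y j))

theorem mem_coneIdeal_iff {y : ι → GlobalSections L} {f : MvPolynomial ι K} :
    f ∈ coneIdeal y ↔ ∀ ℓ ∈ secantCone K L, MvPolynomial.aeval (fun j => ℓ (y j)) f = 0 := by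
  rw [coneIdeal, RingHom.mem_ker, funext_iff, Subtype.forall]
  refine forall₂_congr fun ℓ hℓ => ?_
  have h1 : (Pi.evalAlgHom K (fun _ => AlgebraicClosure K) (⟨ℓ, hℓ⟩ : secantCone K L))
      (MvPolynomial.aeval (fun j => onCone K L (y j)) f) =
        MvPolynomial.aeval (fun j => ℓ (y j)) f := by
    refine AlgHom.congr_fun (φ₁ := (Pi.evalAlgHom K (fun _ => AlgebraicClosure K)
      (⟨ℓ, hℓ⟩ : secantCone K L)).comp (MvPolynomial.aeval fun j => onCone K L (y j))) ?_ f
    refine MvPolynomial.algHom_ext fun j => ?_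
    simp [onCone]
  rw [← h1]
  rfl

/-- The ideal `coneIdeal y` is homogeneous because the cone is stable under scaling. -/
theorem homogeneousComponent_mem_coneIdeal {y : ι → GlobalSections L} {f : MvPolynomial ι K}
    (hf : f ∈ coneIdeal y) (n : ℕ) : MvPolynomial.homogeneousComponent n f ∈ coneIdeal y := by
  rw [mem_coneIdeal_iff] at hf ⊢
  intro ℓ hℓ
  let a : ℕ → AlgebraicClosure K := fun n =>
    MvPolynomial.aeval (fun j => ℓ (y j)) (MvPolynomial.homogeneousComponent n f)
  let p : Polynomial (AlgebraicClosure K) :=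
    ∑ i ∈ Finset.range (f.totalDegree + 1), Polynomial.monomial i (a i)
  have : Infinite (AlgebraicClosure K) := IsAlgClosed.instInfinite
  have hp : p = 0 := by
    refine Polynomial.zero_of_eval_zero _ fun c => ?_
    have h1 := hf _ (smul_mem_secantCone hℓ c)
    rw [← MvPolynomial.sum_homogeneousComponent f, map_sum] at h1
    rw [Polynomial.eval_finsetSum, ← h1]
    refine Finset.sum_congr rfl fun i _ => ?_
    rw [Polynomial.eval_monomial, mul_comm]
    exact (eval₂_mul_of_isHomogeneous (MvPolynomial.homogeneousComponent_isHomogeneous i f)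
      (algebraMap K _) c fun j => ℓ (y j)).symm
  by_cases hn : n ≤ f.totalDegree
  · have h2 := congrArg (fun q => Polynomial.coeff q n) hp
    simp only [p, Polynomial.finsetSum_coeff, Polynomial.coeff_monomial, Finset.sum_ite_eq',
      Finset.mem_range, Polynomial.coeff_zero] at h2
    rwa [if_pos (by omega)] at h2
  · rw [MvPolynomial.homogeneousComponent_eq_zero _ _ (by omega), map_zero]

/-- A linear form in sections of `L` is a section of `L`. -/
theorem exists_section_of_isHomogeneous [Finite ι] (y : ι → GlobalSections L)
    {f : MvPolynomial ι K} (hf : f.IsHomogeneous 1) :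
    ∃ s : GlobalSections L, ∀ ℓ : GlobalSections L →ₗ[K] AlgebraicClosure K,
      ℓ s = MvPolynomial.aeval (fun j => ℓ (y j)) f := by
  have := Fintype.ofFinite ι
  have h1 : f ∈ MvPolynomial.homogeneousSubmodule ι K 1 := hf
  rw [MvPolynomial.homogeneousSubmodule_one_eq_span_X,
    Submodule.mem_span_range_iff_exists_fun] at h1
  obtain ⟨c, rfl⟩ := h1
  exact ⟨∑ j, c j • y j, fun ℓ => by simp⟩

section Isotopic

variable [Infinite K] [IsIntegral X]

/-- The straight line from the coordinates of an embedding to sections `s` avoids the secant variety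
if the equations `s = c x` have only the trivial solution on the projected cone. -/
theorem avoidsSecants_of_incidence [Finite ι] {ψ : X ⟶ ProjSpace K r} (F : Frame L ψ)
    (y : ι → GlobalSections L) (e : Fin (r + 1) → ι) (he : ∀ i, y (e i) = F.coord i)
    {g : ℕ → MvPolynomial ι K} {s : Fin (r + 1) → GlobalSections L}
    (hs : ∀ i, ∀ ℓ : GlobalSections L →ₗ[K] AlgebraicClosure K,
      ℓ (s i) = MvPolynomial.aeval (fun j => ℓ (y j)) (g i))
    (h : ∀ (P : Ideal (Polynomial (MvPolynomial ι K))) [P.IsPrime],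
      (coneIdeal y).map Polynomial.C ≤ P →
      (∀ i : Fin (r + 1), Polynomial.C (g i) - Polynomial.X *
        Polynomial.C (MvPolynomial.X (e i)) ∈ P) →
      ∀ j, Polynomial.C (MvPolynomial.X j) ∈ P) :
    AvoidsSecants (K := K) L F.coord fun i => s i - F.coord i := by
  intro ℓ hℓ t ht
  refine F.eq_zero_of_coord hℓ fun j => ?_
  obtain rfl | ht0 := eq_or_ne t 0
  · simpa using ht j
  -- `s = c x` at `ℓ`, with `c = (t - 1) / t`
  have hst : ∀ i, ℓ (s i) = (t - 1) / t * ℓ (F.coord i) := fun i => by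
    have := ht i
    rw [map_sub] at this
    field_simp
    linear_combination this
  let θ : Polynomial (MvPolynomial ι K) →+* AlgebraicClosure K :=
    Polynomial.eval₂RingHom (MvPolynomial.aeval (R := K) fun j => ℓ (y j)).toRingHom ((t - 1) / t)
  have hC : ∀ f, θ (Polynomial.C f) = MvPolynomial.aeval (fun j => ℓ (y j)) f := fun f =>
    Polynomial.eval₂_C _ _
  have hX : θ Polynomial.X = (t - 1) / t := Polynomial.eval₂_X _ _
  have hprime : (RingHom.ker θ).IsPrime := RingHom.ker_isPrime θ
  have h1 := h (RingHom.ker θ) ?_ (fun i => ?_) (e j)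
  · rw [RingHom.mem_ker, hC, MvPolynomial.aeval_X, he] at h1
    exact h1
  · rw [Ideal.map_le_iff_le_comap]
    intro f hf
    rw [Ideal.mem_comap, RingHom.mem_ker, hC]
    exact mem_coneIdeal_iff.mp hf ℓ hℓ
  · rw [RingHom.mem_ker, map_sub, map_mul, hC, hC, hX, ← hs, MvPolynomial.aeval_X, he, hst,
      sub_self]

/-- If the cone over the secant variety has dimension at most `r` after projection by the sections
that define two embeddings into `ℙ^r`, then these are isotopic: both can be moved along a
straight line to the embedding given by `r + 1` general linear combinations of the sections. -/
theorem algebraicallyIsotopic_of_ringKrullDim_le [IsProper (X ↘ Base K)]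
    {ψ ψ' : Embedding K X r} (F : Frame L ψ.hom) (F' : Frame L ψ'.hom)
    (hr : ringKrullDim (MvPolynomial (Fin (r + 1) ⊕ Fin (r + 1)) K ⧸
      coneIdeal (Sum.elim F.coord F'.coord)) ≤ r) :
    AlgebraicallyIsotopic ψ ψ' := by
  let e : Bool → Fin (r + 1) → Fin (r + 1) ⊕ Fin (r + 1) := fun b => if b then Sum.inl else Sum.inr
  -- the coordinates of either embedding; only the indices up to `r` matter
  let y : Bool → ℕ → MvPolynomial (Fin (r + 1) ⊕ Fin (r + 1)) K := fun b i =>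
    if h : i < r + 1 then MvPolynomial.X (e b ⟨i, h⟩) else 0
  have hy : ∀ b i, (y b i).IsHomogeneous 1 := by
    intro b i
    by_cases h : i < r + 1
    · simp only [y, dif_pos h]
      exact MvPolynomial.isHomogeneous_X _ _
    · simp only [y, dif_neg h]
      exact MvPolynomial.isHomogeneous_zero _ _ _
  obtain ⟨g, hg, h⟩ := exists_generic_linearForms (coneIdeal (Sum.elim F.coord F'.coord))
    (fun f hf n => homogeneousComponent_mem_coneIdeal hf n) hr y hy
  choose s hs using fun i => exists_section_of_isHomogeneous (Sum.elim F.coord F'.coord) (hg i)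
  have hgen : ∀ (b : Bool) (P : Ideal (Polynomial (MvPolynomial (Fin (r + 1) ⊕ Fin (r + 1)) K)))
      [P.IsPrime], (coneIdeal (Sum.elim F.coord F'.coord)).map Polynomial.C ≤ P →
      (∀ i : Fin (r + 1), Polynomial.C (g i) - Polynomial.X *
        Polynomial.C (MvPolynomial.X (e b i)) ∈ P) →
      ∀ j, Polynomial.C (MvPolynomial.X j) ∈ P := by
    intro b P _ hP hi
    refine h b P hP fun i hir => ?_
    simp only [y, dif_pos hir]
    exact hi ⟨i, hir⟩
  have h1 := avoidsSecants_of_incidence F (Sum.elim F.coord F'.coord) (e true) (fun i => rfl)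
    (g := g) (s := fun i => s i) (fun i => hs i) (hgen true)
  have h2 := avoidsSecants_of_incidence F' (Sum.elim F.coord F'.coord) (e false) (fun i => rfl)
    (g := g) (s := fun i => s i) (fun i => hs i) (hgen false)
  obtain ⟨φ₀, φ₁, hφ, hφ₀, hφ₁⟩ := exists_isotopy F h1
  obtain ⟨φ₀', φ₁', hφ', hφ₀', hφ₁'⟩ := exists_isotopy F' h2
  have ext : ∀ {φ φ' : Embedding K X r} {x : Fin (r + 1) → GlobalSections L},
      SecRep L φ.hom x → SecRep L φ'.hom x → φ = φ' := by
    rintro ⟨φ, i, hφ⟩ ⟨φ', i', hφ'⟩ x H H'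
    obtain rfl : φ = φ' := SecRep.hom_ext F hφ hφ' H H'
    rfl
  obtain rfl := ext hφ₀ F.secRep
  obtain rfl := ext hφ₀' F'.secRep
  have e1 : (F.coord + fun i : Fin (r + 1) => s i - F.coord i) = fun i : Fin (r + 1) => s i :=
    funext fun i => add_sub_cancel _ _
  have e2 : (F'.coord + fun i : Fin (r + 1) => s i - F'.coord i) = fun i : Fin (r + 1) => s i :=
    funext fun i => add_sub_cancel _ _
  rw [e1] at hφ₁
  rw [e2] at hφ₁'
  obtain rfl := ext hφ₁ hφ₁'
  exact .trans _ _ _ (.rel _ _ hφ) (.symm _ _ (.rel _ _ hφ'))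

end Isotopic

section Dimension

variable (K L) in
/-- The coordinate ring of the secant variety consists of functions on the cone over it. -/
theorem exists_injective_onCone :
    ∃ f : SecantCoordinateRing K L →ₐ[K] secantCone K L → AlgebraicClosure K,
      Function.Injective f ∧
        ∀ s, f (Ideal.Quotient.mk _ (SymmetricAlgebra.ι K _ s)) = onCone K L s := by
  let o : GlobalSections L →ₗ[K] secantCone K L → AlgebraicClosure K :=
    { toFun := onCone K L
      map_add' := fun s t => funext fun ℓ => map_add ℓ.1 s t
      map_smul' := fun c s => funext fun ℓ => LinearMap.map_smul ℓ.1 c s }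
  have hker : ∀ a, a ∈ secantIdeal K L ↔ SymmetricAlgebra.lift o a = 0 := by
    intro a
    simp only [secantIdeal, Ideal.mem_iInf, RingHom.mem_ker]
    rw [funext_iff, Subtype.forall]
    refine forall₂_congr fun ℓ hℓ => ?_
    have h1 : (Pi.evalAlgHom K (fun _ => AlgebraicClosure K) (⟨ℓ, hℓ⟩ : secantCone K L)).comp
        (SymmetricAlgebra.lift o) = SymmetricAlgebra.lift ℓ := by
      refine SymmetricAlgebra.algHom_ext (LinearMap.ext fun s => ?_)
      simp [o, onCone]
    rw [← h1]
    rfl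
  refine ⟨Ideal.Quotient.liftₐ _ (SymmetricAlgebra.lift o) fun a ha => (hker a).mp ha, ?_,
    fun s => ?_⟩
  · rw [injective_iff_map_eq_zero]
    intro a ha
    obtain ⟨a, rfl⟩ := Ideal.Quotient.mk_surjective a
    exact Ideal.Quotient.eq_zero_iff_mem.mpr ((hker a).mpr ha)
  · exact SymmetricAlgebra.lift_ι_apply _ _

variable (K) in
/-- The homomorphism from polynomials to the coordinate ring of the secant variety that is given
by a family of sections. -/
noncomputable def toCoordinateRing (y : ι → GlobalSections L) :
    MvPolynomial ι K →ₐ[K] SecantCoordinateRing K L :=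
  MvPolynomial.aeval fun j => Ideal.Quotient.mk _ (SymmetricAlgebra.ι K _ (y j))

/-- The coordinate ring of the projected cone is a subring of that of the secant variety. -/
theorem ker_toCoordinateRing (y : ι → GlobalSections L) :
    RingHom.ker (toCoordinateRing K y) = coneIdeal y := by
  obtain ⟨f, hf, hfo⟩ := exists_injective_onCone K L
  have h1 : f.comp (toCoordinateRing K y) = MvPolynomial.aeval fun j => onCone K L (y j) := by
    refine MvPolynomial.algHom_ext fun j => ?_
    simp [toCoordinateRing, hfo]
  ext a
  rw [coneIdeal, ← h1, RingHom.mem_ker, RingHom.mem_ker, AlgHom.comp_apply,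
    map_eq_zero_iff f hf]

/-- The truncated subtraction in the definition of `secantDim` only makes the hypothesis stronger.
-/
theorem ringKrullDim_le_of_secantDim_lt (h : secantDim K L < r) :
    ringKrullDim (SecantCoordinateRing K L) ≤ r := by
  rw [secantDim] at h
  generalize ringKrullDim (SecantCoordinateRing K L) = d at h
  induction d with
  | bot => exact bot_le
  | coe d =>
    have h1 : d - 1 < (r : ℕ∞) := WithBot.coe_lt_coe.mp h
    induction d with
    | top => simp at h1
    | coe d =>
      have h2 : d - 1 < r := by exact_mod_cast h1
      have h3 : d ≤ r := by omega
      exact_mod_cast h3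

theorem subsingleton_isotopyClasses (h : ∀ ψ ψ' : EmbL K L r, AlgebraicallyIsotopic ψ.1 ψ'.1) :
    Subsingleton (IsotopyClasses K L r) := by
  refine ⟨fun a b => ?_⟩
  induction a using Quotient.ind with | _ ψ
  induction b using Quotient.ind with | _ ψ'
  exact Quotient.sound (h ψ ψ')

variable [Infinite K] [IsIntegral X] {ψ : X ⟶ ProjSpace K r}

/-- The projection of the secant variety by the coordinates of an embedding is a finite morphism. -/
theorem Frame.isIntegral_toCoordinateRing (F : Frame L ψ) :
    (toCoordinateRing K F.coord).toRingHom.IsIntegral := by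
  obtain ⟨f, hf, hfo⟩ := exists_injective_onCone K L
  intro a
  obtain ⟨a, rfl⟩ := Ideal.Quotient.mk_surjective a
  induction a using SymmetricAlgebra.induction with
  | algebraMap c =>
    have : Ideal.Quotient.mk (secantIdeal K L) (algebraMap K _ c) =
        (toCoordinateRing K F.coord).toRingHom (algebraMap K _ c) :=
      ((toCoordinateRing K F.coord).commutes c).symm
    rw [this]
    exact RingHom.isIntegralElem_map _
  | mul a b ha hb => rw [map_mul]; exact RingHom.IsIntegralElem.mul _ ha hb
  | add a b ha hb => rw [map_add]; exact RingHom.IsIntegralElem.add _ ha hb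
  | ι s =>
    obtain ⟨g, hg, hgs⟩ := F.isIntegralElem_onCone s
    refine ⟨g, hg, hf ?_⟩
    have h1 : f.toRingHom.comp (toCoordinateRing K F.coord).toRingHom =
        (MvPolynomial.aeval (R := K) fun j => onCone K L (F.coord j)).toRingHom := by
      have h2 : f.comp (toCoordinateRing K F.coord) =
          MvPolynomial.aeval fun j => onCone K L (F.coord j) := by
        refine MvPolynomial.algHom_ext fun j => ?_
        simp [toCoordinateRing, hfo]
      rw [← h2]
      rfl
    rw [map_zero]
    refine (Polynomial.hom_eval₂ g (toCoordinateRing K F.coord).toRingHom f.toRingHom _).trans ?_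
    rw [h1]
    exact (congrArg (fun t => Polynomial.eval₂ _ t g) (hfo s)).trans hgs

theorem Frame.ringKrullDim_coordinateRing_le (F : Frame L ψ) :
    ringKrullDim (SecantCoordinateRing K L) ≤ r + 1 := by
  refine (ringKrullDim_le_of_isIntegral F.isIntegral_toCoordinateRing).trans ?_
  rw [MvPolynomial.ringKrullDim_of_isNoetherianRing, ringKrullDim_eq_zero_of_field, zero_add,
    Nat.card_eq_fintype_card, Fintype.card_fin]
  push_cast
  exact le_rfl

/-- A projection of the secant variety does not have larger dimension. -/
theorem Frame.ringKrullDim_coneIdeal_le (F : Frame L ψ) (y : ι → GlobalSections L)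
    (e : Fin (r + 1) → ι) (he : ∀ i, y (e i) = F.coord i) :
    ringKrullDim (MvPolynomial ι K ⧸ coneIdeal y) ≤ ringKrullDim (SecantCoordinateRing K L) := by
  have h1 : (toCoordinateRing K y).comp (MvPolynomial.rename e) = toCoordinateRing K F.coord := by
    refine MvPolynomial.algHom_ext fun j => ?_
    simp [toCoordinateRing, he]
  have h2 : (toCoordinateRing K y).toRingHom.IsIntegral := by
    refine RingHom.IsIntegral.tower_top (MvPolynomial.rename (R := K) e).toRingHom _ ?_
    have := F.isIntegral_toCoordinateRing
    rw [← h1] at this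
    exact this
  rw [← ker_toCoordinateRing y]
  have h3 : (RingHom.kerLift (toCoordinateRing K y).toRingHom).IsIntegral :=
    RingHom.IsIntegral.tower_top (Ideal.Quotient.mk _) _ h2
  exact ringKrullDim_le_of_isIntegral_of_injective h3 (RingHom.kerLift_injective _)

/-- If `X` embeds into `ℙ^r`, the dimension of its secant variety is at most `r`. -/
theorem Frame.secantDim_le (F : Frame L ψ) : secantDim K L ≤ r := by
  have h := F.ringKrullDim_coordinateRing_le
  rw [secantDim]
  generalize ringKrullDim (SecantCoordinateRing K L) = d at h
  induction d with
  | bot => exact bot_le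
  | coe d =>
    have h1 : d ≤ ((r + 1 : ℕ) : ℕ∞) := by
      rw [← WithBot.coe_le_coe]
      exact_mod_cast h
    have h2 : d - 1 ≤ (r : ℕ∞) := by
      rw [tsub_le_iff_right]
      exact_mod_cast h1
    exact WithBot.coe_le_coe.mpr h2

/-- Embeddings into a projective space of dimension larger than that of the secant variety are
isotopic. -/
theorem algebraicallyIsotopic_of_secantDim_lt [IsProper (X ↘ Base K)] (h : secantDim K L < r)
    (ψ ψ' : EmbL K L r) : AlgebraicallyIsotopic ψ.1 ψ'.1 := by
  obtain ⟨F⟩ := exists_frame ψ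
  obtain ⟨F'⟩ := exists_frame ψ'
  exact algebraicallyIsotopic_of_ringKrullDim_le F F'
    ((F.ringKrullDim_coneIdeal_le _ Sum.inl fun _ => rfl).trans (ringKrullDim_le_of_secantDim_lt h))

end Dimension

end ProjectiveEmbedding

/-! ### Parameters and transcendence degree -/

namespace ProjectiveEmbedding

section Parameters

/-- A *parameter* of a ring `B` over `κ : R → B`, with associated "derivative" `D`: every
`R`-derivation `δ` over a homomorphism `p` from `B` to a field satisfies `δ b = p (D b) · δ t`.  The
map `D` is not required to have any structure. -/
def IsParameter {R B : Type u} [CommRing R] [CommRing B] (κ : R →+* B) (t : B) (D : B → B) : Prop :=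
  ∀ (F : Type u) [Field F] (M : Type u) [AddCommGroup M] [Module F M] (p : B →+* F) (δ : B →+ M),
    (∀ a b, δ (a * b) = p a • δ b + p b • δ a) → (∀ c, δ (κ c) = 0) →
      ∀ b, δ b = p (D b) • δ t

/-- A standard smooth algebra of relative dimension one has a parameter, because its module of
Kähler differentials is free on one differential `dt`. -/
theorem exists_isParameter {R B : Type u} [CommRing R] [CommRing B] (κ : R →+* B)
    (hκ : κ.IsStandardSmoothOfRelativeDimension 1) : ∃ t D, IsParameter κ t D := by
  algebraize [κ]
  obtain ⟨ι, σ, _, _, P, hP⟩ := Algebra.IsStandardSmoothOfRelativeDimension.out (n := 1) (R := R)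
    (S := B)
  have h1 : Nat.card ((Set.range P.map)ᶜ : Set ι) = 1 := by
    have h2 := Set.ncard_add_ncard_compl (Set.range P.map)
    rw [← Nat.card_coe_set_eq, Nat.card_range_of_injective P.map_inj, ← Nat.card_coe_set_eq] at h2
    have h3 : Nat.card ι - Nat.card σ = 1 := hP
    omega
  obtain ⟨hs, ⟨i⟩⟩ := Nat.card_eq_one_iff_unique.mp h1
  refine ⟨P.val i, fun b => P.basisKaehler.repr (KaehlerDifferential.D R B b) i,
    fun F _ M _ _ p δ hδ hδκ b => ?_⟩
  let : Module B M := Module.compHom M p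
  let : Module R M := Module.compHom M κ
  have : IsScalarTower R B M := ⟨fun c b m => by
    rw [Algebra.smul_def, mul_smul]
    rfl⟩
  let d : Derivation R B M :=
    { toFun := δ
      map_add' := map_add δ
      map_smul' := fun c b => by
        rw [Algebra.smul_def, hδ]
        have h2 : δ (algebraMap R B c) = 0 := hδκ c
        rw [h2, smul_zero, add_zero]
        rfl
      map_one_eq_zero' := by
        have := hδκ 1
        rwa [map_one] at this
      leibniz' := fun a b => hδ a b }
  have := Fintype.ofFinite ((Set.range P.map)ᶜ : Set ι)
  have h2 := P.basisKaehler.sum_repr (KaehlerDifferential.D R B b)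
  rw [Fintype.sum_subsingleton _ i, Algebra.SubmersivePresentation.basisKaehler_apply] at h2
  have h3 := congrArg d.liftKaehlerDifferential h2
  rw [map_smul, Derivation.liftKaehlerDifferential_comp_D,
    Derivation.liftKaehlerDifferential_comp_D] at h3
  exact h3.symm

/-- At a field-valued point, all functions are algebraic over a parameter: the extension of fields
generated by the values is unramified. -/
theorem IsParameter.isAlgebraic {K B F : Type u} [Field K] [CommRing B] [Algebra K B]
    [Algebra.FiniteType K B] [Field F] [Algebra K F] {t : B} {D : B → B}
    (ht : IsParameter (algebraMap K B) t D) (χ : B →ₐ[K] F) (b : B) :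
    IsAlgebraic (Algebra.adjoin K {χ t}) (χ b) := by
  let F₀ := IntermediateField.adjoin K {χ t}
  obtain ⟨S, hS⟩ := Algebra.FiniteType.out (R := K) (A := B)
  let F₁ := IntermediateField.adjoin F₀ (χ '' S)
  have hχ : ∀ b, χ b ∈ F₁ := by
    intro b
    have h1 : χ b ∈ (Algebra.adjoin K (S : Set B)).map χ := ⟨b, by rw [hS]; trivial, rfl⟩
    rw [AlgHom.map_adjoin] at h1
    have h2 : Algebra.adjoin K (χ '' S) ≤ (F₁.restrictScalars K).toSubalgebra :=
      Algebra.adjoin_le (IntermediateField.subset_adjoin F₀ _)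
    exact h2 h1
  have hft : Algebra.EssFiniteType F₀ F₁ := by
    rw [IntermediateField.essFiniteType_iff]
    exact IntermediateField.fg_adjoin_of_finite (S.finite_toSet.image _)
  let p : B →+* F₁ := χ.toRingHom.codRestrict F₁.toSubring hχ
  let d := KaehlerDifferential.D F₀ F₁
  -- all differentials of `F₁` over `F₀` vanish, as `dt` does
  have h0 : ∀ b, d (p b) = 0 := by
    intro b
    have := ht F₁ (Ω[F₁⁄F₀]) p (d.toLinearMap.toAddMonoidHom.comp p.toAddMonoidHom)
      (fun a b => by
        change d (p (a * b)) = p a • d (p b) + p b • d (p a)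
        rw [map_mul, Derivation.leibniz])
      (fun c => by
        change d (p (algebraMap K B c)) = 0
        have : p (algebraMap K B c) = algebraMap F₀ F₁ (algebraMap K F₀ c) :=
          Subtype.ext (χ.commutes c)
        rw [this, Derivation.map_algebraMap]) b
    have h2 : d (p t) = 0 := by
      have : p t = algebraMap F₀ F₁ ⟨χ t, IntermediateField.subset_adjoin _ _ rfl⟩ := rfl
      rw [this, Derivation.map_algebraMap]
    refine this.trans ?_
    change p (D b) • d (p t) = 0
    rw [h2, smul_zero]
  have h1 : ∀ x (hx : x ∈ F₁), d ⟨x, hx⟩ = 0 := by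
    intro x hx
    induction hx using IntermediateField.adjoin_induction with
    | mem x hx =>
      obtain ⟨b, -, rfl⟩ := hx
      exact h0 b
    | algebraMap x => exact d.map_algebraMap x
    | add x y hx hy h h' =>
      refine (d.map_add ⟨x, hx⟩ ⟨y, hy⟩).trans ?_
      rw [h, h', add_zero]
    | mul x y hx hy h h' =>
      refine (d.leibniz ⟨x, hx⟩ ⟨y, hy⟩).trans ?_
      rw [h, h', smul_zero, smul_zero, add_zero]
    | inv x hx h =>
      refine (d.leibniz_inv ⟨x, hx⟩).trans ?_
      rw [h, smul_zero]
  have h2 : Algebra.FormallyUnramified F₀ F₁ := by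
    rw [Algebra.formallyUnramified_iff]
    refine subsingleton_of_forall_eq 0 fun x => ?_
    have hx : x ∈ Submodule.span F₁ (Set.range d) := by
      rw [KaehlerDifferential.span_range_derivation]; trivial
    have h3 : Submodule.span F₁ (Set.range d) ≤ ⊥ := by
      rw [Submodule.span_le]
      rintro _ ⟨y, rfl⟩
      exact h1 y.1 y.2
    exact h3 hx
  have h3 := (Algebra.FormallyUnramified.iff_isSeparable F₀ F₁).mp h2
  have h4 : IsAlgebraic F₀ (⟨χ b, hχ b⟩ : F₁) := (h3.isAlgebraic).isAlgebraic _
  have h5 : IsAlgebraic F₀ (χ b) := h4.algebraMap (A := F)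
  exact IntermediateField.isAlgebraic_adjoin_iff.mp h5

end Parameters

section TranscendenceDegree

open AlgebraicIndependent in
/-- The number of algebraically independent elements that are algebraic over `n` elements is at
most `n`. -/
theorem card_le_of_isAlgebraic_adjoin {K F : Type*} [Field K] [Field F] [Algebra K F] {s n : ℕ}
    {x : Fin s → F} (hx : AlgebraicIndependent K x) (τ : Fin n → F)
    (h : ∀ i, IsAlgebraic (Algebra.adjoin K (Set.range τ)) (x i)) : s ≤ n := by
  have h1 : (matroid K F).Indep (Set.range x) :=
    matroid_indep_iff.mpr (AlgebraicIndependent.coe_range hx)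
  have h2 : Set.range x ⊆ (matroid K F).closure (Set.range τ) := by
    rw [matroid_closure_eq]
    rintro _ ⟨i, rfl⟩
    exact h i
  have h3 := h1.encard_le_eRk_of_subset h2
  rw [Matroid.eRk_closure_eq] at h3
  have h4 := h3.trans (Matroid.eRk_le_encard _ _)
  rw [← Set.image_univ, ← Set.image_univ, hx.injective.encard_image] at h4
  have h5 := h4.trans (Set.encard_image_le _ _)
  simpa using h5

/-- The Krull dimension of the image of a polynomial ring in `E` is at most `n` if at every
field-valued point of `E` the image is algebraic over `n` elements. -/
theorem ringKrullDim_quotient_ker_le {K E : Type u} [Field K] [CommRing E] [Algebra K E]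
    {ι : Type*} [Finite ι] {n : ℕ} (φ : MvPolynomial ι K →ₐ[K] E) (τ : Fin n → E)
    (h : ∀ (F : Type u) [Field F] [Algebra K F] (χ : E →ₐ[K] F) (a),
      IsAlgebraic (Algebra.adjoin K (Set.range (χ ∘ τ))) (χ (φ a))) :
    ringKrullDim (MvPolynomial ι K ⧸ RingHom.ker φ) ≤ n := by
  cases subsingleton_or_nontrivial (MvPolynomial ι K ⧸ RingHom.ker φ) with
  | inl _ => rw [ringKrullDim_eq_bot_of_subsingleton]; exact bot_le
  | inr _ =>
  -- Noether normalization; the `s` variables stay independent at some field-valued point of `E`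
  obtain ⟨s, g, hg, hgi⟩ := exists_integral_inj_algHom_of_fg K (MvPolynomial ι K ⧸ RingHom.ker φ)
  refine (ringKrullDim_le_of_isIntegral hgi).trans ?_
  rw [MvPolynomial.ringKrullDim_of_isNoetherianRing, ringKrullDim_eq_zero_of_field, zero_add,
    Nat.card_fin]
  let f := (Ideal.kerLiftAlg φ).comp g
  have hf : Function.Injective f := (Ideal.kerLiftAlg_injective φ).comp hg
  obtain ⟨Q, hQ, hQ0⟩ := Ideal.exists_comap_eq_of_mem_minimalPrimes_of_injective
    (f := f.toRingHom) hf ⊥ (by rw [IsDomain.minimalPrimes_eq_singleton_bot]; rfl)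
  let χ : E →ₐ[K] FractionRing (E ⧸ Q) :=
    (IsScalarTower.toAlgHom K (E ⧸ Q) (FractionRing (E ⧸ Q))).comp (Ideal.Quotient.mkₐ K Q)
  have hχ : Function.Injective (χ.comp f) := by
    rw [injective_iff_map_eq_zero]
    intro a ha
    have h1 : Ideal.Quotient.mk Q (f a) = 0 :=
      IsFractionRing.injective (E ⧸ Q) (FractionRing (E ⧸ Q)) (ha.trans (map_zero _).symm)
    have h2 : f a ∈ Q := Ideal.Quotient.eq_zero_iff_mem.mp h1
    change a ∈ Q.comap f.toRingHom at h2
    rwa [hQ0] at h2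
  have hx : AlgebraicIndependent K fun i : Fin s => (χ.comp f) (MvPolynomial.X i) := by
    have : MvPolynomial.aeval (fun i : Fin s => (χ.comp f) (MvPolynomial.X i)) = χ.comp f :=
      MvPolynomial.algHom_ext fun i => MvPolynomial.aeval_X _ _
    rw [AlgebraicIndependent, this]
    exact hχ
  have hs := card_le_of_isAlgebraic_adjoin hx (χ ∘ τ) fun i => by
    obtain ⟨a, ha⟩ := Ideal.Quotient.mk_surjective (g (MvPolynomial.X i))
    have h1 : (χ.comp f) (MvPolynomial.X i) = χ (φ a) := by
      change χ (Ideal.kerLiftAlg φ (g (MvPolynomial.X i))) = _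
      rw [← ha]
      rfl
    rw [h1]
    exact h _ χ a
  exact_mod_cast hs

/-- The dimension of a finite union of closed subschemes is bounded by the dimensions of its
members. -/
theorem ringKrullDim_quotient_iInf_le {A κ : Type*} [CommRing A] [Finite κ] (I : κ → Ideal A)
    {n : ℕ} (h : ∀ c, ringKrullDim (A ⧸ I c) ≤ n) : ringKrullDim (A ⧸ ⨅ c, I c) ≤ n := by
  have := Fintype.ofFinite κ
  rw [ringKrullDim_quotient]
  refine iSup_le fun l => ?_
  have h1 : ⨅ c, I c ≤ l.head.1.asIdeal := l.head.2
  have h2 : Finset.univ.inf I ≤ l.head.1.asIdeal := by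
    rwa [Finset.inf_eq_iInf, iInf_congr fun c => iInf_pos (Finset.mem_univ c)]
  obtain ⟨c, -, hc⟩ := (Ideal.IsPrime.inf_le' l.head.1.2).mp h2
  refine le_trans ?_ (h c)
  rw [ringKrullDim_quotient]
  let l' : LTSeries (PrimeSpectrum.zeroLocus (I c : Set A)) :=
    { length := l.length
      toFun := fun i => ⟨(l i).1, hc.trans (l.head_le i)⟩
      step := fun i => l.step i }
  exact Order.LTSeries.length_le_krullDim l'

end TranscendenceDegree

end ProjectiveEmbedding

/-! ### The secant variety of a curve -/

namespace ProjectiveEmbedding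

open AlgebraicGeometry.Scheme AlgebraicGeometry.Scheme.Modules

section CurveBound

theorem IsParameter.comp_surjective {R S B : Type u} [CommRing R] [CommRing S] [CommRing B]
    {κ : R →+* B} {t : B} {D : B → B} (h : IsParameter κ t D) {f : S →+* R}
    (hf : Function.Surjective f) : IsParameter (κ.comp f) t D :=
  fun F _ M _ _ p δ hδ hδκ => h F M p δ hδ fun c => by
    obtain ⟨c, rfl⟩ := hf c
    exact hδκ c

open AlgebraicIndependent in
theorem isAlgebraic_adjoin_mono {K F : Type*} [Field K] [Field F] [Algebra K F] {s t : Set F}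
    (h : s ⊆ t) {x : F} (hx : IsAlgebraic (Algebra.adjoin K s) x) :
    IsAlgebraic (Algebra.adjoin K t) x := by
  have h1 : x ∈ (matroid K F).closure s := by
    rw [matroid_closure_eq]
    exact hx
  have h2 := (matroid K F).closure_subset_closure h h1
  rwa [matroid_closure_eq] at h2

variable {K : Type u} [Field K] {X : Scheme.{u}} [X.Over (Base K)] {L : X.Modules}

/-- If the cone over the secant variety is a finite union of images of families with four
parameters, i.e. a parameter for each of two points and two coefficients, its dimension is at most
four. -/
theorem ringKrullDim_quotient_coneIdeal_le {ι : Type*} {κ : Type*} [Finite ι] [Finite κ]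
    (y : ι → GlobalSections L) (B₁ B₂ : κ → Type u) [∀ c, CommRing (B₁ c)]
    [∀ c, CommRing (B₂ c)] [∀ c, Algebra K (B₁ c)] [∀ c, Algebra K (B₂ c)]
    [∀ c, Algebra.FiniteType K (B₁ c)] [∀ c, Algebra.FiniteType K (B₂ c)]
    (h₁ : ∀ c, ∃ t D, IsParameter (algebraMap K (B₁ c)) t D)
    (h₂ : ∀ c, ∃ t D, IsParameter (algebraMap K (B₂ c)) t D)
    (u : ∀ c, ι → B₁ c) (v : ∀ c, ι → B₂ c)
    (h : ∀ ℓ ∈ secantCone K L, ∃ c, ∃ (f₁ : B₁ c →ₐ[K] AlgebraicClosure K)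
      (f₂ : B₂ c →ₐ[K] AlgebraicClosure K) (α β : AlgebraicClosure K),
      ∀ j, ℓ (y j) = α * f₁ (u c j) + β * f₂ (v c j)) :
    ringKrullDim (MvPolynomial ι K ⧸ coneIdeal (K := K) y) ≤ 4 := by
  let T : κ → Type u := fun c => {ℓ : GlobalSections L →ₗ[K] AlgebraicClosure K //
    ℓ ∈ secantCone K L ∧ ∃ (f₁ : B₁ c →ₐ[K] AlgebraicClosure K)
      (f₂ : B₂ c →ₐ[K] AlgebraicClosure K) (α β : AlgebraicClosure K),
      ∀ j, ℓ (y j) = α * f₁ (u c j) + β * f₂ (v c j)}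
  let φ : ∀ c, MvPolynomial ι K →ₐ[K] (T c → AlgebraicClosure K) := fun c =>
    MvPolynomial.aeval fun j ℓ => ℓ.1 (y j)
  have hφ : ∀ c f (ℓ : T c), φ c f ℓ = MvPolynomial.aeval (fun j => ℓ.1 (y j)) f := by
    intro c f ℓ
    refine AlgHom.congr_fun (φ₁ := (Pi.evalAlgHom K (fun _ => AlgebraicClosure K) ℓ).comp (φ c))
      ?_ f
    refine MvPolynomial.algHom_ext fun j => ?_
    simp [φ]
  have hker : coneIdeal (K := K) y = ⨅ c, RingHom.ker (φ c) := by
    ext f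
    rw [mem_coneIdeal_iff, Ideal.mem_iInf]
    constructor
    · intro hf c
      rw [RingHom.mem_ker]
      funext ℓ
      rw [hφ]
      exact hf _ ℓ.2.1
    · intro hf ℓ hℓ
      obtain ⟨c, hc⟩ := h ℓ hℓ
      rw [← hφ c f ⟨ℓ, hℓ, hc⟩, (RingHom.mem_ker.mp (hf c))]
      rfl
  rw [hker]
  refine ringKrullDim_quotient_iInf_le _ fun c => ?_
  choose f₁ f₂ α β hℓ using fun ℓ : T c => ℓ.2.2
  obtain ⟨t₁, D₁, ht₁⟩ := h₁ c
  obtain ⟨t₂, D₂, ht₂⟩ := h₂ c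
  let g₁ : B₁ c →ₐ[K] (T c → AlgebraicClosure K) := AlgHom.pi f₁
  let g₂ : B₂ c →ₐ[K] (T c → AlgebraicClosure K) := AlgHom.pi f₂
  refine ringKrullDim_quotient_ker_le (φ c) ![g₁ t₁, g₂ t₂, α, β] fun F _ _ χ a => ?_
  set S := Set.range (χ ∘ ![g₁ t₁, g₂ t₂, α, β]) with hS
  have hS' : ∀ i, χ (![g₁ t₁, g₂ t₂, α, β] i) ∈ S := fun i => ⟨i, rfl⟩
  -- the elements of `F` that are algebraic over the four parameters
  let N : Subalgebra K F :=
    (Subalgebra.algebraicClosure (Algebra.adjoin K S) F).restrictScalars K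
  have hmem : ∀ x ∈ S, x ∈ N := fun x hx =>
    isAlgebraic_algebraMap (⟨x, Algebra.subset_adjoin hx⟩ : Algebra.adjoin K S)
  have hN : ∀ j, χ (φ c (MvPolynomial.X j)) ∈ N := by
    intro j
    have h1 : φ c (MvPolynomial.X j) = α * g₁ (u c j) + β * g₂ (v c j) := by
      funext ℓ
      rw [hφ, MvPolynomial.aeval_X]
      exact hℓ ℓ j
    rw [h1, map_add, map_mul, map_mul]
    refine N.add_mem (N.mul_mem (hmem _ (hS' 2)) ?_) (N.mul_mem (hmem _ (hS' 3)) ?_)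
    · exact isAlgebraic_adjoin_mono (Set.singleton_subset_iff.mpr (hS' 0))
        (ht₁.isAlgebraic (χ.comp g₁) (u c j))
    · exact isAlgebraic_adjoin_mono (Set.singleton_subset_iff.mpr (hS' 1))
        (ht₂.isAlgebraic (χ.comp g₂) (v c j))
  change χ (φ c a) ∈ N
  induction a using MvPolynomial.induction_on with
  | C a =>
    have : χ (φ c (MvPolynomial.C a)) = algebraMap K F a := by
      rw [← MvPolynomial.algebraMap_eq, AlgHom.commutes, AlgHom.commutes]
    rw [this]
    exact N.algebraMap_mem a
  | add p q hp hq => rw [map_add, map_add]; exact N.add_mem hp hq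
  | mul_X p j hp => rw [map_mul, map_mul]; exact N.mul_mem hp (hN j)

end CurveBound

section Charts

variable {K : Type u} [Field K]

/-- A smooth affine curve is covered by finitely many basic open sets that have a parameter. -/
theorem exists_finset_isParameter {Y : Scheme.{u}} (σ : Y ⟶ Base K)
    [SmoothOfRelativeDimension 1 σ] {V : Y.Opens} (hV : IsAffineOpen V) :
    ∃ s : Finset Γ(Y, V), Ideal.span (s : Set Γ(Y, V)) = ⊤ ∧
      ∀ g ∈ s, ∃ t D, IsParameter ((algebraMap Γ(Y, V) (Localization.Away g)).comp (consts σ V))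
        t D := by
  have h1 := HasRingHomProperty.appLE (@SmoothOfRelativeDimension 1) σ inferInstance
    ⟨⊤, isAffineOpen_top (Base K)⟩ ⟨V, hV⟩ (le_preimage_top σ V)
  obtain ⟨s, hs, h⟩ := (RingHom.locally_iff_finite _ _).mp h1
  refine ⟨s, hs, fun g hg => ?_⟩
  obtain ⟨t, D, ht⟩ := exists_isParameter _ (h g hg)
  have h2 : Function.Surjective (Scheme.ΓSpecIso (CommRingCat.of K)).inv.hom := fun a =>
    ⟨(Scheme.ΓSpecIso (CommRingCat.of K)).hom.hom a,
      congrArg (fun t => t.hom a) (Scheme.ΓSpecIso (CommRingCat.of K)).hom_inv_id⟩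
  exact ⟨t, D, ht.comp_surjective h2⟩

variable {X : Scheme.{u}} [X.Over (Base K)] {L : X.Modules} {r : ℕ}
  {ψ : X ⟶ ProjSpace K r}

/-- A morphism from the spectrum of a local ring `R` to the complement of a hyperplane section
factors through one of the standard charts; the two trivializations of `L` differ by a factor.
Locality is expressed by a homomorphism `π` to a field that detects units. -/
theorem Frame.exists_chart_hom (F : Frame L ψ) {b : MvPolynomial (Fin (r + 1)) K}
    (hb : b ∈ grading K r 1) {R : Type u} [CommRing R] (ρ : Γ(X, ψ ⁻¹ᵁ dPlus b) →+* R)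
    {F' : Type*} [Field F'] (π : R →+* F') (hπ : ∀ u, π u ≠ 0 → IsUnit u) :
    ∃ (k : Fin (r + 1)) (ρ' : Γ(X, ψ ⁻¹ᵁ dPlus (coordX K k)) →+* R) (e : R),
      (∀ s, ρ (quo (F.gen b hb) s) = e * ρ' (quo (F.gen _ (coordX_mem k)) s)) ∧
      ∀ a, ρ' (consts (X ↘ Base K) _ a) = ρ (consts (X ↘ Base K) _ a) := by
  -- the linear form `b` has the value `1`, so not all coordinates vanish at the closed point
  obtain ⟨k, hk⟩ : ∃ k, π (ρ (quo (F.gen b hb) (F.coord k))) ≠ 0 := by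
    by_contra! hn
    have h1 := congrArg (fun a => π (ρ a)) (F.eval₂Hom_self hb)
    simp only [map_one, MvPolynomial.coe_eval₂Hom, MvPolynomial.hom_eval₂] at h1
    have h2 : (fun j => π (ρ (quo (F.gen b hb) (F.coord j)))) = fun _ => 0 := funext hn
    have h3 := eval₂_mul_of_isHomogeneous (k := K) (G := b) (n := 1) hb
      (π.comp (ρ.comp (consts (X ↘ Base K) (ψ ⁻¹ᵁ dPlus b)))) 0 (fun _ => 1)
    simp only [pow_one, zero_mul, ← h2] at h3
    exact zero_ne_one (h3.symm.trans h1)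
  have hU := F.isAffineOpen hb
  let θ : Γ(X, ψ ⁻¹ᵁ dPlus b) ⟶ CommRingCat.of R := CommRingCat.ofHom ρ
  let y : Spec (CommRingCat.of R) ⟶ X := Spec.map θ ≫ hU.fromSpec
  have hyU : ⊤ ≤ y ⁻¹ᵁ (ψ ⁻¹ᵁ dPlus b) := top_le_preimage_fromSpec hU θ
  have hev : ∀ a, evalHom y hyU a = ρ a := evalHom_specMap_fromSpec hU θ
  have hyk : ⊤ ≤ y ⁻¹ᵁ (ψ ⁻¹ᵁ dPlus (coordX K k)) := by
    have h1 : IsUnit (y.pull _ ⊤ hyU (quo (F.gen b hb) (F.coord k))) := by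
      rw [pull_eq_of_evalHom, hev]
      exact (hπ _ hk).map _
    have h2 := Scheme.basicOpen_of_isUnit _ h1
    rw [basicOpen_pull] at h2
    intro p hp
    rw [← h2] at hp
    have h3 := hp.2
    rw [F.quo_coord, basicOpen_pull, basicOpen_frac] at h3
    exact h3.2.2
  refine ⟨k, evalHom y hyk, (Scheme.ΓSpecIso (CommRingCat.of R)).hom.hom (y.pull _ ⊤
    (le_preimage_inf y hyU hyk) (quo ((F.gen b hb).mono inf_le_left) (F.coord k))),
    fun s => ?_, fun a => ?_⟩
  · rw [← hev, evalHom, RingHom.comp_apply,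
      pull_quo_eq_mul (F.gen b hb) (F.gen _ (coordX_mem k)) y hyU hyk, map_mul]
    rfl
  · rw [← hev]
    simp only [evalHom, RingHom.comp_apply, pull_consts]

/-- The localization of the coordinate ring of a standard chart at a function. -/
abbrev ChartRing (ψ : X ⟶ ProjSpace K r) (s : ∀ k, Finset Γ(X, ψ ⁻¹ᵁ dPlus (coordX K k)))
    (c : Σ k, s k) : Type u := Localization.Away c.2.1

/-- The coordinate ring of a chart is an algebra over the ground field. -/
noncomputable abbrev chartRingAlgebra (ψ : X ⟶ ProjSpace K r)
    (s : ∀ k, Finset Γ(X, ψ ⁻¹ᵁ dPlus (coordX K k))) (c : Σ k, s k) :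
    Algebra K (ChartRing ψ s c) :=
  ((algebraMap _ (Localization.Away c.2.1)).comp
    (consts (X ↘ Base K) (ψ ⁻¹ᵁ dPlus (coordX K c.1)))).toAlgebra

/-- The factorization through one of finitely many charts that have a parameter. -/
theorem Frame.exists_chartRing_hom (F : Frame L ψ)
    {s : ∀ k, Finset Γ(X, ψ ⁻¹ᵁ dPlus (coordX K k))}
    (hs : ∀ k, Ideal.span (s k : Set Γ(X, ψ ⁻¹ᵁ dPlus (coordX K k))) = ⊤)
    {b : MvPolynomial (Fin (r + 1)) K}
    (hb : b ∈ grading K r 1) {R : Type u} [CommRing R] (ρ : Γ(X, ψ ⁻¹ᵁ dPlus b) →+* R)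
    {F' : Type*} [Field F'] (π : R →+* F') (hπ : ∀ u, π u ≠ 0 → IsUnit u) :
    ∃ (c : Σ k, s k) (f : ChartRing ψ s c →+* R) (e : R),
      (∀ t, ρ (quo (F.gen b hb) t) =
        e * f (algebraMap _ _ (quo (F.gen _ (coordX_mem c.1)) t))) ∧
      ∀ a, f (algebraMap _ _ (consts (X ↘ Base K) (ψ ⁻¹ᵁ dPlus (coordX K c.1)) a)) =
        ρ (consts (X ↘ Base K) _ a) := by
  obtain ⟨k, ρ', e, h1, h2⟩ := F.exists_chart_hom hb ρ π hπ
  obtain ⟨g, hg, hne⟩ : ∃ g ∈ s k, π (ρ' g) ≠ 0 := by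
    by_contra! hn
    have h3 : Ideal.span (s k : Set Γ(X, ψ ⁻¹ᵁ dPlus (coordX K k))) ≤ RingHom.ker (π.comp ρ') := by
      rw [Ideal.span_le]
      exact fun g hg => hn g hg
    rw [hs k] at h3
    have h4 : π.comp ρ' 1 = 0 := h3 (x := 1) trivial
    rw [map_one] at h4
    exact one_ne_zero h4
  refine ⟨⟨k, g, hg⟩, IsLocalization.Away.lift (S := Localization.Away g) g (hπ _ hne), e,
    fun t => ?_, fun a => ?_⟩
  · rw [h1, IsLocalization.Away.lift_eq]
  · rw [← h2, IsLocalization.Away.lift_eq]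

/-- The cone over the secant variety of a curve has dimension at most four.  Two points have two
parameters, and two coefficients make up a functional; for the tangent lines, one of the points is
replaced by the derivative with respect to a parameter. -/
theorem Frame.ringKrullDim_quotient_coneIdeal_le_four [Infinite K]
    [SmoothOfRelativeDimension 1 (X ↘ Base K)] (F : Frame L ψ) {ι : Type*} [Finite ι]
    (y : ι → GlobalSections L) : ringKrullDim (MvPolynomial ι K ⧸ coneIdeal (K := K) y) ≤ 4 := by
  have := SmoothOfRelativeDimension.smooth 1 (X ↘ Base K)
  choose s hs hpar using fun k => exists_finset_isParameter (X ↘ Base K)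
    (F.isAffineOpen (coordX_mem k))
  choose t D htD using fun c : Σ k, s k => hpar c.1 c.2.1 c.2.2
  let alg : ∀ c, Algebra K (ChartRing ψ s c) := chartRingAlgebra ψ s
  have hft : ∀ c, Algebra.FiniteType K (ChartRing ψ s c) := fun c => by
    have h1 : (algebraMap K (ChartRing ψ s c)).FiniteType :=
      RingHom.FiniteType.comp (RingHom.finiteType_algebraMap.mpr inferInstance)
        (finiteType_consts (X ↘ Base K) (F.isAffineOpen (coordX_mem c.1)))
    exact RingHom.finiteType_algebraMap.mp h1
  let x : ∀ c : Σ k, s k, ι → ChartRing ψ s c := fun c j =>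
    algebraMap _ _ (quo (F.gen _ (coordX_mem c.1)) (y j))
  -- the families are indexed by two charts and by the choice between a secant and a tangent line
  refine ringKrullDim_quotient_coneIdeal_le (κ := (Σ k, s k) × (Σ k, s k) × Bool) y
    (fun c => ChartRing ψ s c.1) (fun c => ChartRing ψ s c.2.1) (fun c => ⟨_, _, htD c.1⟩)
    (fun c => ⟨_, _, htD c.2.1⟩) (fun c => x c.1)
    (fun c j => if c.2.2 then D _ (x c.2.1 j) else x c.2.1 j) fun ℓ hℓ => ?_
  obtain ⟨w, α, β, b, hb, φ, hφ, hℓφ⟩ := F.exists_quadratic hℓ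
  by_cases hw : w = 0
  · -- a tangent vector: the coefficient at `e` is a derivation, so a multiple of the derivative
    subst hw
    have hunit : ∀ v : QuadraticAlgebra (AlgebraicClosure K) 0 0, pointZero 0 v ≠ 0 → IsUnit v := by
      intro v hv
      rw [QuadraticAlgebra.isUnit_iff_norm_isUnit]
      have : QuadraticAlgebra.norm v = pointZero 0 v * pointZero 0 v := by
        rw [QuadraticAlgebra.norm_def, pointZero_apply]
        ring
      rw [this]
      exact (mul_ne_zero hv hv).isUnit
    obtain ⟨c, f, e, h1, h2⟩ := F.exists_chartRing_hom hs hb φ (pointZero 0) hunit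
    let p : ChartRing ψ s c →ₐ[K] AlgebraicClosure K :=
      { (pointZero 0).comp f with
        commutes' := fun a => by
          refine (congrArg (pointZero 0) (h2 a)).trans ?_
          rw [hφ]
          rfl }
    let δ : ChartRing ψ s c →+ AlgebraicClosure K :=
      { toFun := fun v => (f v).im
        map_zero' := by rw [map_zero]; rfl
        map_add' := fun v v' => by rw [map_add]; rfl }
    have hδ : ∀ v, (f v).im = p (D c v) * (f (t c)).im :=
      htD c (AlgebraicClosure K) (AlgebraicClosure K) p δ
        (fun v v' => by
          change (f (v * v')).im = (f v).re * (f v').im + (f v').re * (f v).im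
          rw [map_mul, QuadraticAlgebra.im_mul]
          ring)
        (fun a => by
          refine (congrArg QuadraticAlgebra.im (h2 a)).trans ?_
          rw [hφ]
          rfl)
    refine ⟨⟨c, c, true⟩, p, p, α * e.re + β * e.im, β * e.re * (f (t c)).im, fun j => ?_⟩
    have hre : (f (x c j)).re = p (x c j) := rfl
    rw [hℓφ, h1]
    change α * (e * f (x c j)).re + β * (e * f (x c j)).im = _
    rw [QuadraticAlgebra.re_mul, QuadraticAlgebra.im_mul, hδ (x c j), hre]
    simp only [if_true]
    ring
  · -- two distinct points `p` and `q`: the coefficient at `e` is `(q - p) / w`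
    have hunit : ∀ v : AlgebraicClosure K, RingHom.id _ v ≠ 0 → IsUnit v := fun v hv =>
      isUnit_iff_ne_zero.mpr hv
    obtain ⟨c, f, e, h1, h2⟩ := F.exists_chartRing_hom hs hb ((pointZero w).comp φ)
      (RingHom.id _) hunit
    obtain ⟨c', f', e', h1', h2'⟩ := F.exists_chartRing_hom hs hb ((pointOmega w).comp φ)
      (RingHom.id _) hunit
    let p : ChartRing ψ s c →ₐ[K] AlgebraicClosure K :=
      { f with
        commutes' := fun a => by
          refine (h2 a).trans ?_
          rw [RingHom.comp_apply, hφ, pointZero_apply]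
          rfl }
    let q : ChartRing ψ s c' →ₐ[K] AlgebraicClosure K :=
      { f' with
        commutes' := fun a => by
          refine (h2' a).trans ?_
          rw [RingHom.comp_apply, hφ, pointOmega_apply, QuadraticAlgebra.algebraMap_eq]
          simp }
    refine ⟨⟨c, c', false⟩, p, q, (α - β / w) * e, β / w * e', fun j => ?_⟩
    have h3 : (φ (quo (F.gen b hb) (y j))).re = e * p (x c j) := h1 (y j)
    have h4 : (φ (quo (F.gen b hb) (y j))).re + w * (φ (quo (F.gen b hb) (y j))).im =
      e' * q (x c' j) := h1' (y j)
    rw [hℓφ]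
    change _ = (α - β / w) * e * p (x c j) + β / w * e' * q (x c' j)
    rw [mul_assoc, ← h3, mul_assoc, ← h4]
    field_simp
    ring

end Charts

end ProjectiveEmbedding

/-! ### Isotopy classes of embeddings -/

open ProjectiveEmbedding

theorem mainTheorem8 (K : Type u) [Field K] [Infinite K]
    (X : Scheme.{u}) [X.Over (Base K)] [IsProjectiveVariety K X]
    (L : X.Modules) (hL : IsLineBundle L) (r : ℕ) :
    (secantDim K L < r → ∀ ψ ψ' : EmbL K L r, AlgebraicallyIsotopic ψ.1 ψ'.1) ∧
    (secantDim K L ≠ r → Subsingleton (IsotopyClasses K L r)) ∧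
    (IsCurve K X → 4 ≤ r → Subsingleton (IsotopyClasses K L r)) := by
  have : IsIntegral X := IsProjectiveVariety.isIntegral K
  have : IsProper (X ↘ Base K) := IsProjectiveVariety.isProper
  refine ⟨algebraicallyIsotopic_of_secantDim_lt, fun hne => subsingleton_isotopyClasses
    fun ψ ψ' => ?_, fun hX hr => subsingleton_isotopyClasses fun ψ ψ' => ?_⟩
  · obtain ⟨F⟩ := exists_frame ψ
    exact algebraicallyIsotopic_of_secantDim_lt (lt_of_le_of_ne F.secantDim_le hne) ψ ψ'
  · obtain ⟨F⟩ := exists_frame ψ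
    obtain ⟨F'⟩ := exists_frame ψ'
    have := hX.smooth
    refine algebraicallyIsotopic_of_ringKrullDim_le F F'
      ((F.ringKrullDim_quotient_coneIdeal_le_four _).trans ?_)
    exact_mod_cast hr
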